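/- Let $d\ge 1$ and let $\nu$ be a Borel measure on $\mathbb{R}^d$ such that $\nu(\{0\})=0$, $\int_{\mathbb{R}^d}(1\wedge|y|^2)\,\nu(dy)<\infty$, and $\nu(B)=\nu(-B)$ for all Borel sets $B\subset\mathbb{R}^d$. Put $\psi(\xi)=\int_{\mathbb{R}^d}(1-\cos(\xi\cdot y))\,\nu(dy)$ for $\xi\in\mathbb{R}^d$, and assume the Hartman–Wintner condition $$\lim_{|\xi|\to\infty}\frac{\psi(\xi)}{\log|\xi|}=\infty .$$ For $t>0$ and $x\in\mathbb{R}^d$ let $$p_t(x)=(2\pi)^{-d}\int_{\mathbb{R}^d}e^{-i\xi\cdot x}e^{-t\psi(\xi)}\,d\xi,\qquad P_tf(x)=\int_{\mathbb{R}^d}p_t(y-x)f(y)\,dy,$$ so that $(P_t)$ is the semigroup of the symmetric pure-jump Lévy process with Lévy measure $\nu$. For $1<p<\infty$ and $a,b\in\mathbb{R}$ let $$F(a,b)=|b|^p-|a|^p-p\,a|a|^{p-2}(b-a)\ \ge 0,$$ where $a|a|^{p-2}:=0$ if $a=0$. If $1<p<\infty$ and $f\in L^p(\mathbb{R}^d)$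 is real-valued, then $$\int_{\mathbb{R}^d}|f(x)|^p\,dx=\int_0^\infty\int_{\mathbb{R}^d}\int_{\mathbb{R}^d}F\big(P_tf(x),P_tf(x+y)\big)\,\nu(dy)\,dx\,dt .$$ -/

import Mathlib

open MeasureTheory Filter

noncomputable section

namespace HardyStein

/-- A Lévy measure on `ℝ^d`: no mass at the origin, and `min (1, |y|^2)` has a finite integral. -/
structure IsLevyMeasure {d : ℕ} (ν : Measure (EuclideanSpace ℝ (Fin d))) : Prop where
  zero : ν {0} = 0
  lintegral_lt_top : ∫⁻ y, ENNReal.ofReal (min 1 (‖y‖ ^ 2)) ∂ν < ⊤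

/-- Symmetry: `ν B = ν (-B)` for all Borel sets `B`. -/
def IsSymm {d : ℕ} (ν : Measure (EuclideanSpace ℝ (Fin d))) : Prop :=
  ∀ B : Set (EuclideanSpace ℝ (Fin d)), MeasurableSet B → ν B = ν ((fun y => -y) ⁻¹' B)

/-- The Lévy-Khintchine exponent `ψ(ξ) = ∫ (1 - cos (ξ · y)) ν(dy)`. -/
def exponent {d : ℕ} (ν : Measure (EuclideanSpace ℝ (Fin d))) (ξ : EuclideanSpace ℝ (Fin d)) : ℝ :=
  ∫ y, (1 - Real.cos (inner ℝ ξ y)) ∂ν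

/-- The Hartman-Wintner condition: `ψ(ξ) / log |ξ| → ∞` as `|ξ| → ∞`. -/
def HartmanWintner {d : ℕ} (ν : Measure (EuclideanSpace ℝ (Fin d))) : Prop :=
  Tendsto (fun ξ : EuclideanSpace ℝ (Fin d) => exponent ν ξ / Real.log ‖ξ‖)
    (comap (fun ξ => ‖ξ‖) atTop) atTop

/-- The transition density
`p_t(x) = (2π)^{-d} ∫ e^{-i ξ·x} e^{-t ψ(ξ)} dξ`, that is, the density with characteristic
function `e^{-t ψ}`. The integral is real because `ψ` is even; `re` only changes the type. -/
def density {d : ℕ} (ν : Measure (EuclideanSpace ℝ (Fin d))) (t : ℝ)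
    (x : EuclideanSpace ℝ (Fin d)) : ℝ :=
  ((2 * Real.pi) ^ d)⁻¹ *
    (∫ ξ : EuclideanSpace ℝ (Fin d),
      Complex.exp (-(Complex.I * ((inner ℝ ξ x : ℝ) : ℂ))) *
        Complex.exp (-((t * exponent ν ξ : ℝ) : ℂ))).re

/-- The semigroup `P_t f(x) = ∫ p_t(y - x) f(y) dy`, for `t > 0`. -/
def semigroup {d : ℕ} (ν : Measure (EuclideanSpace ℝ (Fin d))) (t : ℝ)
    (f : EuclideanSpace ℝ (Fin d) → ℝ) (x : EuclideanSpace ℝ (Fin d)) : ℝ :=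
  ∫ y, density ν t (y - x) * f y

/-- The second-order Taylor remainder `F(a,b)` of `x ↦ |x|^p`. -/
def taylorRem (p a b : ℝ) : ℝ :=
  |b| ^ p - |a| ^ p - p * a * |a| ^ (p - 2) * (b - a)

/-- `F` is nonnegative, so that `ENNReal.ofReal (taylorRem p a b)` loses nothing. -/
theorem taylorRem_nonneg {p : ℝ} (hp : 1 < p) (a b : ℝ) : 0 ≤ taylorRem p a b := by
  have h0 : 0 < p := by linarith
  by_cases ha : a = 0
  · subst ha
    simp only [taylorRem, abs_zero, Real.zero_rpow h0.ne']
    have := Real.rpow_nonneg (abs_nonneg b) p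
    simpa using this
  have hpos : 0 < |a| := abs_pos.2 ha
  have hpq := Real.HolderConjugate.conjExponent hp
  have hy := Real.young_inequality_of_nonneg (abs_nonneg b)
    (Real.rpow_nonneg hpos.le (p - 1)) hpq
  have hq : (|a| ^ (p - 1)) ^ p.conjExponent = |a| ^ p := by
    rw [← Real.rpow_mul hpos.le]
    congr 1
    unfold Real.conjExponent
    have : p - 1 ≠ 0 := by linarith
    field_simp
  rw [hq] at hy
  have h1 : |a| ^ (p - 1) = |a| * |a| ^ (p - 2) := by
    rw [← Real.rpow_one_add' hpos.le (by linarith)]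
    congr 1
    ring
  have h2 : |a| ^ p = a * a * |a| ^ (p - 2) := by
    rw [← abs_mul_abs_self a, mul_assoc, ← h1, ← Real.rpow_one_add' hpos.le (by linarith)]
    congr 1
    ring
  have h3 : p * (|a| ^ p / p.conjExponent) = (p - 1) * |a| ^ p := by
    unfold Real.conjExponent
    have : p - 1 ≠ 0 := by linarith
    field_simp
  have h4 : p * (|b| ^ p / p) = |b| ^ p := by field_simp
  have h5 : p * (|b| * |a| ^ (p - 1)) ≤ |b| ^ p + (p - 1) * |a| ^ p := by
    have := mul_le_mul_of_nonneg_left hy h0.le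
    rw [mul_add, h3, h4] at this
    exact this
  have h6 : a * b * |a| ^ (p - 2) ≤ |b| * |a| ^ (p - 1) := by
    rw [h1, ← mul_assoc, mul_comm |b|, ← abs_mul]
    exact mul_le_mul_of_nonneg_right (le_abs_self _) (Real.rpow_nonneg hpos.le _)
  have h7 := mul_le_mul_of_nonneg_left h6 h0.le
  have h8 : taylorRem p a b
      = |b| ^ p + (p - 1) * |a| ^ p - p * (a * b * |a| ^ (p - 2)) := by
    unfold taylorRem
    rw [h2]
    ring
  rw [h8]
  linarith

end HardyStein

end

/-! Write `u = P_t f`. The generator acts by `L u(x) = 1/2 ∫ (u(x+y) + u(x-y) - 2 u(x)) ν(dy)`, and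
formally `d/dt ∫ |u|^p = p ∫ u |u|^(p-2) L u`. When `F(u(x), u(x+y))` is integrated over `x`, the
terms `|u(x+y)|^p` and `|u(x)|^p` cancel by translation invariance, so only `-p ∫ u |u|^(p-2)
(u(x+y) - u(x)) dx` remains. Averaging over `y` and `-y` and using the symmetry of `ν` gives `-p ∫ u
|u|^(p-2) L u = ∫∫ F(u(x), u(x+y)) ν(dy) dx`. It remains to integrate over `(s, T]` and to let `s →
0`, where `‖P_s f‖_p → ‖f‖_p`, and `T → ∞`, where `‖P_T f‖_p → 0`.

The work lies in justifying this for every `f` in `L^p`. All of it rests on one estimate,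
`Decay.exists_integral_abs_secondDiff_density_le`: the symmetric second difference of `p_t` with
step `y` has `L¹` norm at most `C min(1, |y|²)`, uniformly in `t ≥ t₁ > 0`. Since `min(1, |y|²)` is
`ν`-integrable, `∂_t p_t` is then an `L¹` kernel, Young's inequality moves the bounds to `P_t f` in
`L^p`, and the uses of Fubini's theorem become absolutely convergent.

For the estimate, `p_t` is factored as `q * (q * r)`, where `q` is the density produced by the jumps
smaller than 1 during a fixed time. A second difference of a convolution is, up to sign, the
convolution of two first differences, so it is enough that `‖q(· + y) - q‖₁ ≤ C |y|`. A nonnegative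
function with bounded second derivatives has a Lipschitz square root, whence `|q(x+y) - q(x)| ≤ √M
|y| (√q(x+y) + √q(x))`; and `√q` is integrable because jumps of bounded size give `q` all
exponential moments. The Hartman–Wintner condition enters through the integrability of `(1 + |ξ|²)
e^{-tψ(ξ)}`, which supplies the bound on second derivatives.

Nonnegativity and exponential moments of these densities are obtained together: `e^{-ψ}` is a limit
of characteristic functions of random walks, first through compound Poisson laws and then by
restoring the small jumps. Gaussian regularisation makes the intermediate laws invertible, and
Fatou's lemma carries the bounds to the limit. -/

noncomputable section

namespace HardyStein

open scoped Topology ENNReal FourierTransform Convolution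

variable {d : ℕ} {ν : Measure (EuclideanSpace ℝ (Fin d))}

/-! ### Lévy measures and their exponents -/

theorem one_sub_cos_nonneg (x : ℝ) : 0 ≤ 1 - Real.cos x := by
  linarith [Real.cos_le_one x]

theorem one_sub_cos_le_sq (x : ℝ) : 1 - Real.cos x ≤ x ^ 2 / 2 := by
  linarith [Real.one_sub_sq_div_two_le_cos (x := x)]

/-- The factor covers both regimes: the trivial bound 2 for `|y| ≥ 1`, and `|ξ|² |y|² / 2` near the
origin. The resulting quadratic growth of `ψ` is matched by the weight `1 + |ξ|²` in `Decay`. -/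
theorem one_sub_cos_inner_le (ξ y : EuclideanSpace ℝ (Fin d)) :
    1 - Real.cos (inner ℝ ξ y) ≤ (2 + ‖ξ‖ ^ 2) * min 1 (‖y‖ ^ 2) := by
  rcases le_total 1 (‖y‖ ^ 2) with h | h
  · rw [min_eq_left h]
    nlinarith [Real.neg_one_le_cos (inner ℝ ξ y), sq_nonneg ‖ξ‖]
  · rw [min_eq_right h]
    have h1 := one_sub_cos_le_sq (inner ℝ ξ y)
    have h2 : (inner ℝ ξ y) ^ 2 ≤ ‖ξ‖ ^ 2 * ‖y‖ ^ 2 := by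
      rw [← mul_pow, ← sq_abs]
      exact pow_le_pow_left₀ (abs_nonneg _) (abs_real_inner_le_norm ξ y) 2
    nlinarith [sq_nonneg ‖y‖, mul_nonneg (sq_nonneg ‖ξ‖) (sq_nonneg ‖y‖)]

theorem min_one_sq_nonneg (y : EuclideanSpace ℝ (Fin d)) : 0 ≤ min 1 (‖y‖ ^ 2) :=
  le_min zero_le_one (sq_nonneg _)

theorem continuous_min_one_sq :
    Continuous fun y : EuclideanSpace ℝ (Fin d) => min 1 (‖y‖ ^ 2) := by fun_prop

theorem IsLevyMeasure.integrable_min (hν : IsLevyMeasure ν) :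
    Integrable (fun y => min 1 (‖y‖ ^ 2)) ν := by
  refine ⟨continuous_min_one_sq.aestronglyMeasurable, ?_⟩
  rw [hasFiniteIntegral_iff_ofReal (ae_of_all _ min_one_sq_nonneg)]
  exact hν.lintegral_lt_top

theorem IsLevyMeasure.integrable_one_sub_cos (hν : IsLevyMeasure ν)
    (ξ : EuclideanSpace ℝ (Fin d)) :
    Integrable (fun y => 1 - Real.cos (inner ℝ ξ y)) ν := by
  refine (hν.integrable_min.const_mul (2 + ‖ξ‖ ^ 2)).mono'
    (by fun_prop : Continuous _).aestronglyMeasurable (ae_of_all _ fun y => ?_)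
  rw [Real.norm_eq_abs, abs_of_nonneg (one_sub_cos_nonneg _)]
  exact one_sub_cos_inner_le ξ y

theorem exponent_nonneg (ξ : EuclideanSpace ℝ (Fin d)) : 0 ≤ exponent ν ξ :=
  integral_nonneg fun _ => one_sub_cos_nonneg _

theorem exponent_zero : exponent ν 0 = 0 := by simp [exponent]

theorem exponent_neg (ξ : EuclideanSpace ℝ (Fin d)) : exponent ν (-ξ) = exponent ν ξ := by
  simp [exponent]

theorem IsLevyMeasure.exponent_le (hν : IsLevyMeasure ν) (ξ : EuclideanSpace ℝ (Fin d)) :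
    exponent ν ξ ≤ (2 + ‖ξ‖ ^ 2) * ∫ y, min 1 (‖y‖ ^ 2) ∂ν := by
  rw [← integral_const_mul]
  exact integral_mono (hν.integrable_one_sub_cos ξ) (hν.integrable_min.const_mul _)
    fun y => one_sub_cos_inner_le ξ y

theorem IsLevyMeasure.continuous_exponent (hν : IsLevyMeasure ν) : Continuous (exponent ν) := by
  rw [continuous_iff_continuousAt]
  intro ξ₀
  refine continuousAt_of_dominated (bound := fun y => (2 + (‖ξ₀‖ + 1) ^ 2) * min 1 (‖y‖ ^ 2))
    (Eventually.of_forall fun ξ => (by fun_prop : Continuous _).aestronglyMeasurable) ?_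
    (hν.integrable_min.const_mul _) (ae_of_all _ fun y => by fun_prop)
  filter_upwards [Metric.ball_mem_nhds ξ₀ one_pos] with ξ hξ
  refine ae_of_all _ fun y => ?_
  rw [Real.norm_eq_abs, abs_of_nonneg (one_sub_cos_nonneg _)]
  refine (one_sub_cos_inner_le ξ y).trans (mul_le_mul_of_nonneg_right ?_ (min_one_sq_nonneg y))
  have h : ‖ξ‖ ≤ ‖ξ₀‖ + 1 := by
    have h1 : ‖ξ - ξ₀‖ < 1 := by simpa [dist_eq_norm] using hξ
    have h2 := norm_le_norm_add_norm_sub' ξ ξ₀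
    linarith
  gcongr

theorem IsLevyMeasure.measure_norm_gt_lt_top (hν : IsLevyMeasure ν) {ε : ℝ} (hε : 0 < ε) :
    ν {y | ε < ‖y‖} < ⊤ := by
  have h := hν.integrable_min.measure_ge_lt_top (ε := min 1 (ε ^ 2)) (by positivity)
  refine (measure_mono fun y hy => ?_).trans_lt h
  have hy' : ε < ‖y‖ := hy
  exact min_le_min le_rfl (pow_le_pow_left₀ hε.le hy'.le 2)

/-- Makes Fubini's theorem available for `ν`, whose mass near the origin may be infinite. The null
set `{0}` is adjoined because the sets `{1 / (n + 1) < |y|}` miss the origin. -/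
theorem IsLevyMeasure.sigmaFinite (hν : IsLevyMeasure ν) : SigmaFinite ν := by
  refine ⟨⟨⟨fun n : ℕ => {0} ∪ {y | 1 / ((n : ℝ) + 1) < ‖y‖}, fun _ => trivial, fun n => ?_,
    ?_⟩⟩⟩
  · refine (measure_union_le _ _).trans_lt ?_
    rw [hν.zero, zero_add]
    exact hν.measure_norm_gt_lt_top (by positivity)
  · refine Set.eq_univ_of_forall fun y => ?_
    rw [Set.mem_iUnion]
    by_cases hy : y = 0
    · exact ⟨0, Or.inl hy⟩
    · obtain ⟨n, hn⟩ := exists_nat_one_div_lt (norm_pos_iff.2 hy)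
      exact ⟨n, Or.inr hn⟩

theorem IsSymm.isNegInvariant (h : IsSymm ν) : ν.IsNegInvariant := by
  refine ⟨Measure.ext fun B hB => ?_⟩
  rw [Measure.neg, Measure.map_apply measurable_neg hB, h B hB]

theorem IsLevyMeasure.restrict (hν : IsLevyMeasure ν) (s : Set (EuclideanSpace ℝ (Fin d))) :
    IsLevyMeasure (ν.restrict s) :=
  ⟨le_antisymm ((Measure.restrict_apply_le _ _).trans hν.zero.le) bot_le,
    (lintegral_mono' Measure.restrict_le_self le_rfl).trans_lt hν.lintegral_lt_top⟩

theorem IsLevyMeasure.smul (hν : IsLevyMeasure ν) (t : ℝ) :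
    IsLevyMeasure (ENNReal.ofReal t • ν) := by
  refine ⟨by simp [hν.zero], ?_⟩
  rw [lintegral_smul_measure]
  exact ENNReal.mul_lt_top ENNReal.ofReal_lt_top hν.lintegral_lt_top

theorem IsLevyMeasure.add {ν' : Measure (EuclideanSpace ℝ (Fin d))} (hν : IsLevyMeasure ν)
    (hν' : IsLevyMeasure ν') : IsLevyMeasure (ν + ν') := by
  refine ⟨by simp [hν.zero, hν'.zero], ?_⟩
  rw [lintegral_add_measure]
  exact ENNReal.add_lt_top.2 ⟨hν.lintegral_lt_top, hν'.lintegral_lt_top⟩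

theorem IsSymm.smul (h : IsSymm ν) (c : ℝ≥0∞) : IsSymm (c • ν) := fun B hB => by
  simp [h B hB]

theorem IsSymm.add {ν' : Measure (EuclideanSpace ℝ (Fin d))} (h : IsSymm ν) (h' : IsSymm ν') :
    IsSymm (ν + ν') := fun B hB => by
  simp [h B hB, h' B hB]

theorem IsSymm.restrict (h : IsSymm ν) {s : Set (EuclideanSpace ℝ (Fin d))}
    (hs : MeasurableSet s) (hneg : (fun y => -y) ⁻¹' s = s) : IsSymm (ν.restrict s) :=
  fun B hB => by
    rw [Measure.restrict_apply hB, Measure.restrict_apply (measurable_neg hB),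
      h _ (hB.inter hs), Set.preimage_inter, hneg]

theorem exponent_smul {t : ℝ} (ht : 0 ≤ t) (ξ : EuclideanSpace ℝ (Fin d)) :
    exponent (ENNReal.ofReal t • ν) ξ = t * exponent ν ξ := by
  simp [exponent, integral_smul_measure, ht]

theorem exponent_add {ν' : Measure (EuclideanSpace ℝ (Fin d))} (hν : IsLevyMeasure ν)
    (hν' : IsLevyMeasure ν') (ξ : EuclideanSpace ℝ (Fin d)) :
    exponent (ν + ν') ξ = exponent ν ξ + exponent ν' ξ :=
  integral_add_measure (hν.integrable_one_sub_cos ξ) (hν'.integrable_one_sub_cos ξ)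

theorem exponent_restrict_add_compl (hν : IsLevyMeasure ν)
    {s : Set (EuclideanSpace ℝ (Fin d))} (hs : MeasurableSet s)
    (ξ : EuclideanSpace ℝ (Fin d)) :
    exponent (ν.restrict s) ξ + exponent (ν.restrict sᶜ) ξ = exponent ν ξ :=
  integral_add_compl hs (hν.integrable_one_sub_cos ξ)

/-! ### Decay of `e^{-tψ}` from the Hartman–Wintner condition -/

/-- Decay of `e^{-tψ}`: the integrability that makes `p_t` twice differentiable. -/
def Decay (ν : Measure (EuclideanSpace ℝ (Fin d))) : Prop :=
  ∀ t : ℝ, 0 < t → Integrable fun ξ : EuclideanSpace ℝ (Fin d) =>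
    (1 + ‖ξ‖ ^ 2) * Real.exp (-(t * exponent ν ξ))

theorem HartmanWintner.exists_le (h : HartmanWintner ν) (M : ℝ) :
    ∃ R : ℝ, 1 < R ∧ ∀ ξ : EuclideanSpace ℝ (Fin d), R ≤ ‖ξ‖ →
      M * Real.log ‖ξ‖ ≤ exponent ν ξ := by
  have h1 := (tendsto_atTop.1 h M)
  rw [eventually_comap] at h1
  obtain ⟨R, hR⟩ := eventually_atTop.1 h1
  refine ⟨max R 2, by simp, fun ξ hξ => ?_⟩
  have h2 := hR ‖ξ‖ ((le_max_left _ _).trans hξ) ξ rfl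
  have h3 : 0 < Real.log ‖ξ‖ := Real.log_pos (by linarith [le_max_right R 2])
  rwa [le_div_iff₀ h3] at h2

theorem integrable_inv_one_add_norm_pow :
    Integrable fun ξ : EuclideanSpace ℝ (Fin d) => ((1 + ‖ξ‖) ^ (d + 1))⁻¹ := by
  have := integrable_one_add_norm (E := EuclideanSpace ℝ (Fin d)) (μ := volume)
    (r := ((d + 1 : ℕ) : ℝ)) (by simp)
  refine this.congr (ae_of_all _ fun ξ => ?_)
  have : (0 : ℝ) ≤ 1 + ‖ξ‖ := by positivity
  simp only [Real.rpow_neg this, Real.rpow_natCast]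

theorem HartmanWintner.decay (hν : IsLevyMeasure ν) (h : HartmanWintner ν) : Decay ν := by
  intro t ht
  -- The slope `(d + 3) / t` yields `e^{-tψ} ≤ |ξ|^{-(d+3)}` at infinity: two powers pay for the
  -- weight `1 + |ξ|²`, and the other `d + 1` are enough for integrability.
  obtain ⟨R, hR1, hR⟩ := h.exists_le ((d + 3 : ℕ) / t)
  have hc := hν.continuous_exponent
  refine (integrable_inv_one_add_norm_pow.const_mul (2 ^ (d + 3) + (1 + R) ^ (d + 3))).mono'
    (by fun_prop : Continuous _).aestronglyMeasurable (ae_of_all _ fun ξ => ?_)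
  rw [Real.norm_eq_abs, abs_of_nonneg (by positivity)]
  have hn : 0 ≤ ‖ξ‖ := norm_nonneg ξ
  have hpos : 0 < (1 + ‖ξ‖) ^ (d + 1) := by positivity
  rw [← div_eq_mul_inv, le_div_iff₀ hpos]
  have h12 : 1 + ‖ξ‖ ^ 2 ≤ (1 + ‖ξ‖) ^ 2 := by nlinarith
  have key : (1 + ‖ξ‖) ^ (d + 3) * Real.exp (-(t * exponent ν ξ))
      ≤ 2 ^ (d + 3) + (1 + R) ^ (d + 3) := by
    rcases le_total R ‖ξ‖ with hle | hle
    · have h0 : 0 < ‖ξ‖ := by linarith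
      have h1 : Real.exp (-(t * exponent ν ξ)) ≤ (‖ξ‖ ^ (d + 3))⁻¹ := by
        rw [← Real.exp_log (pow_pos h0 (d + 3)), ← Real.exp_neg, Real.log_pow]
        refine Real.exp_le_exp.2 (neg_le_neg ?_)
        have := mul_le_mul_of_nonneg_left (hR ξ hle) ht.le
        calc ((d + 3 : ℕ) : ℝ) * Real.log ‖ξ‖
            = t * (((d + 3 : ℕ) : ℝ) / t * Real.log ‖ξ‖) := by field_simp
          _ ≤ _ := this
      have h2 : (1 + ‖ξ‖) ^ (d + 3) ≤ 2 ^ (d + 3) * ‖ξ‖ ^ (d + 3) := by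
        rw [← mul_pow]
        gcongr
        linarith
      have h3 : (1 + ‖ξ‖) ^ (d + 3) * Real.exp (-(t * exponent ν ξ)) ≤ 2 ^ (d + 3) := by
        calc _ ≤ 2 ^ (d + 3) * ‖ξ‖ ^ (d + 3) * (‖ξ‖ ^ (d + 3))⁻¹ := by gcongr
          _ = _ := by field_simp
      have : 0 ≤ (1 + R) ^ (d + 3) := by positivity
      linarith
    · have h1 : Real.exp (-(t * exponent ν ξ)) ≤ 1 :=
        Real.exp_le_one_iff.2 (by nlinarith [exponent_nonneg (ν := ν) ξ])
      have h2 : (1 + ‖ξ‖) ^ (d + 3) ≤ (1 + R) ^ (d + 3) := by gcongr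
      have h3 : (0 : ℝ) ≤ 2 ^ (d + 3) := by positivity
      have h4 : 0 ≤ (1 + ‖ξ‖) ^ (d + 3) := by positivity
      nlinarith [Real.exp_pos (-(t * exponent ν ξ))]
  calc (1 + ‖ξ‖ ^ 2) * Real.exp (-(t * exponent ν ξ)) * (1 + ‖ξ‖) ^ (d + 1)
      ≤ (1 + ‖ξ‖) ^ 2 * Real.exp (-(t * exponent ν ξ)) * (1 + ‖ξ‖) ^ (d + 1) := by gcongr
    _ = (1 + ‖ξ‖) ^ (d + 3) * Real.exp (-(t * exponent ν ξ)) := by ring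
    _ ≤ _ := key

theorem Decay.integrable_exp (hν : IsLevyMeasure ν) (h : Decay ν) {t : ℝ} (ht : 0 < t) :
    Integrable fun ξ : EuclideanSpace ℝ (Fin d) => Real.exp (-(t * exponent ν ξ)) := by
  have hc := hν.continuous_exponent
  refine (h t ht).mono' (by fun_prop : Continuous _).aestronglyMeasurable
    (ae_of_all _ fun ξ => ?_)
  rw [Real.norm_eq_abs, abs_of_pos (Real.exp_pos _)]
  nlinarith [Real.exp_pos (-(t * exponent ν ξ)), sq_nonneg ‖ξ‖,
    mul_nonneg (sq_nonneg ‖ξ‖) (Real.exp_pos (-(t * exponent ν ξ))).le]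

/-! ### Cosine transform: inversion and convolution -/

/-- The cosine form of the inverse Fourier transform, used for even functions. -/
def invF (φ : EuclideanSpace ℝ (Fin d) → ℝ) (x : EuclideanSpace ℝ (Fin d)) : ℝ :=
  ((2 * Real.pi) ^ d)⁻¹ * ∫ ξ, Real.cos (inner ℝ ξ x) * φ ξ

theorem invF_const_pos : 0 < ((2 * Real.pi) ^ d)⁻¹ := by positivity

theorem integrable_cos_mul {φ : EuclideanSpace ℝ (Fin d) → ℝ} (hφ : Integrable φ)
    (x : EuclideanSpace ℝ (Fin d)) : Integrable fun ξ => Real.cos (inner ℝ ξ x) * φ ξ :=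
  hφ.bdd_mul (c := 1) (by fun_prop : Continuous _).aestronglyMeasurable
    (ae_of_all _ fun _ => by simpa using Real.abs_cos_le_one _)

theorem integrable_sin_mul {φ : EuclideanSpace ℝ (Fin d) → ℝ} (hφ : Integrable φ)
    (x : EuclideanSpace ℝ (Fin d)) : Integrable fun ξ => Real.sin (inner ℝ ξ x) * φ ξ :=
  hφ.bdd_mul (c := 1) (by fun_prop : Continuous _).aestronglyMeasurable
    (ae_of_all _ fun _ => by simpa using Real.abs_sin_le_one _)

theorem integral_sin_mul_eq_zero {φ : EuclideanSpace ℝ (Fin d) → ℝ}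
    (heven : ∀ ξ, φ (-ξ) = φ ξ) (x : EuclideanSpace ℝ (Fin d)) :
    ∫ ξ, Real.sin (inner ℝ ξ x) * φ ξ = 0 := by
  have h := integral_neg_eq_self (fun ξ => Real.sin (inner ℝ ξ x) * φ ξ) volume
  simp only [inner_neg_left, Real.sin_neg, heven, neg_mul] at h
  rw [integral_neg] at h
  linarith

theorem integral_cexp_mul_of_even {φ : EuclideanSpace ℝ (Fin d) → ℝ} (hφ : Integrable φ)
    (heven : ∀ ξ, φ (-ξ) = φ ξ) (x : EuclideanSpace ℝ (Fin d)) :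
    ∫ ξ, Complex.exp (Complex.I * ((inner ℝ ξ x : ℝ) : ℂ)) * (φ ξ : ℂ)
      = ((∫ ξ, Real.cos (inner ℝ ξ x) * φ ξ : ℝ) : ℂ) := by
  have h1 : ∀ ξ : EuclideanSpace ℝ (Fin d),
      Complex.exp (Complex.I * ((inner ℝ ξ x : ℝ) : ℂ)) * (φ ξ : ℂ)
      = ((Real.cos (inner ℝ ξ x) * φ ξ : ℝ) : ℂ)
        + Complex.I * ((Real.sin (inner ℝ ξ x) * φ ξ : ℝ) : ℂ) := by
    intro ξ
    rw [mul_comm Complex.I, Complex.exp_mul_I]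
    push_cast
    ring
  simp_rw [h1]
  rw [integral_add (integrable_cos_mul hφ x).ofReal
    ((integrable_sin_mul hφ x).ofReal.const_mul _), integral_const_mul]
  rw [integral_complex_ofReal, integral_complex_ofReal, integral_sin_mul_eq_zero heven]
  simp

theorem density_eq_invF (t : ℝ)
    (hint : Integrable fun ξ : EuclideanSpace ℝ (Fin d) => Real.exp (-(t * exponent ν ξ)))
    (x : EuclideanSpace ℝ (Fin d)) :
    density ν t x = invF (fun ξ => Real.exp (-(t * exponent ν ξ))) x := by
  have h := integral_cexp_mul_of_even hint (fun ξ => by rw [exponent_neg]) (-x)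
  unfold density invF
  congr 1
  rw [← Complex.ofReal_re (∫ ξ, Real.cos (inner ℝ ξ x) * _)]
  congr 1
  simp only [inner_neg_right, Real.cos_neg, Complex.ofReal_neg, mul_neg,
    Complex.ofReal_exp] at h
  exact h

theorem invF_neg (φ : EuclideanSpace ℝ (Fin d) → ℝ) (x : EuclideanSpace ℝ (Fin d)) :
    invF φ (-x) = invF φ x := by simp [invF]

/-- The substitution `ξ ↦ 2πξ` absorbs the prefactor and produces the normalisation used by `𝓕`. -/
theorem invF_comp_smul (φ : EuclideanSpace ℝ (Fin d) → ℝ) (x : EuclideanSpace ℝ (Fin d)) :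
    invF φ x = ∫ ξ, Real.cos (inner ℝ ξ ((2 * Real.pi) • x)) * φ ((2 * Real.pi) • ξ) := by
  have h := Measure.integral_comp_smul (volume : Measure (EuclideanSpace ℝ (Fin d)))
    (fun ξ => Real.cos (inner ℝ ξ x) * φ ξ) (2 * Real.pi)
  simp only [inner_smul_left, inner_smul_right] at h ⊢
  rw [invF]
  rw [abs_of_pos (by simpa using invF_const_pos (d := d))] at h
  simpa using h.symm

theorem continuous_invF {φ : EuclideanSpace ℝ (Fin d) → ℝ} (hφ : Integrable φ) :
    Continuous (invF φ) := by
  refine continuous_const.mul (continuous_of_dominated (bound := fun ξ => |φ ξ|)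
    (fun x => (integrable_cos_mul hφ x).aestronglyMeasurable) (fun x => ae_of_all _ fun ξ => ?_)
    hφ.abs (ae_of_all _ fun ξ => by fun_prop))
  rw [norm_mul]
  exact mul_le_of_le_one_left (norm_nonneg _) (Real.abs_cos_le_one _)

theorem abs_invF_le {φ : EuclideanSpace ℝ (Fin d) → ℝ} (hφ : Integrable φ)
    (x : EuclideanSpace ℝ (Fin d)) :
    |invF φ x| ≤ ((2 * Real.pi) ^ d)⁻¹ * ∫ ξ, |φ ξ| := by
  rw [invF, abs_mul, abs_of_pos invF_const_pos]
  refine mul_le_mul_of_nonneg_left ?_ invF_const_pos.le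
  refine (abs_integral_le_integral_abs).trans (integral_mono (integrable_cos_mul hφ x).abs
    hφ.abs fun ξ => ?_)
  simp only [abs_mul]
  exact mul_le_of_le_one_left (abs_nonneg _) (Real.abs_cos_le_one _)

/-- For even `φ` the sine part vanishes, so `invF φ` is `𝓕` of the rescaled function `φ(2π ·)`, and
ordinary Fourier inversion applies. -/
theorem invF_inversion {φ : EuclideanSpace ℝ (Fin d) → ℝ} (hc : Continuous φ)
    (hφ : Integrable φ) (heven : ∀ ξ, φ (-ξ) = φ ξ) (hq : Integrable (invF φ))
    (ξ : EuclideanSpace ℝ (Fin d)) :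
    ∫ x, Real.cos (inner ℝ x ξ) * invF φ x = φ ξ := by
  have hpi : (2 * Real.pi) ≠ 0 := by positivity
  set f : EuclideanSpace ℝ (Fin d) → ℂ := fun ξ => (φ ((2 * Real.pi) • ξ) : ℂ) with hf
  have hg : Integrable fun ξ : EuclideanSpace ℝ (Fin d) => φ ((2 * Real.pi) • ξ) :=
    hφ.comp_smul hpi
  have hfc : Continuous f := by fun_prop
  have hfi : Integrable f := hg.ofReal
  have hF : 𝓕 f = fun x => (invF φ x : ℂ) := by
    ext x
    have h := integral_cexp_mul_of_even hg (fun ξ => by rw [smul_neg, heven])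
      (-((2 * Real.pi) • x))
    rw [Real.fourier_eq', invF_comp_smul]
    simp only [inner_neg_right, Real.cos_neg] at h
    rw [← h]
    refine integral_congr_ae (ae_of_all _ fun ξ => ?_)
    simp only [smul_eq_mul, hf, inner_smul_right]
    congr 2
    push_cast
    ring
  have hinv := congrFun (hfc.fourierInv_fourier_eq hfi (by rw [hF]; exact hq.ofReal))
    ((2 * Real.pi)⁻¹ • ξ)
  rw [hF, Real.fourierInv_eq'] at hinv
  have h := integral_cexp_mul_of_even hq (invF_neg φ) ξ
  simp only [hf, smul_inv_smul₀ hpi] at hinv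
  rw [← Complex.ofReal_inj, ← h, ← hinv]
  refine integral_congr_ae (ae_of_all _ fun x => ?_)
  simp only [smul_eq_mul, inner_smul_right]
  congr 2
  push_cast
  field_simp

/-- Fubini's theorem for `q(y) φ₁(ξ) cos(ξ·(x - y))`. After the addition formula the sine term
integrates to zero because `q` is even. -/
theorem invF_mul {φ₁ φ₂ q : EuclideanSpace ℝ (Fin d) → ℝ} (h₁ : Integrable φ₁)
    (hq : Integrable q) (heven : ∀ y, q (-y) = q y)
    (hF : ∀ ξ, ∫ y, Real.cos (inner ℝ y ξ) * q y = φ₂ ξ) (x : EuclideanSpace ℝ (Fin d)) :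
    invF (fun ξ => φ₁ ξ * φ₂ ξ) x = ∫ y, invF φ₁ (x - y) * q y := by
  have hprod : Integrable (fun z : EuclideanSpace ℝ (Fin d) × EuclideanSpace ℝ (Fin d) =>
      (q z.1 * φ₁ z.2) * Real.cos (inner ℝ z.2 (x - z.1))) (volume.prod volume) :=
    (hq.mul_prod h₁).mul_bdd (c := 1) (by fun_prop : Continuous _).aestronglyMeasurable
      (ae_of_all _ fun _ => by simpa using Real.abs_cos_le_one _)
  have h1 : ∀ y, invF φ₁ (x - y) * q y = ((2 * Real.pi) ^ d)⁻¹ *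
      ∫ ξ, (q y * φ₁ ξ) * Real.cos (inner ℝ ξ (x - y)) := by
    intro y
    rw [invF, mul_assoc, ← integral_mul_const]
    congr 2
    ext ξ
    ring
  simp_rw [h1]
  rw [integral_const_mul, integral_integral_swap hprod, invF]
  congr 2
  ext ξ
  have h2 : ∀ y, q y * φ₁ ξ * Real.cos (inner ℝ ξ (x - y))
      = (Real.cos (inner ℝ ξ x) * φ₁ ξ) * (Real.cos (inner ℝ y ξ) * q y)
        + (Real.sin (inner ℝ ξ x) * φ₁ ξ) * (Real.sin (inner ℝ y ξ) * q y) := by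
    intro y
    rw [inner_sub_right, Real.cos_sub, real_inner_comm ξ y]
    ring
  simp_rw [h2]
  rw [integral_add ((integrable_cos_mul hq ξ).const_mul _)
    ((integrable_sin_mul hq ξ).const_mul _), integral_const_mul, integral_const_mul, hF,
    integral_sin_mul_eq_zero heven]
  ring

/-! ### Gaussian regularisation, nonnegativity and exponential moments -/

theorem integrable_gaussian {b : ℝ} (hb : 0 < b) :
    Integrable fun ξ : EuclideanSpace ℝ (Fin d) => Real.exp (-b * ‖ξ‖ ^ 2) := by
  have h := (GaussianFourier.integrable_cexp_neg_mul_sq_norm_add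
    (V := EuclideanSpace ℝ (Fin d)) (b := (b : ℂ)) (by simpa using hb) 0 0).re
  refine h.congr (ae_of_all _ fun ξ => ?_)
  have h1 : -(b : ℂ) * (‖ξ‖ : ℂ) ^ 2 + 0 * ((inner ℝ 0 ξ : ℝ) : ℂ)
      = ((-b * ‖ξ‖ ^ 2 : ℝ) : ℂ) := by
    push_cast
    ring
  simp only [h1]
  exact Complex.exp_ofReal_re _

theorem invF_gaussian {b : ℝ} (hb : 0 < b) (x : EuclideanSpace ℝ (Fin d)) :
    invF (fun ξ : EuclideanSpace ℝ (Fin d) => Real.exp (-b * ‖ξ‖ ^ 2)) x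
      = ((2 * Real.pi) ^ d)⁻¹ * (Real.pi / b) ^ ((d : ℝ) / 2)
        * Real.exp (-(4 * b)⁻¹ * ‖x‖ ^ 2) := by
  have h := GaussianFourier.integral_cexp_neg_mul_sq_norm_add
    (V := EuclideanSpace ℝ (Fin d)) (b := (b : ℂ)) (by simpa using hb) Complex.I x
  have h2 := integral_cexp_mul_of_even (integrable_gaussian (d := d) hb) (fun ξ => by simp) x
  rw [invF, mul_assoc]
  congr 1
  rw [← Complex.ofReal_inj, ← h2]
  have h3 : ∀ ξ : EuclideanSpace ℝ (Fin d),
      Complex.exp (Complex.I * ((inner ℝ ξ x : ℝ) : ℂ)) * ((Real.exp (-b * ‖ξ‖ ^ 2) : ℝ) : ℂ)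
      = Complex.exp (-(b : ℂ) * ‖ξ‖ ^ 2 + Complex.I * ((inner ℝ x ξ : ℝ) : ℂ)) := by
    intro ξ
    rw [Complex.ofReal_exp, ← Complex.exp_add, real_inner_comm]
    congr 1
    push_cast
    ring
  simp_rw [h3]
  rw [h, finrank_euclideanSpace_fin, Complex.ofReal_mul, Complex.ofReal_cpow (by positivity)]
  push_cast
  congr 2
  rw [Complex.I_sq]
  field_simp

/-- The inverse transform of `e^{-b|ξ|²}` is the centred Gaussian density with covariance `2b` times
the identity; this is its moment generating function. -/
theorem lintegral_exp_inner_mul_invF_gaussian {b : ℝ} (hb : 0 < b)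
    (l : EuclideanSpace ℝ (Fin d)) :
    ∫⁻ x, ENNReal.ofReal (Real.exp (inner ℝ l x)
      * invF (fun ξ : EuclideanSpace ℝ (Fin d) => Real.exp (-b * ‖ξ‖ ^ 2)) x)
      = ENNReal.ofReal (Real.exp (b * ‖l‖ ^ 2)) := by
  have hb4 : 0 < (4 * b)⁻¹ := by positivity
  have h := GaussianFourier.integral_cexp_neg_mul_sq_norm_add
    (V := EuclideanSpace ℝ (Fin d)) (b := ((4 * b)⁻¹ : ℝ)) (by simpa using hb) 1 l
  have hi := (GaussianFourier.integrable_cexp_neg_mul_sq_norm_add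
    (V := EuclideanSpace ℝ (Fin d)) (b := ((4 * b)⁻¹ : ℝ)) (by simpa using hb) 1 l)
  have h3 : ∀ x : EuclideanSpace ℝ (Fin d),
      Complex.exp (-(((4 * b)⁻¹ : ℝ) : ℂ) * ‖x‖ ^ 2 + 1 * ((inner ℝ l x : ℝ) : ℂ))
      = ((Real.exp (-(4 * b)⁻¹ * ‖x‖ ^ 2 + inner ℝ l x) : ℝ) : ℂ) := by
    intro x
    push_cast
    congr 1
    ring
  simp_rw [h3] at h hi
  have hi' : Integrable fun x : EuclideanSpace ℝ (Fin d) =>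
      Real.exp (-(4 * b)⁻¹ * ‖x‖ ^ 2 + inner ℝ l x) := 
    hi.re.congr (ae_of_all _ fun x => Complex.ofReal_re _)
  rw [integral_complex_ofReal, finrank_euclideanSpace_fin] at h
  have h4 : ∫ x : EuclideanSpace ℝ (Fin d), Real.exp (-(4 * b)⁻¹ * ‖x‖ ^ 2 + inner ℝ l x)
      = (Real.pi / (4 * b)⁻¹) ^ ((d : ℝ) / 2) * Real.exp (b * ‖l‖ ^ 2) := by
    rw [← Complex.ofReal_inj, h, Complex.ofReal_mul, Complex.ofReal_cpow (by positivity)]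
    push_cast
    congr 2
    field_simp
  set A : ℝ := ((2 * Real.pi) ^ d)⁻¹ * (Real.pi / b) ^ ((d : ℝ) / 2) with hA
  have hA0 : 0 ≤ A := by positivity
  have hAone : A * (Real.pi / (4 * b)⁻¹) ^ ((d : ℝ) / 2) = 1 := by
    rw [hA, mul_assoc, ← Real.mul_rpow (by positivity) (by positivity)]
    have : Real.pi / b * (Real.pi / (4 * b)⁻¹) = (2 * Real.pi) ^ (2 : ℝ) := by
      rw [Real.rpow_two]
      field_simp
      ring
    rw [this, ← Real.rpow_mul (by positivity), mul_div_cancel₀ _ two_ne_zero, Real.rpow_natCast]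
    exact inv_mul_cancel₀ (by positivity)
  have h5 : ∀ x : EuclideanSpace ℝ (Fin d), Real.exp (inner ℝ l x)
      * invF (fun ξ : EuclideanSpace ℝ (Fin d) => Real.exp (-b * ‖ξ‖ ^ 2)) x
      = A * Real.exp (-(4 * b)⁻¹ * ‖x‖ ^ 2 + inner ℝ l x) := by
    intro x
    rw [invF_gaussian hb, Real.exp_add]
    ring
  simp_rw [h5]
  rw [← ofReal_integral_eq_lintegral_ofReal (hi'.const_mul A)
    (ae_of_all _ fun x => by positivity), integral_const_mul, h4, ← mul_assoc, hAone, one_mul]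

/-- Fatou's lemma: the two properties to be propagated both survive pointwise limits. -/
theorem nonneg_and_lintegral_le_of_tendsto {g : ℕ → EuclideanSpace ℝ (Fin d) → ℝ}
    {g₀ w : EuclideanSpace ℝ (Fin d) → ℝ} {C : ℕ → ℝ≥0∞} {C₀ : ℝ≥0∞}
    (hlim : ∀ x, Tendsto (fun n => g n x) atTop (𝓝 (g₀ x)))
    (hmeas : ∀ n, Measurable (g n)) (hw : Measurable w)
    (h : ∀ᶠ n in atTop, (∀ x, 0 ≤ g n x) ∧ ∫⁻ x, ENNReal.ofReal (w x * g n x) ≤ C n)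
    (hC : Tendsto C atTop (𝓝 C₀)) :
    (∀ x, 0 ≤ g₀ x) ∧ ∫⁻ x, ENNReal.ofReal (w x * g₀ x) ≤ C₀ := by
  refine ⟨fun x => ge_of_tendsto (hlim x) (h.mono fun n hn => hn.1 x), ?_⟩
  have h1 : ∀ x, ENNReal.ofReal (w x * g₀ x)
      = liminf (fun n => ENNReal.ofReal (w x * g n x)) atTop := fun x =>
    ((ENNReal.continuous_ofReal.tendsto _).comp ((hlim x).const_mul (w x))).liminf_eq.symm
  simp_rw [h1]
  refine (lintegral_liminf_le fun n => (hw.mul (hmeas n)).ennreal_ofReal).trans ?_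
  rw [← hC.liminf_eq]
  exact liminf_le_liminf (h.mono fun n hn => hn.2)

/-- The Gaussian regularisations of the inverse Fourier transform of `φ` are nonnegative, and
their exponential moments at `l` are controlled by `K`. -/
def GaussianNonneg (l : EuclideanSpace ℝ (Fin d)) (K : ℝ≥0∞)
    (φ : EuclideanSpace ℝ (Fin d) → ℝ) : Prop :=
  ∀ b : ℝ, 0 < b → (∀ x, 0 ≤ invF (fun ξ => φ ξ * Real.exp (-b * ‖ξ‖ ^ 2)) x) ∧
    ∫⁻ x, ENNReal.ofReal (Real.exp (inner ℝ l x) *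
      invF (fun ξ => φ ξ * Real.exp (-b * ‖ξ‖ ^ 2)) x)
      ≤ ENNReal.ofReal (Real.exp (b * ‖l‖ ^ 2)) * K

theorem integrable_mul_gaussian {φ : EuclideanSpace ℝ (Fin d) → ℝ} (hc : Continuous φ)
    (h1 : ∀ ξ, |φ ξ| ≤ 1) {b : ℝ} (hb : 0 < b) :
    Integrable fun ξ => φ ξ * Real.exp (-b * ‖ξ‖ ^ 2) :=
  (integrable_gaussian hb).bdd_mul hc.aestronglyMeasurable (ae_of_all _ h1)

theorem tendsto_invF {φ : ℕ → EuclideanSpace ℝ (Fin d) → ℝ}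
    {φ₀ g : EuclideanSpace ℝ (Fin d) → ℝ} (hint : ∀ n, Integrable (φ n))
    (hg : Integrable g) (hle : ∀ n ξ, |φ n ξ| ≤ g ξ)
    (hlim : ∀ ξ, Tendsto (fun n => φ n ξ) atTop (𝓝 (φ₀ ξ))) (x : EuclideanSpace ℝ (Fin d)) :
    Tendsto (fun n => invF (φ n) x) atTop (𝓝 (invF φ₀ x)) := by
  refine Tendsto.const_mul _ (tendsto_integral_of_dominated_convergence g
    (fun n => (integrable_cos_mul (hint n) x).aestronglyMeasurable) hg
    (fun n => ae_of_all _ fun ξ => ?_) (ae_of_all _ fun ξ => (hlim ξ).const_mul _))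
  rw [norm_mul]
  exact (mul_le_of_le_one_left (norm_nonneg _) (Real.abs_cos_le_one _)).trans (hle n ξ)

theorem GaussianNonneg.of_tendsto {l : EuclideanSpace ℝ (Fin d)} {K : ℝ≥0∞}
    {φ : ℕ → EuclideanSpace ℝ (Fin d) → ℝ} {φ₀ : EuclideanSpace ℝ (Fin d) → ℝ}
    (hc : ∀ n, Continuous (φ n)) (h1 : ∀ n ξ, |φ n ξ| ≤ 1)
    (hlim : ∀ ξ, Tendsto (fun n => φ n ξ) atTop (𝓝 (φ₀ ξ)))
    (h : ∀ n, GaussianNonneg l K (φ n)) : GaussianNonneg l K φ₀ := by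
  intro b hb
  refine nonneg_and_lintegral_le_of_tendsto
    (tendsto_invF (fun n => integrable_mul_gaussian (hc n) (h1 n) hb) (integrable_gaussian hb)
      (fun n ξ => ?_) fun ξ => (hlim ξ).mul_const _)
    (fun n => (continuous_invF (integrable_mul_gaussian (hc n) (h1 n) hb)).measurable)
    (by fun_prop) (Eventually.of_forall fun n => h n b hb) tendsto_const_nhds
  rw [abs_mul, abs_of_pos (Real.exp_pos _)]
  exact mul_le_of_le_one_left (Real.exp_pos _).le (h1 n ξ)

/-- The Gaussian factor is there only so that characteristic functions which are not integrable can
be inverted. Once `φ` itself is integrable, the factor is removed by letting `b = 1 / (n + 1)` tend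
to 0. -/
theorem GaussianNonneg.invF {l : EuclideanSpace ℝ (Fin d)} {K : ℝ≥0∞} (hK : K ≠ ⊤)
    {φ : EuclideanSpace ℝ (Fin d) → ℝ} (hc : Continuous φ) (hφ : Integrable φ)
    (h1 : ∀ ξ, |φ ξ| ≤ 1) (h : GaussianNonneg l K φ) :
    (∀ x, 0 ≤ invF φ x) ∧
      ∫⁻ x, ENNReal.ofReal (Real.exp (inner ℝ l x) * HardyStein.invF φ x) ≤ K := by
  have hb : ∀ n : ℕ, (0 : ℝ) < 1 / ((n : ℝ) + 1) := fun n => by positivity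
  have hlim := tendsto_one_div_add_atTop_nhds_zero_nat (𝕜 := ℝ)
  refine nonneg_and_lintegral_le_of_tendsto
    (g := fun n => HardyStein.invF fun ξ => φ ξ * Real.exp (-(1 / ((n : ℝ) + 1)) * ‖ξ‖ ^ 2))
    (tendsto_invF (fun n => integrable_mul_gaussian hc h1 (hb n)) hφ.abs
      (fun n ξ => ?_) fun ξ => ?_)
    (fun n => (continuous_invF (integrable_mul_gaussian hc h1 (hb n))).measurable)
    (by fun_prop) (Eventually.of_forall fun n => h _ (hb n)) ?_
  · rw [abs_mul, abs_of_pos (Real.exp_pos _)]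
    refine mul_le_of_le_one_right (abs_nonneg _) (Real.exp_le_one_iff.2 ?_)
    nlinarith [hb n, sq_nonneg ‖ξ‖, mul_nonneg (hb n).le (sq_nonneg ‖ξ‖)]
  · have : Tendsto (fun n : ℕ => φ ξ * Real.exp (-(1 / ((n : ℝ) + 1)) * ‖ξ‖ ^ 2)) atTop
        (𝓝 (φ ξ * Real.exp (-0 * ‖ξ‖ ^ 2))) :=
      ((Real.continuous_exp.tendsto _).comp (hlim.neg.mul_const _)).const_mul _
    simpa using this
  · have : Tendsto (fun n : ℕ => ENNReal.ofReal (Real.exp (1 / ((n : ℝ) + 1) * ‖l‖ ^ 2)) * K)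
        atTop (𝓝 (ENNReal.ofReal (Real.exp (0 * ‖l‖ ^ 2)) * K)) :=
      ENNReal.Tendsto.mul_const ((ENNReal.continuous_ofReal.tendsto _).comp
        ((Real.continuous_exp.tendsto _).comp (hlim.mul_const _))) (Or.inr hK)
    simpa using this

/-- The product of `φ` with the Gaussian is the characteristic function of `μ` convolved with a
Gaussian law. Its inverse transform is therefore an average of translated Gaussian densities, and
exponential moments of a convolution factorise. -/
theorem gaussianNonneg_of_charFun (μ : Measure (EuclideanSpace ℝ (Fin d)))
    [IsProbabilityMeasure μ] {φ : EuclideanSpace ℝ (Fin d) → ℝ}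
    (hφ : ∀ ξ, charFun μ ξ = (φ ξ : ℂ)) {l : EuclideanSpace ℝ (Fin d)} {K : ℝ≥0∞}
    (hK : ∫⁻ y, ENNReal.ofReal (Real.exp (inner ℝ l y)) ∂μ ≤ K) : GaussianNonneg l K φ := by
  intro b hb
  set G : EuclideanSpace ℝ (Fin d) → ℝ := fun ξ => Real.exp (-b * ‖ξ‖ ^ 2) with hG
  have hGi : Integrable G := integrable_gaussian hb
  have hG0 : ∀ x, 0 ≤ invF G x := fun x => by rw [invF_gaussian hb]; positivity
  have hGc := continuous_invF hGi
  have hGint : ∀ x, Integrable (fun y => invF G (x - y)) μ := fun x =>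
    Integrable.mono' (integrable_const (((2 * Real.pi) ^ d)⁻¹ * ∫ ξ, |G ξ|))
      (by fun_prop : Continuous _).aestronglyMeasurable (ae_of_all _ fun y => abs_invF_le hGi _)
  have hcos : ∀ ξ x, Real.cos (inner ℝ ξ x) * φ ξ = ∫ y, Real.cos (inner ℝ ξ (x - y)) ∂μ := by
    intro ξ x
    have hint : Integrable (fun y : EuclideanSpace ℝ (Fin d) =>
        Complex.exp (((inner ℝ ξ x - inner ℝ y ξ : ℝ) : ℂ) * Complex.I)) μ :=
      Integrable.mono' (integrable_const (1 : ℝ))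
        (by fun_prop : Continuous _).aestronglyMeasurable
        (ae_of_all _ fun y => by rw [Complex.norm_exp_ofReal_mul_I])
    have h1 : ∫ y, Complex.exp (((inner ℝ ξ x - inner ℝ y ξ : ℝ) : ℂ) * Complex.I) ∂μ
        = Complex.exp (((inner ℝ ξ x : ℝ) : ℂ) * Complex.I) * (φ ξ : ℂ) := by
      have h0 : charFun μ (-ξ) = (φ ξ : ℂ) := by
        rw [charFun_neg, hφ, Complex.conj_ofReal]
      rw [← h0, charFun_apply, ← integral_const_mul]
      refine integral_congr_ae (ae_of_all _ fun y => ?_)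
      simp only [← Complex.exp_add, inner_neg_right]
      congr 1
      push_cast
      ring
    have h2 := congrArg Complex.re h1
    rw [Complex.re_mul_ofReal, Complex.exp_ofReal_mul_I_re] at h2
    rw [← h2, ← RCLike.re_eq_complex_re, ← integral_re hint]
    refine integral_congr_ae (ae_of_all _ fun y => ?_)
    simp only [RCLike.re_eq_complex_re, Complex.exp_ofReal_mul_I_re, inner_sub_right,
      real_inner_comm]
  have hR : ∀ x, invF (fun ξ => φ ξ * G ξ) x = ∫ y, invF G (x - y) ∂μ := by
    intro x
    have hprod : Integrable (fun z : EuclideanSpace ℝ (Fin d) × EuclideanSpace ℝ (Fin d) =>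
        (G z.1 * 1) * Real.cos (inner ℝ z.1 (x - z.2))) (volume.prod μ) :=
      (hGi.mul_prod (integrable_const (1 : ℝ))).mul_bdd (c := 1)
        (by fun_prop : Continuous _).aestronglyMeasurable
        (ae_of_all _ fun _ => by simpa using Real.abs_cos_le_one _)
    simp only [invF]
    rw [integral_const_mul]
    congr 1
    have h3 : ∀ ξ, Real.cos (inner ℝ ξ x) * (φ ξ * G ξ)
        = ∫ y, (G ξ * 1) * Real.cos (inner ℝ ξ (x - y)) ∂μ := by
      intro ξ
      rw [integral_const_mul, ← hcos]
      ring
    simp_rw [h3]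
    rw [integral_integral_swap hprod]
    refine integral_congr_ae (ae_of_all _ fun y => integral_congr_ae (ae_of_all _ fun ξ => ?_))
    simp only
    ring
  refine ⟨fun x => by rw [hR]; exact integral_nonneg fun y => hG0 _, ?_⟩
  have hR' : ∀ x, ENNReal.ofReal (Real.exp (inner ℝ l x) * invF (fun ξ => φ ξ * G ξ) x)
      = ∫⁻ y, ENNReal.ofReal (Real.exp (inner ℝ l x) * invF G (x - y)) ∂μ := by
    intro x
    rw [hR, ← integral_const_mul, ofReal_integral_eq_lintegral_ofReal ((hGint x).const_mul _)
      (ae_of_all _ fun y => mul_nonneg (Real.exp_pos _).le (hG0 _))]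
  refine (lintegral_congr hR').trans_le ?_
  rw [lintegral_lintegral_swap
    (by fun_prop : Measurable _).aemeasurable]
  have h4 : ∀ y, ∫⁻ x, ENNReal.ofReal (Real.exp (inner ℝ l x) * invF G (x - y))
      = ENNReal.ofReal (Real.exp (b * ‖l‖ ^ 2)) * ENNReal.ofReal (Real.exp (inner ℝ l y)) := by
    intro y
    rw [← lintegral_add_right_eq_self _ y, ← lintegral_exp_inner_mul_invF_gaussian hb l,
      ← lintegral_mul_const _ (by fun_prop)]
    refine lintegral_congr fun x => ?_
    rw [← ENNReal.ofReal_mul (mul_nonneg (Real.exp_pos _).le (hG0 _)), add_sub_cancel_right,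
      inner_add_right, Real.exp_add]
    congr 1
    ring
  simp_rw [h4]
  rw [lintegral_const_mul _ (by fun_prop)]
  gcongr

/-! ### Compound Poisson approximation by random walks -/

/-- Convolution powers of a measure. -/
def convPow (m : Measure (EuclideanSpace ℝ (Fin d))) : ℕ → Measure (EuclideanSpace ℝ (Fin d))
  | 0 => Measure.dirac 0
  | n + 1 => m ∗ convPow m n

theorem isProbabilityMeasure_convPow (m : Measure (EuclideanSpace ℝ (Fin d)))
    [IsProbabilityMeasure m] : ∀ n, IsProbabilityMeasure (convPow m n)
  | 0 => by rw [convPow]; infer_instance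
  | n + 1 => by
    have := isProbabilityMeasure_convPow m n
    rw [convPow]
    infer_instance

theorem charFun_convPow (m : Measure (EuclideanSpace ℝ (Fin d))) [IsProbabilityMeasure m]
    (ξ : EuclideanSpace ℝ (Fin d)) : ∀ n, charFun (convPow m n) ξ = charFun m ξ ^ n
  | 0 => by simp [convPow]
  | n + 1 => by
    have := isProbabilityMeasure_convPow m n
    rw [convPow, charFun_conv, charFun_convPow m ξ n, pow_succ']

theorem lintegral_exp_inner_convPow (m : Measure (EuclideanSpace ℝ (Fin d)))
    [IsProbabilityMeasure m] (l : EuclideanSpace ℝ (Fin d)) :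
    ∀ n, ∫⁻ y, ENNReal.ofReal (Real.exp (inner ℝ l y)) ∂(convPow m n)
      = (∫⁻ y, ENNReal.ofReal (Real.exp (inner ℝ l y)) ∂m) ^ n
  | 0 => by simp [convPow, lintegral_dirac' _
      (by fun_prop : Measurable fun y => ENNReal.ofReal (Real.exp (inner ℝ l y)))]
  | n + 1 => by
    have := isProbabilityMeasure_convPow m n
    rw [convPow, Measure.lintegral_conv (by fun_prop)]
    simp_rw [inner_add_right, Real.exp_add, ENNReal.ofReal_mul (Real.exp_pos _).le]
    simp_rw [lintegral_const_mul _
      (by fun_prop : Measurable fun y => ENNReal.ofReal (Real.exp (inner ℝ l y)))]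
    rw [lintegral_mul_const _ (by fun_prop), lintegral_exp_inner_convPow m l n, pow_succ']

theorem charFun_eq_of_isSymm [IsFiniteMeasure ν] (hs : IsSymm ν)
    (ξ : EuclideanSpace ℝ (Fin d)) :
    charFun ν ξ = ((ν.real Set.univ - exponent ν ξ : ℝ) : ℂ) := by
  have := hs.isNegInvariant
  have h1 : (charFun ν ξ).im = 0 := by
    have h2 : charFun ν (-ξ) = charFun ν ξ := by
      rw [charFun_apply, charFun_apply,
        ← integral_neg_eq_self (fun y => Complex.exp (((inner ℝ y ξ : ℝ) : ℂ) * Complex.I)) ν]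
      simp
    rw [charFun_neg] at h2
    exact Complex.conj_eq_iff_im.1 h2
  have hint : Integrable (fun y : EuclideanSpace ℝ (Fin d) =>
      Complex.exp (((inner ℝ y ξ : ℝ) : ℂ) * Complex.I)) ν :=
    Integrable.mono' (integrable_const (1 : ℝ))
      (by fun_prop : Continuous _).aestronglyMeasurable
      (ae_of_all _ fun y => by rw [Complex.norm_exp_ofReal_mul_I])
  have hcos : Integrable (fun y : EuclideanSpace ℝ (Fin d) => Real.cos (inner ℝ ξ y)) ν :=
    Integrable.mono' (integrable_const (1 : ℝ))
      (by fun_prop : Continuous _).aestronglyMeasurable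
      (ae_of_all _ fun y => Real.abs_cos_le_one _)
  apply Complex.ext
  · rw [Complex.ofReal_re, exponent, integral_sub (integrable_const _) hcos, integral_const,
      smul_eq_mul, mul_one, sub_sub_cancel, charFun_apply, ← RCLike.re_eq_complex_re,
      ← integral_re hint]
    refine integral_congr_ae (ae_of_all _ fun y => ?_)
    simp only [RCLike.re_eq_complex_re, Complex.exp_ofReal_mul_I_re, real_inner_comm]
  · rw [h1, Complex.ofReal_im]

/-- Symmetry turns `exp` into `cosh`. Splitting off the total mass leaves `cosh - 1`, which is
quadratic at the origin, so the second term can stay bounded while the mass of truncations of a Lévy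
measure blows up. -/
theorem lintegral_exp_inner_eq [IsFiniteMeasure ν] (hs : IsSymm ν)
    (l : EuclideanSpace ℝ (Fin d)) :
    ∫⁻ y, ENNReal.ofReal (Real.exp (inner ℝ l y)) ∂ν
      = ν Set.univ + ∫⁻ y, ENNReal.ofReal (Real.cosh (inner ℝ l y) - 1) ∂ν := by
  have := hs.isNegInvariant
  have hm : Measurable fun y : EuclideanSpace ℝ (Fin d) =>
      ENNReal.ofReal (Real.exp (inner ℝ l y)) := by fun_prop
  have h1 : ∫⁻ y, ENNReal.ofReal (Real.exp (-inner ℝ l y)) ∂ν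
      = ∫⁻ y, ENNReal.ofReal (Real.exp (inner ℝ l y)) ∂ν := by
    have h := lintegral_neg_eq_self (μ := ν) fun y => ENNReal.ofReal (Real.exp (inner ℝ l y))
    simpa only [inner_neg_right] using h
  -- The identity is proved in doubled form, so that no division is needed in `ℝ≥0∞`.
  have h2 : (2 : ℝ≥0∞) * ∫⁻ y, ENNReal.ofReal (Real.exp (inner ℝ l y)) ∂ν
      = 2 * (ν Set.univ + ∫⁻ y, ENNReal.ofReal (Real.cosh (inner ℝ l y) - 1) ∂ν) := by
    have hone : ν Set.univ = ∫⁻ _, 1 ∂ν := by simp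
    rw [two_mul]
    nth_rewrite 2 [← h1]
    rw [← lintegral_add_left hm, hone, ← lintegral_add_left measurable_const,
      ← lintegral_const_mul _ (by fun_prop)]
    refine lintegral_congr fun y => ?_
    rw [← ENNReal.ofReal_add (Real.exp_pos _).le (Real.exp_pos _).le, ← ENNReal.ofReal_one,
      ← ENNReal.ofReal_add zero_le_one (sub_nonneg.2 (Real.one_le_cosh _)),
      show (2 : ℝ≥0∞) * ENNReal.ofReal (1 + (Real.cosh (inner ℝ l y) - 1))
        = ENNReal.ofReal (2 * (1 + (Real.cosh (inner ℝ l y) - 1))) by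
          rw [ENNReal.ofReal_mul zero_le_two, ENNReal.ofReal_ofNat], Real.cosh_eq]
    congr 1
    ring
  exact (ENNReal.mul_right_inj two_ne_zero ENNReal.ofNat_ne_top).1 h2

/-- The step distribution of the random walk with `k` steps that approximates the compound
Poisson distribution with Lévy measure `ν`. -/
def stepMeasure (ν : Measure (EuclideanSpace ℝ (Fin d))) (k : ℕ) :
    Measure (EuclideanSpace ℝ (Fin d)) :=
  ENNReal.ofReal (1 - ν.real Set.univ / k) • Measure.dirac 0 + ENNReal.ofReal (1 / k) • ν

theorem isProbabilityMeasure_stepMeasure [IsFiniteMeasure ν] {k : ℕ} (hk : 0 < k)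
    (h : ν.real Set.univ ≤ k) : IsProbabilityMeasure (stepMeasure ν k) := by
  have hk' : (0 : ℝ) < k := by exact_mod_cast hk
  refine ⟨?_⟩
  have h1 : ν Set.univ = ENNReal.ofReal (ν.real Set.univ) := by simp
  simp only [stepMeasure, Measure.add_apply, Measure.smul_apply, smul_eq_mul, measure_univ,
    mul_one]
  rw [h1, ← ENNReal.ofReal_mul (by positivity), ← ENNReal.ofReal_add
    (sub_nonneg.2 ((div_le_one hk').2 h)) (by positivity), ← ENNReal.ofReal_one]
  congr 1
  ring

theorem charFun_stepMeasure [IsFiniteMeasure ν] (hs : IsSymm ν) {k : ℕ} (hk : 0 < k)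
    (h : ν.real Set.univ ≤ k) (ξ : EuclideanSpace ℝ (Fin d)) :
    charFun (stepMeasure ν k) ξ = ((1 + -exponent ν ξ / k : ℝ) : ℂ) := by
  have hk' : (0 : ℝ) < k := by exact_mod_cast hk
  have hint : ∀ (m : Measure (EuclideanSpace ℝ (Fin d))) [IsFiniteMeasure m],
      Integrable (fun y : EuclideanSpace ℝ (Fin d) =>
        Complex.exp (((inner ℝ y ξ : ℝ) : ℂ) * Complex.I)) m := fun m _ =>
    Integrable.mono' (integrable_const (1 : ℝ))
      (by fun_prop : Continuous _).aestronglyMeasurable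
      (ae_of_all _ fun y => by rw [Complex.norm_exp_ofReal_mul_I])
  have h1 := charFun_eq_of_isSymm hs ξ
  rw [charFun_apply] at h1 ⊢
  rw [stepMeasure, integral_add_measure ((hint _).smul_measure ENNReal.ofReal_ne_top)
    ((hint _).smul_measure ENNReal.ofReal_ne_top), integral_smul_measure, integral_smul_measure,
    h1, integral_dirac, ENNReal.toReal_ofReal (sub_nonneg.2 ((div_le_one hk').2 h)),
    ENNReal.toReal_ofReal (by positivity)]
  simp only [inner_zero_left, Complex.ofReal_zero, zero_mul, Complex.exp_zero,
    Complex.real_smul]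
  push_cast
  ring

/-- One step has exponential moment at most `1 + K / k ≤ e^{K/k}`, so `k` steps give at most `e^K`,
independently of `k`. -/
theorem lintegral_exp_inner_stepMeasure_le [IsFiniteMeasure ν] (hs : IsSymm ν) {k : ℕ}
    (hk : 0 < k) (h : ν.real Set.univ ≤ k) {l : EuclideanSpace ℝ (Fin d)} {K : ℝ} (hK0 : 0 ≤ K)
    (hK : ∫⁻ y, ENNReal.ofReal (Real.cosh (inner ℝ l y) - 1) ∂ν ≤ ENNReal.ofReal K) :
    ∫⁻ y, ENNReal.ofReal (Real.exp (inner ℝ l y)) ∂(stepMeasure ν k)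
      ≤ ENNReal.ofReal (Real.exp (K / k)) := by
  have hk' : (0 : ℝ) < k := by exact_mod_cast hk
  have hm : Measurable fun y : EuclideanSpace ℝ (Fin d) =>
      ENNReal.ofReal (Real.exp (inner ℝ l y)) := by fun_prop
  have h1 : ν Set.univ = ENNReal.ofReal (ν.real Set.univ) := by simp
  rw [stepMeasure, lintegral_add_measure, lintegral_smul_measure, lintegral_smul_measure,
    lintegral_dirac' _ hm, lintegral_exp_inner_eq hs, h1]
  simp only [inner_zero_right, Real.exp_zero, ENNReal.ofReal_one, smul_eq_mul, mul_one]
  calc _ ≤ ENNReal.ofReal (1 - ν.real Set.univ / k) + ENNReal.ofReal (1 / k) *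
        (ENNReal.ofReal (ν.real Set.univ) + ENNReal.ofReal K) := by gcongr
    _ = ENNReal.ofReal (K / k + 1) := by
      rw [← ENNReal.ofReal_add (by positivity) hK0, ← ENNReal.ofReal_mul (by positivity),
        ← ENNReal.ofReal_add (sub_nonneg.2 ((div_le_one hk').2 h)) (by positivity)]
      congr 1
      ring
    _ ≤ _ := ENNReal.ofReal_le_ofReal (Real.add_one_le_exp _)

/-- The walk with `k` steps has characteristic function `(1 - ψ/k)^k`, which tends to `e^{-ψ}`. -/
theorem gaussianNonneg_of_isFiniteMeasure [IsFiniteMeasure ν] (hν : IsLevyMeasure ν)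
    (hs : IsSymm ν) {l : EuclideanSpace ℝ (Fin d)} {K : ℝ} (hK0 : 0 ≤ K)
    (hK : ∫⁻ y, ENNReal.ofReal (Real.cosh (inner ℝ l y) - 1) ∂ν ≤ ENNReal.ofReal K) :
    GaussianNonneg l (ENNReal.ofReal (Real.exp K)) fun ξ => Real.exp (-exponent ν ξ) := by
  obtain ⟨k₀, hk₀⟩ := exists_nat_ge (ν.real Set.univ)
  -- The shift keeps `k` positive and at least the total mass of `ν`, so that every step measure is
  -- a probability measure.
  set k : ℕ → ℕ := fun n => n + (k₀ + 1) with hkdef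
  have hk : ∀ n, 0 < k n := fun n => by simp only [hkdef]; omega
  have hkν : ∀ n, ν.real Set.univ ≤ k n := fun n => hk₀.trans (by
    simp only [hkdef]
    push_cast
    have : (0 : ℝ) ≤ n := n.cast_nonneg
    linarith)
  have hprob := fun n => isProbabilityMeasure_stepMeasure (hk n) (hkν n)
  have hprob' := fun n => isProbabilityMeasure_convPow (stepMeasure ν (k n)) (k n)
  have hchar : ∀ n ξ, charFun (convPow (stepMeasure ν (k n)) (k n)) ξ
      = (((1 + -exponent ν ξ / k n) ^ k n : ℝ) : ℂ) := fun n ξ => by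
    rw [charFun_convPow, charFun_stepMeasure hs (hk n) (hkν n)]
    push_cast
    rfl
  have hψ := hν.continuous_exponent
  refine GaussianNonneg.of_tendsto (φ := fun n ξ => (1 + -exponent ν ξ / k n) ^ k n)
    (fun n => by fun_prop) (fun n ξ => ?_) (fun ξ => ?_) (fun n =>
      gaussianNonneg_of_charFun (convPow (stepMeasure ν (k n)) (k n)) (hchar n) ?_)
  · have h1 := norm_charFun_le_one (μ := convPow (stepMeasure ν (k n)) (k n)) ξ
    rwa [hchar, Complex.norm_real] at h1
  · exact (Real.tendsto_one_add_div_pow_exp _).comp (tendsto_add_atTop_nat (k₀ + 1))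
  · rw [lintegral_exp_inner_convPow]
    have hk' : (k n : ℝ) ≠ 0 := by exact_mod_cast (hk n).ne'
    calc _ ≤ (ENNReal.ofReal (Real.exp (K / k n))) ^ k n := by
          gcongr
          exact lintegral_exp_inner_stepMeasure_le hs (hk n) (hkν n) hK0 hK
      _ = _ := by
        rw [← ENNReal.ofReal_pow (Real.exp_pos _).le, ← Real.exp_nat_mul,
          mul_div_cancel₀ _ hk']

theorem tendsto_exponent_restrict (hν : IsLevyMeasure ν) (ξ : EuclideanSpace ℝ (Fin d)) :
    Tendsto (fun n : ℕ => exponent (ν.restrict {y | 1 / ((n : ℝ) + 1) < ‖y‖}) ξ) atTop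
      (𝓝 (exponent ν ξ)) := by
  have hmono : Monotone fun n : ℕ =>
      {y : EuclideanSpace ℝ (Fin d) | 1 / ((n : ℝ) + 1) < ‖y‖} := fun m n hmn y hy => by
    have h2 : 1 / ((n : ℝ) + 1) ≤ 1 / ((m : ℝ) + 1) := by gcongr
    exact lt_of_le_of_lt h2 hy
  have h := tendsto_setIntegral_of_monotone (μ := ν)
    (fun n : ℕ => measurableSet_lt measurable_const measurable_norm) hmono
    (hν.integrable_one_sub_cos ξ).integrableOn
  have hU : (⋃ n : ℕ, {y : EuclideanSpace ℝ (Fin d) | 1 / ((n : ℝ) + 1) < ‖y‖}) = {0}ᶜ := by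
    ext y
    simp only [Set.mem_iUnion, Set.mem_ofPred_eq, Set.mem_compl_iff, Set.mem_singleton_iff]
    refine ⟨fun ⟨n, hn⟩ hy => ?_, fun hy => exists_nat_one_div_lt (norm_pos_iff.2 hy)⟩
    rw [hy, norm_zero] at hn
    exact absurd hn (not_lt.2 (by positivity))
  have h0 : ∀ᵐ y ∂ν, y ∈ ({0}ᶜ : Set (EuclideanSpace ℝ (Fin d))) := compl_mem_ae_iff.2 hν.zero
  rw [hU, Measure.restrict_eq_self_of_ae_mem h0] at h
  exact h

/-- Removing the jumps of size at most `1 / (n + 1)` makes `ν` finite. As `cosh - 1 ≥ 0`, the same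
`K` serves all truncations, and their exponents converge to `ψ`. -/
theorem gaussianNonneg_exp_neg_exponent (hν : IsLevyMeasure ν)
    (hs : IsSymm ν) {l : EuclideanSpace ℝ (Fin d)} {K : ℝ} (hK0 : 0 ≤ K)
    (hK : ∫⁻ y, ENNReal.ofReal (Real.cosh (inner ℝ l y) - 1) ∂ν ≤ ENNReal.ofReal K) :
    GaussianNonneg l (ENNReal.ofReal (Real.exp K)) fun ξ => Real.exp (-exponent ν ξ) := by
  set A : ℕ → Set (EuclideanSpace ℝ (Fin d)) := fun n => {y | 1 / ((n : ℝ) + 1) < ‖y‖} with hA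
  have hfin : ∀ n, IsFiniteMeasure (ν.restrict (A n)) := fun n =>
    ⟨by rw [Measure.restrict_apply_univ]; exact hν.measure_norm_gt_lt_top (by positivity)⟩
  have hsymm : ∀ n, IsSymm (ν.restrict (A n)) := fun n =>
    hs.restrict (measurableSet_lt measurable_const measurable_norm) (by ext y; simp [hA])
  have hc := fun n => (hν.restrict (A n)).continuous_exponent
  refine GaussianNonneg.of_tendsto (φ := fun n ξ => Real.exp (-exponent (ν.restrict (A n)) ξ))
    (fun n => by have := hc n; fun_prop) (fun n ξ => ?_)
    (fun ξ => (Real.continuous_exp.tendsto _).comp (tendsto_exponent_restrict hν ξ).neg)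
    fun n => gaussianNonneg_of_isFiniteMeasure (hν.restrict _) (hsymm n) hK0
      ((lintegral_mono' Measure.restrict_le_self le_rfl).trans hK)
  rw [abs_of_pos (Real.exp_pos _), Real.exp_le_one_iff]
  exact neg_nonpos.2 (exponent_nonneg _)

/-! ### Densities of symmetric infinitely divisible laws -/

/-- The density of the infinitely divisible distribution with Lévy measure `ν`. -/
def levyDensity (ν : Measure (EuclideanSpace ℝ (Fin d))) (x : EuclideanSpace ℝ (Fin d)) : ℝ :=
  invF (fun ξ => Real.exp (-exponent ν ξ)) x

/-- Integrability of the characteristic function of the infinitely divisible distribution. -/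
def IntegrableExp (ν : Measure (EuclideanSpace ℝ (Fin d))) : Prop :=
  Integrable fun ξ : EuclideanSpace ℝ (Fin d) => Real.exp (-exponent ν ξ)

theorem abs_exp_neg_exponent_le_one (ξ : EuclideanSpace ℝ (Fin d)) :
    |Real.exp (-exponent ν ξ)| ≤ 1 := by
  rw [abs_of_pos (Real.exp_pos _), Real.exp_le_one_iff]
  exact neg_nonpos.2 (exponent_nonneg _)

theorem lintegral_exp_inner_mul_levyDensity_le (hν : IsLevyMeasure ν) (hs : IsSymm ν)
    (hint : IntegrableExp ν) {l : EuclideanSpace ℝ (Fin d)} {K : ℝ} (hK0 : 0 ≤ K)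
    (hK : ∫⁻ y, ENNReal.ofReal (Real.cosh (inner ℝ l y) - 1) ∂ν ≤ ENNReal.ofReal K) :
    ∫⁻ x, ENNReal.ofReal (Real.exp (inner ℝ l x) * levyDensity ν x)
      ≤ ENNReal.ofReal (Real.exp K) :=
  ((gaussianNonneg_exp_neg_exponent hν hs hK0 hK).invF ENNReal.ofReal_ne_top
    (by have := hν.continuous_exponent; fun_prop) hint abs_exp_neg_exponent_le_one).2

theorem levyDensity_nonneg (hν : IsLevyMeasure ν) (hs : IsSymm ν) (hint : IntegrableExp ν)
    (x : EuclideanSpace ℝ (Fin d)) : 0 ≤ levyDensity ν x :=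
  ((gaussianNonneg_exp_neg_exponent (l := 0) hν hs le_rfl (by simp)).invF ENNReal.ofReal_ne_top
    (by have := hν.continuous_exponent; fun_prop) hint abs_exp_neg_exponent_le_one).1 x

theorem continuous_levyDensity (hint : IntegrableExp ν) : Continuous (levyDensity ν) :=
  continuous_invF hint

theorem levyDensity_neg (x : EuclideanSpace ℝ (Fin d)) :
    levyDensity ν (-x) = levyDensity ν x := invF_neg _ _

theorem integrable_levyDensity (hν : IsLevyMeasure ν) (hs : IsSymm ν)
    (hint : IntegrableExp ν) : Integrable (levyDensity ν) := by
  refine ⟨(continuous_levyDensity hint).aestronglyMeasurable, ?_⟩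
  rw [hasFiniteIntegral_iff_ofReal (ae_of_all _ (levyDensity_nonneg hν hs hint))]
  have h := lintegral_exp_inner_mul_levyDensity_le (l := 0) hν hs hint le_rfl (by simp)
  simp only [inner_zero_left, Real.exp_zero, one_mul] at h
  exact h.trans_lt ENNReal.ofReal_lt_top

theorem integral_cos_mul_levyDensity (hν : IsLevyMeasure ν) (hs : IsSymm ν)
    (hint : IntegrableExp ν) (ξ : EuclideanSpace ℝ (Fin d)) :
    ∫ x, Real.cos (inner ℝ x ξ) * levyDensity ν x = Real.exp (-exponent ν ξ) :=
  invF_inversion (by have := hν.continuous_exponent; fun_prop) hint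
    (fun ξ => by rw [exponent_neg]) (integrable_levyDensity hν hs hint) ξ

theorem integral_levyDensity (hν : IsLevyMeasure ν) (hs : IsSymm ν)
    (hint : IntegrableExp ν) : ∫ x, levyDensity ν x = 1 := by
  simpa [exponent_zero] using integral_cos_mul_levyDensity hν hs hint 0

theorem lintegral_levyDensity (hν : IsLevyMeasure ν) (hs : IsSymm ν)
    (hint : IntegrableExp ν) : ∫⁻ x, ENNReal.ofReal (levyDensity ν x) = 1 := by
  rw [← ofReal_integral_eq_lintegral_ofReal (integrable_levyDensity hν hs hint)
    (ae_of_all _ (levyDensity_nonneg hν hs hint)), integral_levyDensity hν hs hint,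
    ENNReal.ofReal_one]

/-- Convolution of infinitely divisible densities adds the Lévy measures. -/
theorem levyDensity_add {ν' : Measure (EuclideanSpace ℝ (Fin d))} (hν : IsLevyMeasure ν)
    (hint : IntegrableExp ν) (hν' : IsLevyMeasure ν') (hs' : IsSymm ν')
    (hint' : IntegrableExp ν') (x : EuclideanSpace ℝ (Fin d)) :
    levyDensity (ν + ν') x = ∫ y, levyDensity ν (x - y) * levyDensity ν' y := by
  have h := invF_mul hint (integrable_levyDensity hν' hs' hint') levyDensity_neg
    (integral_cos_mul_levyDensity hν' hs' hint') x
  rw [levyDensity, show (fun y => levyDensity ν (x - y) * levyDensity ν' y)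
    = fun y => invF (fun ξ => Real.exp (-exponent ν ξ)) (x - y) * levyDensity ν' y from rfl, ← h]
  congr 1
  ext ξ
  rw [exponent_add hν hν', neg_add, Real.exp_add]

theorem density_eq_levyDensity {t : ℝ} (ht : 0 ≤ t) (hint : IntegrableExp (ENNReal.ofReal t • ν))
    (x : EuclideanSpace ℝ (Fin d)) :
    density ν t x = levyDensity (ENNReal.ofReal t • ν) x := by
  simp only [IntegrableExp, levyDensity, exponent_smul ht] at hint ⊢
  exact density_eq_invF t hint x

/-! ### Lipschitz continuity of translations in `L¹` -/

theorem abs_sin_sub_self_le (b : ℝ) : |Real.sin b - b| ≤ 2 * b ^ 2 := by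
  have h : ∀ b : ℝ, 0 ≤ b → |Real.sin b - b| ≤ 2 * b ^ 2 := by
    intro b hb
    rw [abs_sub_comm, abs_of_nonneg (sub_nonneg.2 (Real.sin_le hb))]
    rcases le_total b 1 with h1 | h1
    · rcases hb.eq_or_lt with h0 | h0
      · simp [← h0]
      · have := Real.sin_gt_sub_cube h0
        nlinarith [pow_pos h0 2, pow_pos h0 3]
    · nlinarith [Real.neg_one_le_sin b]
  rcases le_total 0 b with hb | hb
  · exact h b hb
  · have := h (-b) (by linarith)
    rw [Real.sin_neg, neg_sub_neg, neg_sq, abs_sub_comm] at this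
    exact this

theorem abs_cos_add_sub_le (a b : ℝ) :
    |Real.cos (a + b) - Real.cos a + b * Real.sin a| ≤ 3 * b ^ 2 := by
  have h1 : Real.cos (a + b) - Real.cos a + b * Real.sin a
      = -(Real.cos a * (1 - Real.cos b)) - Real.sin a * (Real.sin b - b) := by
    rw [Real.cos_add]
    ring
  have h2 : |Real.cos a * (1 - Real.cos b)| ≤ b ^ 2 / 2 := by
    rw [abs_mul, abs_of_nonneg (one_sub_cos_nonneg b)]
    exact (mul_le_of_le_one_left (one_sub_cos_nonneg b) (Real.abs_cos_le_one a)).trans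
      (one_sub_cos_le_sq b)
  have h3 : |Real.sin a * (Real.sin b - b)| ≤ 2 * b ^ 2 := by
    rw [abs_mul]
    exact (mul_le_of_le_one_left (abs_nonneg _) (Real.abs_sin_le_one a)).trans
      (abs_sin_sub_self_le b)
  rw [h1]
  have h4 := abs_sub (-(Real.cos a * (1 - Real.cos b))) (Real.sin a * (Real.sin b - b))
  rw [abs_neg] at h4
  nlinarith [sq_nonneg b]

/-- A nonnegative function whose first-order Taylor remainders are at most `M ‖z‖ ^ 2` has a
Lipschitz square root. -/
theorem sqrt_add_le_of_taylor {V : Type*} [NormedAddCommGroup V] [NormedSpace ℝ V]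
    {q : V → ℝ} (hq : ∀ x, 0 ≤ q x) {M : ℝ} (hM : 0 ≤ M) (x : V) (ℓ : V →ₗ[ℝ] ℝ)
    (h : ∀ z, q (x + z) ≤ q x + ℓ z + M * ‖z‖ ^ 2) (z : V) :
    √(q (x + z)) ≤ √(q x) + √M * ‖z‖ := by
  -- Along the line through `z` the quadratic upper bound for `q` dominates a nonnegative function,
  -- so its discriminant is not positive. This bounds the slope: `ℓ z ≤ 2 √(q x) √M ‖z‖`, which
  -- completes the square.
  have h1 : ∀ s : ℝ, 0 ≤ (M * ‖z‖ ^ 2) * (s * s) + ℓ z * s + q x := by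
    intro s
    have h2 := (hq _).trans (h (s • z))
    rw [map_smul, norm_smul, mul_pow, Real.norm_eq_abs, sq_abs, smul_eq_mul] at h2
    linarith
  have h3 := discrim_le_zero h1
  rw [discrim] at h3
  have h4 : ℓ z ≤ 2 * (√(q x) * (√M * ‖z‖)) := by
    refine le_of_abs_le (abs_le_of_sq_le_sq ?_ (by positivity))
    have : (2 * (√(q x) * (√M * ‖z‖))) ^ 2 = 4 * (√(q x) ^ 2 * (√M ^ 2 * ‖z‖ ^ 2)) := by ring
    rw [this, Real.sq_sqrt (hq x), Real.sq_sqrt hM]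
    linarith
  refine Real.sqrt_le_iff.2 ⟨by positivity, (h z).trans ?_⟩
  have h5 : (√(q x) + √M * ‖z‖) ^ 2
      = √(q x) ^ 2 + 2 * (√(q x) * (√M * ‖z‖)) + √M ^ 2 * ‖z‖ ^ 2 := by ring
  rw [h5, Real.sq_sqrt (hq x), Real.sq_sqrt hM]
  linarith

/-- The Lipschitz bound for `√q`, used from both end points, combined with `a² - b² = (a - b)(a +
b)`. -/
theorem abs_sub_le_of_taylor {V : Type*} [NormedAddCommGroup V] [NormedSpace ℝ V]
    {q : V → ℝ} (hq : ∀ x, 0 ≤ q x) {M : ℝ} (hM : 0 ≤ M) (ℓ : V → V →ₗ[ℝ] ℝ)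
    (h : ∀ x z, q (x + z) ≤ q x + ℓ x z + M * ‖z‖ ^ 2) (x z : V) :
    |q (x + z) - q x| ≤ √M * ‖z‖ * (√(q (x + z)) + √(q x)) := by
  have h1 := sqrt_add_le_of_taylor hq hM x (ℓ x) (h x) z
  have h2 := sqrt_add_le_of_taylor hq hM (x + z) (ℓ (x + z)) (h (x + z)) (-z)
  rw [add_neg_cancel_right, norm_neg] at h2
  have h3 : q (x + z) - q x = (√(q (x + z)) - √(q x)) * (√(q (x + z)) + √(q x)) := by
    have e1 := Real.sq_sqrt (hq (x + z))
    have e2 := Real.sq_sqrt (hq x)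
    nlinarith
  have h4 : 0 ≤ √(q (x + z)) + √(q x) := by positivity
  rw [h3, abs_mul, abs_of_nonneg h4]
  exact mul_le_mul_of_nonneg_right (abs_le.2 ⟨by linarith, by linarith⟩) h4

/-- The linear map is the gradient at `x`, obtained by expanding the cosine under the integral. What
matters is that the quadratic constant does not depend on `x`. -/
theorem exists_linearMap_invF_le {φ : EuclideanSpace ℝ (Fin d) → ℝ} (hφ : Integrable φ)
    (h0 : ∀ ξ, 0 ≤ φ ξ) (h2 : Integrable fun ξ => ‖ξ‖ ^ 2 * φ ξ)
    (x : EuclideanSpace ℝ (Fin d)) :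
    ∃ ℓ : EuclideanSpace ℝ (Fin d) →ₗ[ℝ] ℝ, ∀ z, invF φ (x + z) ≤ invF φ x + ℓ z
      + (3 * (((2 * Real.pi) ^ d)⁻¹ * ∫ ξ, ‖ξ‖ ^ 2 * φ ξ)) * ‖z‖ ^ 2 := by
  have hint : ∀ z, Integrable fun ξ : EuclideanSpace ℝ (Fin d) =>
      inner ℝ ξ z * (Real.sin (inner ℝ ξ x) * φ ξ) := by
    intro z
    refine ((hφ.add h2).mul_const ‖z‖).mono' ((by fun_prop : Continuous fun
      ξ : EuclideanSpace ℝ (Fin d) => inner ℝ ξ z).aestronglyMeasurable.mul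
        (integrable_sin_mul hφ x).aestronglyMeasurable) (ae_of_all _ fun ξ => ?_)
    simp only [norm_mul, Real.norm_eq_abs, abs_of_nonneg (h0 ξ), Pi.add_apply]
    have e1 := abs_real_inner_le_norm ξ z
    have e2 := Real.abs_sin_le_one (inner ℝ ξ x)
    have e3 : |Real.sin (inner ℝ ξ x)| * φ ξ ≤ φ ξ := mul_le_of_le_one_left (h0 ξ) e2
    have e4 : ‖ξ‖ ≤ 1 + ‖ξ‖ ^ 2 := by nlinarith [sq_nonneg (‖ξ‖ - 1)]
    calc |inner ℝ ξ z| * (|Real.sin (inner ℝ ξ x)| * φ ξ)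
        ≤ (‖ξ‖ * ‖z‖) * φ ξ := by
          have := h0 ξ
          gcongr
      _ ≤ ((1 + ‖ξ‖ ^ 2) * ‖z‖) * φ ξ := by
          have := h0 ξ
          gcongr
      _ = _ := by ring
  refine ⟨{ toFun := fun z => -(((2 * Real.pi) ^ d)⁻¹ *
              ∫ ξ, inner ℝ ξ z * (Real.sin (inner ℝ ξ x) * φ ξ))
            map_add' := fun z z' => ?_
            map_smul' := fun c z => ?_ }, fun z => ?_⟩
  · simp only [inner_add_right, add_mul]
    rw [integral_add (hint z) (hint z')]
    ring
  · simp only [inner_smul_right, mul_assoc, RingHom.id_apply, smul_eq_mul]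
    rw [integral_const_mul]
    ring
  · simp only [LinearMap.coe_mk, AddHom.coe_mk]
    have h3 : ∫ ξ, Real.cos (inner ℝ ξ (x + z)) * φ ξ
        ≤ ∫ ξ, (Real.cos (inner ℝ ξ x) * φ ξ - inner ℝ ξ z * (Real.sin (inner ℝ ξ x) * φ ξ)
          + 3 * (‖ξ‖ ^ 2 * φ ξ) * ‖z‖ ^ 2) := by
      refine integral_mono (integrable_cos_mul hφ _)
        (((integrable_cos_mul hφ x).sub (hint z)).add ((h2.const_mul 3).mul_const _))
        fun ξ => ?_
      have e1 := le_of_abs_le (abs_cos_add_sub_le (inner ℝ ξ x) (inner ℝ ξ z))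
      have e2 : (inner ℝ ξ z) ^ 2 ≤ ‖ξ‖ ^ 2 * ‖z‖ ^ 2 := by
        rw [← mul_pow, ← sq_abs]
        exact pow_le_pow_left₀ (abs_nonneg _) (abs_real_inner_le_norm ξ z) 2
      simp only [inner_add_right]
      nlinarith [h0 ξ]
    have h5 : Integrable fun ξ => Real.cos (inner ℝ ξ x) * φ ξ
        - inner ℝ ξ z * (Real.sin (inner ℝ ξ x) * φ ξ) := (integrable_cos_mul hφ x).sub (hint z)
    rw [integral_add h5 ((h2.const_mul 3).mul_const _),
      integral_sub (integrable_cos_mul hφ x) (hint z), integral_mul_const,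
      integral_const_mul] at h3
    have h4 := mul_le_mul_of_nonneg_left h3 (invF_const_pos (d := d)).le
    rw [invF, invF]
    refine h4.trans (le_of_eq ?_)
    ring

theorem norm_le_sum_abs (x : EuclideanSpace ℝ (Fin d)) : ‖x‖ ≤ ∑ i, |x i| := by
  have h := norm_sum_le Finset.univ fun i => x i • EuclideanSpace.basisFun (Fin d) ℝ i
  have h1 : ∑ i, x i • EuclideanSpace.basisFun (Fin d) ℝ i = x :=
    (EuclideanSpace.basisFun (Fin d) ℝ).sum_repr x
  rw [h1] at h
  refine h.trans (Finset.sum_le_sum fun i _ => ?_)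
  rw [norm_smul, (EuclideanSpace.basisFun (Fin d) ℝ).orthonormal.1 i, mul_one]
  exact le_rfl

/-- The vector with entries `± (d + 1)` prescribed by `σ`. -/
def signVector (σ : Fin d → Bool) : EuclideanSpace ℝ (Fin d) :=
  WithLp.toLp 2 fun i => if σ i then ((d : ℝ) + 1) else -((d : ℝ) + 1)

/-- Matching `σ` to the signs of the coordinates gives the exponent `(d + 1) ∑ |x i|`, and `1 + r ≤
e^r` does the rest. Finitely many exponential moments thus control a polynomial one. -/
theorem one_add_norm_pow_le_sum_exp (x : EuclideanSpace ℝ (Fin d)) :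
    (1 + ‖x‖) ^ (d + 1) ≤ ∑ σ : Fin d → Bool, Real.exp (inner ℝ (signVector σ) x) := by
  classical
  set σ₀ : Fin d → Bool := fun i => decide (0 ≤ x i) with hσ
  have h1 : inner ℝ (signVector σ₀) x = ((d : ℝ) + 1) * ∑ i, |x i| := by
    rw [PiLp.inner_apply, Finset.mul_sum]
    refine Finset.sum_congr rfl fun i _ => ?_
    simp only [signVector, hσ, decide_eq_true_eq, RCLike.inner_apply, conj_trivial]
    split_ifs with h
    · rw [abs_of_nonneg h]
      ring
    · rw [abs_of_neg (not_le.1 h)]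
      ring
  calc (1 + ‖x‖) ^ (d + 1) ≤ (Real.exp (∑ i, |x i|)) ^ (d + 1) := by
        gcongr
        linarith [Real.add_one_le_exp (∑ i, |x i|), norm_le_sum_abs x]
    _ = Real.exp (inner ℝ (signVector σ₀) x) := by
        rw [← Real.exp_nat_mul, h1]
        push_cast
        rfl
    _ ≤ _ := Finset.single_le_sum (f := fun σ => Real.exp (inner ℝ (signVector σ) x))
        (fun σ _ => (Real.exp_pos _).le) (Finset.mem_univ σ₀)

/-- With `W = (1 + |x|)^(d+1)` one has `√q ≤ W q + 1/W`. The first term is integrable by the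
exponential moments of `q`, the second by the choice of the power. -/
theorem integrable_sqrt_levyDensity (hν : IsLevyMeasure ν) (hs : IsSymm ν)
    (hint : IntegrableExp ν) (hcosh : ∀ l : EuclideanSpace ℝ (Fin d),
      ∫⁻ y, ENNReal.ofReal (Real.cosh (inner ℝ l y) - 1) ∂ν ≠ ⊤) :
    Integrable fun x => √(levyDensity ν x) := by
  have hc := continuous_levyDensity hint
  have h0 := levyDensity_nonneg hν hs hint
  have hexp : ∀ l : EuclideanSpace ℝ (Fin d),
      Integrable fun x => Real.exp (inner ℝ l x) * levyDensity ν x := by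
    intro l
    refine ⟨(by fun_prop : Continuous _).aestronglyMeasurable, ?_⟩
    rw [hasFiniteIntegral_iff_ofReal
      (ae_of_all _ fun x => mul_nonneg (Real.exp_pos _).le (h0 x))]
    exact (lintegral_exp_inner_mul_levyDensity_le hν hs hint ENNReal.toReal_nonneg
      (ENNReal.ofReal_toReal (hcosh l)).ge).trans_lt ENNReal.ofReal_lt_top
  refine ((integrable_finsetSum (Finset.univ : Finset (Fin d → Bool)) fun σ _ =>
    hexp (signVector σ)).add integrable_inv_one_add_norm_pow).mono'
    (by fun_prop : Continuous _).aestronglyMeasurable (ae_of_all _ fun x => ?_)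
  rw [Real.norm_eq_abs, abs_of_nonneg (Real.sqrt_nonneg _)]
  simp only [Pi.add_apply]
  rw [← Finset.sum_mul]
  have hW : 0 < (1 + ‖x‖) ^ (d + 1) := by positivity
  have h1 := mul_le_mul_of_nonneg_right (one_add_norm_pow_le_sum_exp x) (h0 x)
  refine le_trans ?_ (add_le_add_left h1 _)
  set W := (1 + ‖x‖) ^ (d + 1)
  refine Real.sqrt_le_iff.2 ⟨add_nonneg (mul_nonneg hW.le (h0 x)) (inv_pos.2 hW).le, ?_⟩
  have h2 : (W * levyDensity ν x + W⁻¹) ^ 2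
      = (W * levyDensity ν x) ^ 2 + 2 * levyDensity ν x + W⁻¹ ^ 2 := by
    field_simp
    ring
  nlinarith [sq_nonneg (W * levyDensity ν x), sq_nonneg W⁻¹, h0 x]

/-- Integrating the pointwise bound `√M |z| (√q(x+z) + √q(x))` over `x` gives the constant `2 √M ∫
√q`. -/
theorem exists_integral_abs_levyDensity_add_sub_le (hν : IsLevyMeasure ν) (hs : IsSymm ν)
    (hint : IntegrableExp ν)
    (h2 : Integrable fun ξ : EuclideanSpace ℝ (Fin d) => ‖ξ‖ ^ 2 * Real.exp (-exponent ν ξ))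
    (hcosh : ∀ l : EuclideanSpace ℝ (Fin d),
      ∫⁻ y, ENNReal.ofReal (Real.cosh (inner ℝ l y) - 1) ∂ν ≠ ⊤) :
    ∃ C : ℝ, 0 ≤ C ∧ ∀ z, ∫ x, |levyDensity ν (x + z) - levyDensity ν x| ≤ C * ‖z‖ := by
  have hsq := integrable_sqrt_levyDensity hν hs hint hcosh
  choose ℓ hℓ using exists_linearMap_invF_le hint (fun ξ => (Real.exp_pos _).le) h2
  set M := 3 * (((2 * Real.pi) ^ d)⁻¹ *
    ∫ ξ : EuclideanSpace ℝ (Fin d), ‖ξ‖ ^ 2 * Real.exp (-exponent ν ξ)) with hM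
  have hM0 : 0 ≤ M := mul_nonneg (by norm_num) (mul_nonneg invF_const_pos.le
    (integral_nonneg fun ξ => by positivity))
  have hi := integrable_levyDensity hν hs hint
  refine ⟨√M * (2 * ∫ x, √(levyDensity ν x)), mul_nonneg (Real.sqrt_nonneg _)
    (mul_nonneg zero_le_two (integral_nonneg fun _ => Real.sqrt_nonneg _)), fun z => ?_⟩
  calc ∫ x, |levyDensity ν (x + z) - levyDensity ν x|
      ≤ ∫ x, √M * ‖z‖ * (√(levyDensity ν (x + z)) + √(levyDensity ν x)) :=
        integral_mono ((hi.comp_add_right z).sub hi).abs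
          (((hsq.comp_add_right z).add hsq).const_mul _)
          fun x => abs_sub_le_of_taylor (levyDensity_nonneg hν hs hint) hM0 ℓ hℓ x z
    _ = _ := by
      rw [integral_const_mul, integral_add (hsq.comp_add_right z) hsq,
        integral_add_right_eq_self (fun x => √(levyDensity ν x)) z]
      ring

theorem integral_abs_integral_mul_le {k h : EuclideanSpace ℝ (Fin d) → ℝ}
    (hk : Integrable k) (hh : Integrable h) :
    ∫ x, |∫ z, k (x - z) * h z| ≤ (∫ x, |k x|) * ∫ z, |h z| := by
  have hF : Integrable (fun p : EuclideanSpace ℝ (Fin d) × EuclideanSpace ℝ (Fin d) =>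
      k (p.1 - p.2) * h p.2) (volume.prod volume) := by
    have := hh.convolution_integrand (ContinuousLinearMap.mul ℝ ℝ) hk
    simpa [mul_comm] using this
  calc ∫ x, |∫ z, k (x - z) * h z| ≤ ∫ x, ∫ z, |k (x - z) * h z| :=
        integral_mono hF.integral_prod_left.abs hF.abs.integral_prod_left
          fun x => abs_integral_le_integral_abs
    _ = ∫ z, ∫ x, |k (x - z) * h z| := integral_integral_swap hF.abs
    _ = _ := by
      simp_rw [abs_mul, integral_mul_const, integral_sub_right_eq_self (fun x => |k x|)]
      rw [integral_const_mul]

/-! ### Small and large jumps -/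

theorem cosh_sub_one_le (x : ℝ) : Real.cosh x - 1 ≤ x ^ 2 * Real.cosh x := by
  have h1 : ∀ x : ℝ, 0 ≤ x → Real.cosh x - 1 ≤ x ^ 2 * Real.cosh x := by
    intro x hx
    have h2 : Real.cosh x - 1 = 2 * Real.sinh (x / 2) ^ 2 := by
      have h3 := Real.cosh_two_mul (x / 2)
      rw [mul_div_cancel₀ x two_ne_zero, Real.cosh_sq] at h3
      linarith
    have h4 : Real.sinh (x / 2) ≤ x / 2 * Real.cosh (x / 2) := by
      have h5 : ∀ y : ℝ, 0 ≤ y → Real.sinh y ≤ y * Real.cosh y := by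
        intro y hy
        have hm : MonotoneOn (fun y => y * Real.cosh y - Real.sinh y) (Set.Ici 0) := by
          refine monotoneOn_of_deriv_nonneg (convex_Ici 0) (by fun_prop) (by fun_prop) ?_
          intro z hz
          rw [interior_Ici] at hz
          have hd : HasDerivAt (fun y => y * Real.cosh y - Real.sinh y)
              (1 * Real.cosh z + z * Real.sinh z - Real.cosh z) z :=
            ((hasDerivAt_id z).mul (Real.hasDerivAt_cosh z)).sub (Real.hasDerivAt_sinh z)
          rw [hd.deriv]
          have : 0 ≤ z * Real.sinh z :=
            mul_nonneg (le_of_lt hz) (Real.sinh_nonneg_iff.2 (le_of_lt hz))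
          linarith
        have := hm Set.self_mem_Ici hy hy
        simp only [zero_mul, Real.sinh_zero, sub_zero] at this
        linarith
      exact h5 _ (by linarith)
    have h6 : Real.sinh (x / 2) ^ 2 ≤ (x / 2 * Real.cosh (x / 2)) ^ 2 :=
      pow_le_pow_left₀ (Real.sinh_nonneg_iff.2 (by linarith)) h4 2
    have h7 : Real.cosh (x / 2) ^ 2 ≤ Real.cosh x := by
      have h3 := Real.cosh_two_mul (x / 2)
      rw [mul_div_cancel₀ x two_ne_zero] at h3
      nlinarith [sq_nonneg (Real.sinh (x / 2))]
    nlinarith [sq_nonneg x, mul_le_mul_of_nonneg_left h7 (sq_nonneg x),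
      Real.cosh_pos x, mul_nonneg (sq_nonneg x) (Real.cosh_pos x).le]
  rcases le_total 0 x with hx | hx
  · exact h1 x hx
  · have := h1 (-x) (by linarith)
    simpa using this

/-- The part of the measure carried by the open unit ball. -/
def smallJumps (ν : Measure (EuclideanSpace ℝ (Fin d))) : Measure (EuclideanSpace ℝ (Fin d)) :=
  ν.restrict (Metric.ball 0 1)

/-- The part of the measure carried by the complement of the open unit ball. -/
def largeJumps (ν : Measure (EuclideanSpace ℝ (Fin d))) : Measure (EuclideanSpace ℝ (Fin d)) :=
  ν.restrict (Metric.ball 0 1)ᶜ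

theorem isSymm_smallJumps (hs : IsSymm ν) : IsSymm (smallJumps ν) :=
  hs.restrict measurableSet_ball (by ext; simp)

theorem isSymm_largeJumps (hs : IsSymm ν) : IsSymm (largeJumps ν) :=
  hs.restrict measurableSet_ball.compl (by ext; simp)

theorem exponent_smallJumps_add_largeJumps (hν : IsLevyMeasure ν)
    (ξ : EuclideanSpace ℝ (Fin d)) :
    exponent (smallJumps ν) ξ + exponent (largeJumps ν) ξ = exponent ν ξ :=
  exponent_restrict_add_compl hν measurableSet_ball ξ

/-- On the unit ball `cosh(l·y) ≤ cosh |l|`, so the integrand is `O(|y|²)`. Large jumps need not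
have exponential moments, which is the reason for the splitting. -/
theorem lintegral_cosh_smallJumps_lt_top (hν : IsLevyMeasure ν)
    (l : EuclideanSpace ℝ (Fin d)) :
    ∫⁻ y, ENNReal.ofReal (Real.cosh (inner ℝ l y) - 1) ∂(smallJumps ν) ≠ ⊤ := by
  have h1 : ∫⁻ y, ENNReal.ofReal (Real.cosh (inner ℝ l y) - 1) ∂(smallJumps ν)
      ≤ ∫⁻ y, ENNReal.ofReal (‖l‖ ^ 2 * Real.cosh ‖l‖) * ENNReal.ofReal (min 1 (‖y‖ ^ 2))
        ∂(smallJumps ν) := by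
    refine setLIntegral_mono (by fun_prop) fun y hy => ?_
    rw [mem_ball_zero_iff] at hy
    rw [← ENNReal.ofReal_mul (by positivity)]
    refine ENNReal.ofReal_le_ofReal ((cosh_sub_one_le _).trans ?_)
    have e0 := abs_real_inner_le_norm l y
    have e1 : (inner ℝ l y) ^ 2 ≤ ‖l‖ ^ 2 * ‖y‖ ^ 2 := by
      rw [← mul_pow, ← sq_abs]
      exact pow_le_pow_left₀ (abs_nonneg _) e0 2
    have e2 : Real.cosh (inner ℝ l y) ≤ Real.cosh ‖l‖ := by
      rw [Real.cosh_le_cosh, abs_of_nonneg (norm_nonneg l)]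
      nlinarith [norm_nonneg l, norm_nonneg y]
    have e3 : ‖y‖ ^ 2 ≤ 1 := by nlinarith [norm_nonneg y]
    rw [min_eq_right e3]
    calc (inner ℝ l y) ^ 2 * Real.cosh (inner ℝ l y)
        ≤ (‖l‖ ^ 2 * ‖y‖ ^ 2) * Real.cosh ‖l‖ := by gcongr
      _ = _ := by ring
  refine ne_top_of_le_ne_top ?_ h1
  rw [lintegral_const_mul _ (by fun_prop)]
  exact ENNReal.mul_ne_top ENNReal.ofReal_ne_top (hν.restrict _).lintegral_lt_top.ne

theorem exists_exponent_largeJumps_le (hν : IsLevyMeasure ν) :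
    ∃ B : ℝ, ∀ ξ, exponent (largeJumps ν) ξ ≤ B := by
  have hfin : IsFiniteMeasure (largeJumps ν) := by
    refine ⟨?_⟩
    rw [largeJumps, Measure.restrict_apply_univ]
    refine (measure_mono fun y hy => ?_).trans_lt
      (hν.measure_norm_gt_lt_top (ε := 1 / 2) (by norm_num))
    have : 1 ≤ ‖y‖ := by simpa using hy
    exact lt_of_lt_of_le (by norm_num) this
  refine ⟨∫ _, 2 ∂(largeJumps ν), fun ξ => integral_mono
    ((hν.restrict _).integrable_one_sub_cos ξ) (integrable_const _) fun y => ?_⟩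
  linarith [Real.neg_one_le_cos (inner ℝ ξ y)]

/-- Dropping the finite measure of large jumps lowers `ψ` by at most a constant `B`, which costs
only a factor `e^{tB}`. -/
theorem Decay.restrict_ball (hν : IsLevyMeasure ν) (h : Decay ν) :
    Decay (smallJumps ν) := by
  intro t ht
  obtain ⟨B, hB⟩ := exists_exponent_largeJumps_le hν
  have hc := (hν.restrict (Metric.ball 0 1)).continuous_exponent
  refine ((h t ht).const_mul (Real.exp (t * B))).mono'
    (by unfold smallJumps; fun_prop : Continuous _).aestronglyMeasurable
    (ae_of_all _ fun ξ => ?_)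
  rw [Real.norm_eq_abs, abs_of_nonneg (by positivity), mul_left_comm, ← Real.exp_add]
  gcongr
  have h1 := exponent_smallJumps_add_largeJumps hν ξ
  nlinarith [hB ξ]

/-! ### Second differences of the transition density -/

/-- The symmetric second difference of `g` with step `y`. -/
def secondDiff (g : EuclideanSpace ℝ (Fin d) → ℝ) (y x : EuclideanSpace ℝ (Fin d)) : ℝ :=
  g (x + y) + g (x - y) - 2 * g x

theorem Decay.integrableExp (hν : IsLevyMeasure ν) (h : Decay ν) {t : ℝ} (ht : 0 < t) :
    IntegrableExp (ENNReal.ofReal t • ν) := by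
  simp only [IntegrableExp, exponent_smul ht.le]
  exact h.integrable_exp hν ht

theorem Decay.density_eq (hν : IsLevyMeasure ν) (h : Decay ν) {t : ℝ} (ht : 0 < t) :
    density ν t = levyDensity (ENNReal.ofReal t • ν) :=
  funext fun x => density_eq_levyDensity ht.le (h.integrableExp hν ht) x

theorem Decay.density_eq_invF (hν : IsLevyMeasure ν) (h : Decay ν) {t : ℝ} (ht : 0 < t) :
    density ν t = invF fun ξ => Real.exp (-(t * exponent ν ξ)) :=
  funext fun x => HardyStein.density_eq_invF t (h.integrable_exp hν ht) x

theorem Decay.density_nonneg (hν : IsLevyMeasure ν) (hs : IsSymm ν) (h : Decay ν) {t : ℝ}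
    (ht : 0 < t) (x : EuclideanSpace ℝ (Fin d)) : 0 ≤ density ν t x := by
  rw [h.density_eq hν ht]
  exact levyDensity_nonneg (hν.smul t) (hs.smul _) (h.integrableExp hν ht) x

theorem Decay.continuous_density (hν : IsLevyMeasure ν) (h : Decay ν) {t : ℝ}
    (ht : 0 < t) : Continuous (density ν t) := by
  rw [h.density_eq hν ht]
  exact continuous_levyDensity (h.integrableExp hν ht)

theorem Decay.integrable_density (hν : IsLevyMeasure ν) (hs : IsSymm ν) (h : Decay ν) {t : ℝ}
    (ht : 0 < t) : Integrable (density ν t) := by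
  rw [h.density_eq hν ht]
  exact integrable_levyDensity (hν.smul t) (hs.smul _) (h.integrableExp hν ht)

theorem Decay.integral_density (hν : IsLevyMeasure ν) (hs : IsSymm ν) (h : Decay ν) {t : ℝ}
    (ht : 0 < t) : ∫ x, density ν t x = 1 := by
  rw [h.density_eq hν ht]
  exact integral_levyDensity (hν.smul t) (hs.smul _) (h.integrableExp hν ht)

theorem Decay.lintegral_density (hν : IsLevyMeasure ν) (hs : IsSymm ν) (h : Decay ν) {t : ℝ}
    (ht : 0 < t) : ∫⁻ x, ENNReal.ofReal (density ν t x) = 1 := by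
  rw [h.density_eq hν ht]
  exact lintegral_levyDensity (hν.smul t) (hs.smul _) (h.integrableExp hν ht)

theorem Decay.integral_cos_mul_density (hν : IsLevyMeasure ν) (hs : IsSymm ν) (h : Decay ν)
    {t : ℝ} (ht : 0 < t) (ξ : EuclideanSpace ℝ (Fin d)) :
    ∫ x, Real.cos (inner ℝ x ξ) * density ν t x = Real.exp (-(t * exponent ν ξ)) := by
  rw [h.density_eq hν ht, ← exponent_smul ht.le]
  exact integral_cos_mul_levyDensity (hν.smul t) (hs.smul _) (h.integrableExp hν ht) ξ

/-- Discrete integration by parts: translating the integration variable moves one of the two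
differences from `q` to `g`. -/
theorem integral_abs_secondDiff_convolution_le {q g : EuclideanSpace ℝ (Fin d) → ℝ}
    (hq : Integrable q) (hqb : ∃ B, ∀ x, |q x| ≤ B) (hqc : Continuous q) (hg : Integrable g)
    (y : EuclideanSpace ℝ (Fin d)) :
    ∫ x, |secondDiff (fun x => ∫ z, q (x - z) * g z) y x|
      ≤ (∫ x, |q (x + y) - q x|) * ∫ z, |g (z + -y) - g z| := by
  obtain ⟨B, hB⟩ := hqb
  have hint : ∀ (x : EuclideanSpace ℝ (Fin d)) {g : EuclideanSpace ℝ (Fin d) → ℝ},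
      Integrable g → Integrable fun z => q (x - z) * g z := fun x g hg =>
    hg.bdd_mul (by fun_prop : Continuous _).aestronglyMeasurable (ae_of_all _ fun z => hB _)
  have hg' : Integrable fun z => g (z + -y) := hg.comp_add_right (-y)
  have key : ∀ x, secondDiff (fun x => ∫ z, q (x - z) * g z) y x
      = -∫ z, (q (x - z + y) - q (x - z)) * (g (z + -y) - g z) := by
    intro x
    have e1 : ∫ z, q (x - y - z) * g z = ∫ z, q (x - z) * g (z + -y) := by
      rw [← integral_add_right_eq_self _ (-y)]
      refine integral_congr_ae (ae_of_all _ fun z => ?_)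
      simp only
      congr 2
      abel
    have e2 : ∫ z, q (x - z) * g z = ∫ z, q (x + y - z) * g (z + -y) := by
      rw [← integral_add_right_eq_self _ (-y)]
      refine integral_congr_ae (ae_of_all _ fun z => ?_)
      simp only
      congr 2
      abel
    have e3 : ∀ z, (q (x - z + y) - q (x - z)) * (g (z + -y) - g z)
        = (q (x + y - z) * g (z + -y) - q (x + y - z) * g z)
          - (q (x - z) * g (z + -y) - q (x - z) * g z) := by
      intro z
      rw [show x - z + y = x + y - z by abel]
      ring
    simp_rw [e3]
    have e4 : ∀ x, Integrable fun z => q (x - z) * g (z + -y) - q (x - z) * g z := fun x =>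
      (hint x hg').sub (hint x hg)
    rw [integral_sub (e4 _) (e4 _), integral_sub (hint _ hg') (hint _ hg), integral_sub (hint _ hg') (hint _ hg),
      ← e2, ← e1, secondDiff]
    ring
  simp_rw [key, abs_neg]
  exact integral_abs_integral_mul_le ((hq.comp_add_right y).sub hq) (hg'.sub hg)

theorem integral_abs_sub_convolution_le {q r : EuclideanSpace ℝ (Fin d) → ℝ}
    (hq : Integrable q) (hqb : ∃ B, ∀ x, |q x| ≤ B) (hqc : Continuous q) (hr : Integrable r)
    (y : EuclideanSpace ℝ (Fin d)) :
    ∫ x, |(∫ z, q (x + y - z) * r z) - ∫ z, q (x - z) * r z|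
      ≤ (∫ x, |q (x + y) - q x|) * ∫ z, |r z| := by
  obtain ⟨B, hB⟩ := hqb
  have hint : ∀ x : EuclideanSpace ℝ (Fin d), Integrable fun z => q (x - z) * r z := fun x =>
    hr.bdd_mul (by fun_prop : Continuous _).aestronglyMeasurable (ae_of_all _ fun z => hB _)
  have key : ∀ x, (∫ z, q (x + y - z) * r z) - ∫ z, q (x - z) * r z
      = ∫ z, (q (x - z + y) - q (x - z)) * r z := by
    intro x
    rw [← integral_sub (hint _) (hint _)]
    refine integral_congr_ae (ae_of_all _ fun z => ?_)
    simp only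
    rw [show x - z + y = x + y - z by abel]
    ring
  simp_rw [key]
  exact integral_abs_integral_mul_le ((hq.comp_add_right y).sub hq) hr

theorem integrable_secondDiff {g : EuclideanSpace ℝ (Fin d) → ℝ} (hg : Integrable g)
    (y : EuclideanSpace ℝ (Fin d)) : Integrable (secondDiff g y) :=
  ((hg.comp_add_right y).add (hg.comp_sub_right y)).sub (hg.const_mul 2)

theorem integral_abs_secondDiff_le {g : EuclideanSpace ℝ (Fin d) → ℝ} (hg : Integrable g)
    (y : EuclideanSpace ℝ (Fin d)) : ∫ x, |secondDiff g y x| ≤ 4 * ∫ x, |g x| := by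
  calc ∫ x, |secondDiff g y x| ≤ ∫ x, (|g (x + y)| + |g (x - y)| + 2 * |g x|) := by
        refine integral_mono (integrable_secondDiff hg y).abs
          (((hg.comp_add_right y).abs.add (hg.comp_sub_right y).abs).add (hg.abs.const_mul 2))
          fun x => ?_
        have h1 := abs_sub (g (x + y) + g (x - y)) (2 * g x)
        have h2 := abs_add_le (g (x + y)) (g (x - y))
        rw [abs_mul, abs_two] at h1
        exact h1.trans (by gcongr)
    _ = _ := by
      have h3 : Integrable fun x => |g (x + y)| + |g (x - y)| :=
        (hg.comp_add_right y).abs.add (hg.comp_sub_right y).abs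
      rw [integral_add h3 (hg.abs.const_mul 2),
        integral_add (hg.comp_add_right y).abs (hg.comp_sub_right y).abs, integral_const_mul,
        integral_add_right_eq_self (fun x => |g x|), integral_sub_right_eq_self (fun x => |g x|)]
      ring

/-- With `p_t = q * (q * r)`, each factor `q` contributes one first difference of `L¹` norm at most
`C |y|`, and `r` has mass one. -/
theorem Decay.exists_integral_abs_secondDiff_density_le (hν : IsLevyMeasure ν) (hs : IsSymm ν)
    (h : Decay ν) {t₁ : ℝ} (ht₁ : 0 < t₁) :
    ∃ C : ℝ, 0 ≤ C ∧ ∀ t, t₁ ≤ t → ∀ y,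
      ∫ x, |secondDiff (density ν t) y x| ≤ C * min 1 (‖y‖ ^ 2) := by
  -- The time given to the two copies of `q` depends on `t₁` only, and at least `t₁ / 2` is left for
  -- the remainder. All dependence on `t` then sits in `r`, so the constant is uniform in `t ≥ t₁`.
  set s := t₁ / 4 with hsdef
  have hs0 : 0 < s := by positivity
  have hνs : IsLevyMeasure (smallJumps ν) := hν.restrict _
  have hνl : IsLevyMeasure (largeJumps ν) := hν.restrict _
  set N := ENNReal.ofReal s • smallJumps ν with hN
  have hNL : IsLevyMeasure N := hνs.smul s
  have hNS : IsSymm N := (isSymm_smallJumps hs).smul _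
  have hNI : IntegrableExp N := (h.restrict_ball hν).integrableExp hνs hs0
  have hN2 : Integrable fun ξ : EuclideanSpace ℝ (Fin d) =>
      ‖ξ‖ ^ 2 * Real.exp (-exponent N ξ) := by
    have hc := hνs.continuous_exponent
    simp only [hN, exponent_smul hs0.le]
    refine (h.restrict_ball hν s hs0).mono' (by fun_prop : Continuous _).aestronglyMeasurable
      (ae_of_all _ fun ξ => ?_)
    rw [Real.norm_eq_abs, abs_of_nonneg (by positivity)]
    gcongr
    linarith
  have hNc : ∀ l : EuclideanSpace ℝ (Fin d),
      ∫⁻ y, ENNReal.ofReal (Real.cosh (inner ℝ l y) - 1) ∂N ≠ ⊤ := fun l => by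
    rw [hN, lintegral_smul_measure]
    exact ENNReal.mul_ne_top ENNReal.ofReal_ne_top (lintegral_cosh_smallJumps_lt_top hν l)
  obtain ⟨C, hC0, hC⟩ := exists_integral_abs_levyDensity_add_sub_le hNL hNS hNI hN2 hNc
  have hNint := integrable_levyDensity hNL hNS hNI
  have hNb : ∃ B, ∀ x, |levyDensity N x| ≤ B := ⟨_, abs_invF_le hNI⟩
  have hNcont := continuous_levyDensity hNI
  refine ⟨max 4 (C * C), by positivity, fun t ht y => ?_⟩
  have ht0 : 0 < t := ht₁.trans_le ht
  -- The remainder receives the unused time, and also the large jumps of the time `2s` spent on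
  -- small jumps, so that `N + (N + R)` has exponent `tψ`.
  set R := ENNReal.ofReal (t - 2 * s) • ν + ENNReal.ofReal (2 * s) • largeJumps ν with hR
  have hts : 0 < t - 2 * s := by
    rw [hsdef]
    linarith
  have hRL : IsLevyMeasure R := (hν.smul _).add (hνl.smul _)
  have hRS : IsSymm R := (hs.smul _).add ((isSymm_largeJumps hs).smul _)
  have hRe : ∀ ξ, exponent R ξ = (t - 2 * s) * exponent ν ξ
      + 2 * s * exponent (largeJumps ν) ξ := fun ξ => by
    rw [hR, exponent_add (hν.smul _) (hνl.smul _), exponent_smul hts.le,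
      exponent_smul (by positivity)]
  have hRI : IntegrableExp R := by
    have hc := hRL.continuous_exponent
    refine (h.integrable_exp hν hts).mono'
      (by fun_prop : Continuous _).aestronglyMeasurable (ae_of_all _ fun ξ => ?_)
    rw [Real.norm_eq_abs, abs_of_pos (Real.exp_pos _), Real.exp_le_exp, hRe]
    nlinarith [exponent_nonneg (ν := largeJumps ν) ξ]
  have hNRI : IntegrableExp (N + R) := by
    have hc := (hNL.add hRL).continuous_exponent
    refine hRI.mono' (by fun_prop : Continuous _).aestronglyMeasurable (ae_of_all _ fun ξ => ?_)
    rw [Real.norm_eq_abs, abs_of_pos (Real.exp_pos _), Real.exp_le_exp, exponent_add hNL hRL]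
    linarith [exponent_nonneg (ν := N) ξ]
  have hNR : Integrable (levyDensity (N + R)) :=
    integrable_levyDensity (hNL.add hRL) (hNS.add hRS) hNRI
  have hRint := integrable_levyDensity hRL hRS hRI
  have hpt : density ν t = fun x => ∫ z, levyDensity N (x - z) * levyDensity (N + R) z := by
    ext x
    rw [← levyDensity_add hNL hNI (hNL.add hRL) (hNS.add hRS) hNRI, h.density_eq hν ht0]
    unfold levyDensity
    congr 1
    ext ξ
    rw [exponent_add hNL (hNL.add hRL), exponent_add hNL hRL, hRe, hN, exponent_smul hs0.le,
      exponent_smul ht0.le, ← exponent_smallJumps_add_largeJumps hν]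
    congr 1
    ring
  have hsmall : ∫ x, |secondDiff (density ν t) y x| ≤ C * C * ‖y‖ ^ 2 := by
    have h1 := integral_abs_secondDiff_convolution_le hNint hNb hNcont hNR y
    rw [← hpt] at h1
    have h2 : ∫ z, |levyDensity (N + R) (z + -y) - levyDensity (N + R) z| ≤ C * ‖y‖ := by
      have h3 := integral_abs_sub_convolution_le hNint hNb hNcont hRint (-y)
      simp_rw [← levyDensity_add hNL hNI hRL hRS hRI] at h3
      have h4 : ∫ z, |levyDensity R z| = 1 := by
        rw [← integral_levyDensity hRL hRS hRI]
        exact integral_congr_ae (ae_of_all _ fun z =>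
          abs_of_nonneg (levyDensity_nonneg hRL hRS hRI z))
      rw [h4, mul_one] at h3
      refine h3.trans ?_
      rw [← norm_neg y]
      exact hC (-y)
    calc _ ≤ _ := h1
      _ ≤ (C * ‖y‖) * (C * ‖y‖) := by
          gcongr
          exact hC y
      _ = _ := by ring
  -- For long steps the triangle inequality and `∫ p_t = 1` are enough.
  have hlarge : ∫ x, |secondDiff (density ν t) y x| ≤ 4 := by
    have h1 := integral_abs_secondDiff_le (h.integrable_density hν hs ht0) y
    simp_rw [abs_of_nonneg (h.density_nonneg hν hs ht0 _)] at h1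
    rwa [h.integral_density hν hs ht0, mul_one] at h1
  rcases le_total 1 (‖y‖ ^ 2) with h1 | h1
  · rw [min_eq_left h1, mul_one]
    exact hlarge.trans (le_max_left _ _)
  · rw [min_eq_right h1]
    exact hsmall.trans (mul_le_mul_of_nonneg_right (le_max_right _ _) (sq_nonneg _))

theorem secondDiff_invF {φ : EuclideanSpace ℝ (Fin d) → ℝ} (hφ : Integrable φ)
    (y x : EuclideanSpace ℝ (Fin d)) :
    secondDiff (invF φ) y x
      = invF (fun ξ => -(2 * ((1 - Real.cos (inner ℝ ξ y)) * φ ξ))) x := by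
  simp only [secondDiff, invF]
  rw [← mul_add, mul_left_comm 2, ← mul_sub]
  congr 1
  have h1 : Integrable fun ξ => Real.cos (inner ℝ ξ (x + y)) * φ ξ
      + Real.cos (inner ℝ ξ (x - y)) * φ ξ :=
    (integrable_cos_mul hφ _).add (integrable_cos_mul hφ _)
  rw [← integral_const_mul, ← integral_add (integrable_cos_mul hφ _) (integrable_cos_mul hφ _),
    ← integral_sub h1 ((integrable_cos_mul hφ _).const_mul _)]
  refine integral_congr_ae (ae_of_all _ fun ξ => ?_)
  simp only [inner_add_right, inner_sub_right, Real.cos_add, Real.cos_sub]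
  ring

theorem Decay.integrable_one_sub_cos_mul (hν : IsLevyMeasure ν) (h : Decay ν) {t : ℝ}
    (ht : 0 < t) (y : EuclideanSpace ℝ (Fin d)) :
    Integrable fun ξ : EuclideanSpace ℝ (Fin d) =>
      (1 - Real.cos (inner ℝ ξ y)) * Real.exp (-(t * exponent ν ξ)) := by
  refine (h.integrable_exp hν ht).bdd_mul (c := 2)
    (by fun_prop : Continuous _).aestronglyMeasurable (ae_of_all _ fun ξ => ?_)
  rw [Real.norm_eq_abs, abs_of_nonneg (one_sub_cos_nonneg _)]
  linarith [Real.neg_one_le_cos (inner ℝ ξ y)]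

/-- The supremum counterpart of the `L¹` bound. Both are needed to integrate the second-difference
kernel against an `f` that is only in `L^p`. -/
theorem Decay.exists_abs_secondDiff_density_le (hν : IsLevyMeasure ν) (h : Decay ν) {t₁ : ℝ}
    (ht₁ : 0 < t₁) : ∃ C : ℝ, 0 ≤ C ∧ ∀ t, t₁ ≤ t → ∀ y x,
      |secondDiff (density ν t) y x| ≤ C * min 1 (‖y‖ ^ 2) := by
  have hi : Integrable fun ξ : EuclideanSpace ℝ (Fin d) =>
      (2 + ‖ξ‖ ^ 2) * Real.exp (-(t₁ * exponent ν ξ)) := by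
    refine ((h t₁ ht₁).add (h.integrable_exp hν ht₁)).congr (ae_of_all _ fun ξ => ?_)
    simp only [Pi.add_apply]
    ring
  refine ⟨((2 * Real.pi) ^ d)⁻¹ * (2 * ∫ ξ : EuclideanSpace ℝ (Fin d),
    (2 + ‖ξ‖ ^ 2) * Real.exp (-(t₁ * exponent ν ξ))), mul_nonneg invF_const_pos.le
    (mul_nonneg zero_le_two (integral_nonneg fun ξ => by positivity)), fun t ht y x => ?_⟩
  have ht0 := ht₁.trans_le ht
  have hi2 := ((h.integrable_one_sub_cos_mul hν ht0 y).const_mul 2).neg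
  rw [h.density_eq_invF hν ht0, secondDiff_invF (h.integrable_exp hν ht0)]
  refine (abs_invF_le hi2 x).trans ?_
  rw [mul_assoc]
  refine mul_le_mul_of_nonneg_left ?_ invF_const_pos.le
  rw [← integral_const_mul, ← integral_mul_const]
  refine integral_mono hi2.abs ((hi.const_mul 2).mul_const _) fun ξ => ?_
  have e1 := one_sub_cos_inner_le ξ y
  have e2 : Real.exp (-(t * exponent ν ξ)) ≤ Real.exp (-(t₁ * exponent ν ξ)) := by
    gcongr
    exact exponent_nonneg ξ
  simp only [Pi.neg_apply, abs_neg, abs_mul, abs_two, abs_of_nonneg (one_sub_cos_nonneg _),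
    abs_of_pos (Real.exp_pos _)]
  have e3 : 0 ≤ (2 + ‖ξ‖ ^ 2) * min 1 (‖y‖ ^ 2) :=
    mul_nonneg (by positivity) (min_one_sq_nonneg y)
  calc 2 * ((1 - Real.cos (inner ℝ ξ y)) * Real.exp (-(t * exponent ν ξ)))
      ≤ 2 * (((2 + ‖ξ‖ ^ 2) * min 1 (‖y‖ ^ 2)) * Real.exp (-(t₁ * exponent ν ξ))) := by gcongr
    _ = _ := by ring

/-! ### Time derivative of the density and the generator -/

/-- The time derivative of the transition density. -/
def densityDeriv (ν : Measure (EuclideanSpace ℝ (Fin d))) (t : ℝ)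
    (x : EuclideanSpace ℝ (Fin d)) : ℝ :=
  invF (fun ξ => -(exponent ν ξ * Real.exp (-(t * exponent ν ξ)))) x

theorem Decay.integrable_two_add_sq_mul (hν : IsLevyMeasure ν) (h : Decay ν) {t : ℝ}
    (ht : 0 < t) : Integrable fun ξ : EuclideanSpace ℝ (Fin d) =>
      (2 + ‖ξ‖ ^ 2) * Real.exp (-(t * exponent ν ξ)) := by
  refine ((h t ht).add (h.integrable_exp hν ht)).congr (ae_of_all _ fun ξ => ?_)
  simp only [Pi.add_apply]
  ring

theorem Decay.integrable_exponent_mul (hν : IsLevyMeasure ν) (h : Decay ν) {t : ℝ}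
    (ht : 0 < t) : Integrable fun ξ : EuclideanSpace ℝ (Fin d) =>
      exponent ν ξ * Real.exp (-(t * exponent ν ξ)) := by
  have hc := hν.continuous_exponent
  refine ((h.integrable_two_add_sq_mul hν ht).const_mul (∫ y, min 1 (‖y‖ ^ 2) ∂ν)).mono'
    (by fun_prop : Continuous _).aestronglyMeasurable (ae_of_all _ fun ξ => ?_)
  rw [Real.norm_eq_abs, abs_of_nonneg (mul_nonneg (exponent_nonneg ξ) (Real.exp_pos _).le),
    ← mul_assoc]
  refine mul_le_mul_of_nonneg_right ?_ (Real.exp_pos _).le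
  rw [mul_comm]
  exact hν.exponent_le ξ

theorem exponent_mul_exp_anti {s t : ℝ} (hst : s ≤ t) (ξ : EuclideanSpace ℝ (Fin d)) :
    exponent ν ξ * Real.exp (-(t * exponent ν ξ))
      ≤ exponent ν ξ * Real.exp (-(s * exponent ν ξ)) := by
  have := exponent_nonneg (ν := ν) ξ
  gcongr

theorem Decay.abs_density_le (hν : IsLevyMeasure ν) (h : Decay ν) {s t : ℝ} (hs : 0 < s)
    (hst : s ≤ t) (x : EuclideanSpace ℝ (Fin d)) :
    |density ν t x| ≤ ((2 * Real.pi) ^ d)⁻¹ *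
      ∫ ξ : EuclideanSpace ℝ (Fin d), Real.exp (-(s * exponent ν ξ)) := by
  have ht := hs.trans_le hst
  rw [h.density_eq_invF hν ht]
  refine (abs_invF_le (h.integrable_exp hν ht) x).trans
    (mul_le_mul_of_nonneg_left ?_ invF_const_pos.le)
  refine integral_mono (h.integrable_exp hν ht).abs (h.integrable_exp hν hs) fun ξ => ?_
  simp only [abs_of_pos (Real.exp_pos _)]
  gcongr
  exact exponent_nonneg ξ

theorem Decay.abs_densityDeriv_le (hν : IsLevyMeasure ν) (h : Decay ν) {s t : ℝ} (hs : 0 < s)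
    (hst : s ≤ t) (x : EuclideanSpace ℝ (Fin d)) :
    |densityDeriv ν t x| ≤ ((2 * Real.pi) ^ d)⁻¹ *
      ∫ ξ : EuclideanSpace ℝ (Fin d), exponent ν ξ * Real.exp (-(s * exponent ν ξ)) := by
  have ht := hs.trans_le hst
  refine (abs_invF_le (h.integrable_exponent_mul hν ht).neg x).trans
    (mul_le_mul_of_nonneg_left ?_ invF_const_pos.le)
  refine integral_mono (h.integrable_exponent_mul hν ht).neg.abs
    (h.integrable_exponent_mul hν hs) fun ξ => ?_
  simp only [Pi.neg_apply, abs_neg, abs_mul, abs_of_nonneg (exponent_nonneg ξ),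
    abs_of_pos (Real.exp_pos _)]
  exact exponent_mul_exp_anti hst ξ

theorem Decay.continuous_densityDeriv (hν : IsLevyMeasure ν) (h : Decay ν) {t : ℝ}
    (ht : 0 < t) : Continuous (densityDeriv ν t) :=
  continuous_invF (h.integrable_exponent_mul hν ht).neg

theorem Decay.hasDerivAt_density (hν : IsLevyMeasure ν) (h : Decay ν) {t : ℝ} (ht : 0 < t)
    (x : EuclideanSpace ℝ (Fin d)) :
    HasDerivAt (fun t => density ν t x) (densityDeriv ν t x) t := by
  have hc := hν.continuous_exponent
  have h1 := hasDerivAt_integral_of_dominated_loc_of_deriv_le (μ := volume)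
    (F := fun (t : ℝ) (ξ : EuclideanSpace ℝ (Fin d)) =>
      Real.cos (inner ℝ ξ x) * Real.exp (-(t * exponent ν ξ)))
    (F' := fun (t : ℝ) (ξ : EuclideanSpace ℝ (Fin d)) =>
      Real.cos (inner ℝ ξ x) * -(exponent ν ξ * Real.exp (-(t * exponent ν ξ))))
    -- The integrand `ψ e^{-rψ}` decreases in `r`, so its value at `r = t/2` dominates throughout
    -- this neighbourhood.
    (x₀ := t) (s := Set.Ioi (t / 2))
    (bound := fun ξ => exponent ν ξ * Real.exp (-(t / 2 * exponent ν ξ)))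
    (Ioi_mem_nhds (by linarith))
    (Eventually.of_forall fun t => (by fun_prop : Continuous _).aestronglyMeasurable)
    (integrable_cos_mul (h.integrable_exp hν ht) x)
    (by fun_prop : Continuous _).aestronglyMeasurable
    (ae_of_all _ fun ξ r hr => ?_) (h.integrable_exponent_mul hν (half_pos ht))
    (ae_of_all _ fun ξ r _ => ?_)
  · refine (h1.2.const_mul ((2 * Real.pi) ^ d)⁻¹).congr_of_eventuallyEq ?_
    filter_upwards [Ioi_mem_nhds ht] with r hr
    rw [h.density_eq_invF hν hr, invF]
  · rw [norm_mul, norm_neg, Real.norm_eq_abs, Real.norm_eq_abs,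
      abs_of_nonneg (mul_nonneg (exponent_nonneg ξ) (Real.exp_pos _).le)]
    exact (mul_le_of_le_one_left (mul_nonneg (exponent_nonneg ξ) (Real.exp_pos _).le)
      (Real.abs_cos_le_one _)).trans (exponent_mul_exp_anti (le_of_lt hr) ξ)
  · have h2 : HasDerivAt (fun r => -(r * exponent ν ξ)) (-(1 * exponent ν ξ)) r :=
      ((hasDerivAt_id r).mul_const _).neg
    refine (h2.exp.const_mul (Real.cos (inner ℝ ξ x))).congr_deriv ?_
    ring

theorem Decay.continuousOn_densityDeriv (hν : IsLevyMeasure ν) (h : Decay ν)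
    (x : EuclideanSpace ℝ (Fin d)) :
    ContinuousOn (fun t => densityDeriv ν t x) (Set.Ioi 0) := by
  intro t ht
  have ht : 0 < t := ht
  have hc := hν.continuous_exponent
  refine ContinuousAt.continuousWithinAt (continuousAt_const.mul (continuousAt_of_dominated
    (bound := fun ξ => exponent ν ξ * Real.exp (-(t / 2 * exponent ν ξ)))
    (Eventually.of_forall fun t => (by fun_prop : Continuous _).aestronglyMeasurable) ?_
    (h.integrable_exponent_mul hν (half_pos ht)) (ae_of_all _ fun ξ => by fun_prop)))
  filter_upwards [Ioi_mem_nhds (half_lt_self ht)] with r hr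
  refine ae_of_all _ fun ξ => ?_
  rw [norm_mul, norm_neg, Real.norm_eq_abs, Real.norm_eq_abs,
    abs_of_nonneg (mul_nonneg (exponent_nonneg ξ) (Real.exp_pos _).le)]
  exact (mul_le_of_le_one_left (mul_nonneg (exponent_nonneg ξ) (Real.exp_pos _).le)
    (Real.abs_cos_le_one _)).trans (exponent_mul_exp_anti (le_of_lt hr) ξ)

theorem measurable_densityDeriv (hν : IsLevyMeasure ν) :
    Measurable fun p : ℝ × EuclideanSpace ℝ (Fin d) => densityDeriv ν p.1 p.2 := by
  have hc := hν.continuous_exponent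
  have h1 : StronglyMeasurable fun q : (ℝ × EuclideanSpace ℝ (Fin d)) ×
      EuclideanSpace ℝ (Fin d) => Real.cos (inner ℝ q.2 q.1.2) *
        -(exponent ν q.2 * Real.exp (-(q.1.1 * exponent ν q.2))) :=
    (by fun_prop : Continuous _).stronglyMeasurable
  exact (h1.integral_prod_right (ν := volume)).measurable.const_mul _

theorem measurable_density (hν : IsLevyMeasure ν) :
    Measurable fun p : ℝ × EuclideanSpace ℝ (Fin d) => density ν p.1 p.2 := by
  have hc := hν.continuous_exponent
  have h1 : StronglyMeasurable fun q : (ℝ × EuclideanSpace ℝ (Fin d)) ×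
      EuclideanSpace ℝ (Fin d) => Complex.exp (-(Complex.I * ((inner ℝ q.2 q.1.2 : ℝ) : ℂ))) *
        Complex.exp (-((q.1.1 * exponent ν q.2 : ℝ) : ℂ)) :=
    (by fun_prop : Continuous _).stronglyMeasurable
  exact (Complex.measurable_re.comp
    (h1.integral_prod_right (ν := volume)).measurable).const_mul _

theorem Decay.integrable_secondDiff_density_prod (hν : IsLevyMeasure ν) (hs : IsSymm ν)
    (h : Decay ν) {t : ℝ} (ht : 0 < t) :
    Integrable (fun p : EuclideanSpace ℝ (Fin d) × EuclideanSpace ℝ (Fin d) =>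
      secondDiff (density ν t) p.1 p.2) (ν.prod volume) := by
  have := hν.sigmaFinite
  obtain ⟨C, -, hC⟩ := h.exists_integral_abs_secondDiff_density_le hν hs ht
  have hc := h.continuous_density hν ht
  have hm : AEStronglyMeasurable (fun p : EuclideanSpace ℝ (Fin d) × EuclideanSpace ℝ (Fin d) =>
      secondDiff (density ν t) p.1 p.2) (ν.prod volume) :=
    (by unfold secondDiff; fun_prop : Continuous _).aestronglyMeasurable
  rw [integrable_prod_iff hm]
  refine ⟨ae_of_all _ fun y => integrable_secondDiff (h.integrable_density hν hs ht) y,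
    (hν.integrable_min.const_mul C).mono' hm.norm.integral_prod_right'
      (ae_of_all _ fun y => ?_)⟩
  rw [Real.norm_eq_abs, abs_of_nonneg (integral_nonneg fun _ => norm_nonneg _)]
  exact hC t le_rfl y

/-- On the Fourier side the second difference with step `y` is multiplication by `-2(1 - cos(ξ·y))`;
half its `ν`-integral is `-ψ(ξ)`. -/
theorem Decay.densityDeriv_eq_integral_secondDiff (hν : IsLevyMeasure ν) (h : Decay ν) {t : ℝ}
    (ht : 0 < t) (x : EuclideanSpace ℝ (Fin d)) :
    densityDeriv ν t x = 1 / 2 * ∫ y, secondDiff (density ν t) y x ∂ν := by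
  have := hν.sigmaFinite
  have hc := hν.continuous_exponent
  have hprod : Integrable (fun p : EuclideanSpace ℝ (Fin d) × EuclideanSpace ℝ (Fin d) =>
      Real.cos (inner ℝ p.1 x) *
        -(2 * ((1 - Real.cos (inner ℝ p.1 p.2)) * Real.exp (-(t * exponent ν p.1)))))
      (volume.prod ν) := by
    refine (((h.integrable_two_add_sq_mul hν ht).const_mul 2).mul_prod hν.integrable_min).mono'
      (by fun_prop : Continuous _).aestronglyMeasurable (ae_of_all _ fun p => ?_)
    have e1 := one_sub_cos_inner_le p.1 p.2
    have e2 := one_sub_cos_nonneg (inner ℝ p.1 p.2)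
    rw [norm_mul, norm_neg, Real.norm_eq_abs, Real.norm_eq_abs,
      abs_of_nonneg (by positivity : (0 : ℝ) ≤ 2 * ((1 - Real.cos (inner ℝ p.1 p.2)) *
        Real.exp (-(t * exponent ν p.1))))]
    refine (mul_le_of_le_one_left (by positivity) (Real.abs_cos_le_one _)).trans ?_
    calc 2 * ((1 - Real.cos (inner ℝ p.1 p.2)) * Real.exp (-(t * exponent ν p.1)))
        ≤ 2 * (((2 + ‖p.1‖ ^ 2) * min 1 (‖p.2‖ ^ 2)) * Real.exp (-(t * exponent ν p.1))) := by
          gcongr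
      _ = _ := by ring
  have h1 : ∀ y, secondDiff (density ν t) y x = ((2 * Real.pi) ^ d)⁻¹ *
      ∫ ξ, Real.cos (inner ℝ ξ x) *
        -(2 * ((1 - Real.cos (inner ℝ ξ y)) * Real.exp (-(t * exponent ν ξ)))) := fun y => by
    rw [h.density_eq_invF hν ht, secondDiff_invF (h.integrable_exp hν ht), invF]
  simp_rw [h1]
  rw [integral_const_mul, ← integral_integral_swap hprod, densityDeriv, invF, mul_left_comm,
    ← integral_const_mul (1 / 2)]
  refine congrArg _ (integral_congr_ae (ae_of_all _ fun ξ => ?_))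
  have h2 : ∀ y, Real.cos (inner ℝ ξ x) *
        -(2 * ((1 - Real.cos (inner ℝ ξ y)) * Real.exp (-(t * exponent ν ξ))))
      = (1 - Real.cos (inner ℝ ξ y)) *
        (-2 * Real.cos (inner ℝ ξ x) * Real.exp (-(t * exponent ν ξ))) := fun y => by ring
  have h3 : ∫ y, Real.cos (inner ℝ ξ x) *
        -(2 * ((1 - Real.cos (inner ℝ ξ y)) * Real.exp (-(t * exponent ν ξ)))) ∂ν
      = exponent ν ξ * (-2 * Real.cos (inner ℝ ξ x) * Real.exp (-(t * exponent ν ξ))) := by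
    simp_rw [h2]
    rw [integral_mul_const]
    rfl
  simp only
  rw [h3]
  ring

theorem Decay.integrable_densityDeriv (hν : IsLevyMeasure ν) (hs : IsSymm ν)
    (h : Decay ν) {t : ℝ} (ht : 0 < t) : Integrable (densityDeriv ν t) := by
  have := hν.sigmaFinite
  refine ((h.integrable_secondDiff_density_prod hν hs ht).integral_prod_right.const_mul
    (1 / 2)).congr (ae_of_all _ fun x => ?_)
  exact (h.densityDeriv_eq_integral_secondDiff hν ht x).symm

theorem Decay.exists_integral_abs_densityDeriv_le (hν : IsLevyMeasure ν) (hs : IsSymm ν)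
    (h : Decay ν) {t₁ : ℝ} (ht₁ : 0 < t₁) :
    ∃ C : ℝ, 0 ≤ C ∧ ∀ t, t₁ ≤ t → ∫ x, |densityDeriv ν t x| ≤ C := by
  have := hν.sigmaFinite
  obtain ⟨C, hC0, hC⟩ := h.exists_integral_abs_secondDiff_density_le hν hs ht₁
  refine ⟨1 / 2 * ∫ y, C * min 1 (‖y‖ ^ 2) ∂ν, mul_nonneg (by norm_num)
    (integral_nonneg fun y => mul_nonneg hC0 (min_one_sq_nonneg y)), fun t ht => ?_⟩
  have ht0 := ht₁.trans_le ht
  have hi := h.integrable_secondDiff_density_prod hν hs ht0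
  calc ∫ x, |densityDeriv ν t x|
      ≤ ∫ x, 1 / 2 * ∫ y, |secondDiff (density ν t) y x| ∂ν := by
        refine integral_mono (h.integrable_densityDeriv hν hs ht0).abs
          (hi.abs.integral_prod_right.const_mul _) fun x => ?_
        simp only
        rw [h.densityDeriv_eq_integral_secondDiff hν ht0, abs_mul,
          abs_of_pos (by norm_num : (0 : ℝ) < 1 / 2)]
        gcongr
        exact abs_integral_le_integral_abs
    _ = 1 / 2 * ∫ y, (∫ x, |secondDiff (density ν t) y x|) ∂ν := by
        rw [integral_const_mul, ← integral_integral_swap hi.abs]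
    _ ≤ _ := by
        refine mul_le_mul_of_nonneg_left ?_ (by norm_num)
        exact integral_mono hi.abs.integral_prod_left (hν.integrable_min.const_mul C)
          fun y => hC t ht y

/-! ### Integral kernels acting on `L^p` -/

theorem abs_le_one_add_abs_rpow {p : ℝ} (hp : 1 ≤ p) (a : ℝ) : |a| ≤ 1 + |a| ^ p := by
  rcases le_total |a| 1 with h | h
  · linarith [Real.rpow_nonneg (abs_nonneg a) p]
  · linarith [Real.self_le_rpow_of_one_le h hp]

/-- From `|f| ≤ 1 + |f|^p`: the first term uses the integrability of `k`, the second its supremum in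
the second variable. No dual exponent is involved. -/
theorem integrable_prod_kernel_mul {Y : Type*} [MeasurableSpace Y] {m : Measure Y} [SFinite m]
    {p : ℝ} (hp : 1 ≤ p) {f : EuclideanSpace ℝ (Fin d) → ℝ} (hf : Measurable f)
    (hfp : Integrable fun x => |f x| ^ p) {k : Y × EuclideanSpace ℝ (Fin d) → ℝ}
    (hk : Integrable k (m.prod volume)) {κ : Y → ℝ} (hκ : Integrable κ m)
    (hle : ∀ q, |k q| ≤ κ q.1) : Integrable (fun q => k q * f q.2) (m.prod volume) := by
  refine (hk.abs.add (hκ.mul_prod hfp)).mono'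
    (hk.aestronglyMeasurable.mul (hf.comp measurable_snd).aestronglyMeasurable)
    (ae_of_all _ fun q => ?_)
  rw [norm_mul, Real.norm_eq_abs, Real.norm_eq_abs, Pi.add_apply]
  have h1 := mul_le_mul_of_nonneg_left (abs_le_one_add_abs_rpow hp (f q.2)) (abs_nonneg (k q))
  have h2 := mul_le_mul_of_nonneg_right (hle q) (Real.rpow_nonneg (abs_nonneg (f q.2)) p)
  linarith

theorem integrable_kernel_mul {p : ℝ} (hp : 1 ≤ p) {f : EuclideanSpace ℝ (Fin d) → ℝ}
    (hf : Measurable f) (hfp : Integrable fun x => |f x| ^ p)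
    {k : EuclideanSpace ℝ (Fin d) → ℝ} (hk : Integrable k) {B : ℝ} (hB : ∀ z, |k z| ≤ B) :
    Integrable fun z => k z * f z := by
  refine (hk.abs.add (hfp.const_mul B)).mono'
    (hk.aestronglyMeasurable.mul hf.aestronglyMeasurable) (ae_of_all _ fun q => ?_)
  rw [norm_mul, Real.norm_eq_abs, Real.norm_eq_abs, Pi.add_apply]
  have h1 := mul_le_mul_of_nonneg_left (abs_le_one_add_abs_rpow hp (f q)) (abs_nonneg (k q))
  have h2 := mul_le_mul_of_nonneg_right (hB q) (Real.rpow_nonneg (abs_nonneg (f q)) p)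
  linarith

/-- A time-dependent kernel that is bounded in `L¹` and in the supremum norm, uniformly in
`t > s`. -/
structure KernelBound (s A B : ℝ) (k : ℝ → EuclideanSpace ℝ (Fin d) → ℝ) : Prop where
  integrable : ∀ t, s < t → Integrable (k t)
  abs_le : ∀ t, s < t → ∀ z, |k t z| ≤ B
  integral_le : ∀ t, s < t → ∫ z, |k t z| ≤ A

/-- The part of `f` where `|f| > 1 / (n + 1)`. -/
def truncLow (f : EuclideanSpace ℝ (Fin d) → ℝ) (n : ℕ) (z : EuclideanSpace ℝ (Fin d)) : ℝ :=
  {z | 1 / ((n : ℝ) + 1) < |f z|}.indicator f z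

theorem measurable_truncLow {f : EuclideanSpace ℝ (Fin d) → ℝ} (hf : Measurable f) (n : ℕ) :
    Measurable (truncLow f n) :=
  hf.indicator (measurableSet_lt measurable_const hf.abs)

theorem abs_sub_truncLow_le (f : EuclideanSpace ℝ (Fin d) → ℝ) (n : ℕ)
    (z : EuclideanSpace ℝ (Fin d)) : |f z - truncLow f n z| ≤ 1 / ((n : ℝ) + 1) := by
  by_cases h : 1 / ((n : ℝ) + 1) < |f z|
  · rw [truncLow, Set.indicator_of_mem (by exact h), sub_self, abs_zero]
    positivity
  · rw [truncLow, Set.indicator_of_notMem (by exact h), sub_zero]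
    exact not_lt.1 h

theorem integrable_truncLow {p : ℝ} (hp : 1 ≤ p) {f : EuclideanSpace ℝ (Fin d) → ℝ}
    (hf : Measurable f) (hfp : Integrable fun x => |f x| ^ p) (n : ℕ) :
    Integrable (truncLow f n) := by
  have hn : (0 : ℝ) < 1 / ((n : ℝ) + 1) := by positivity
  refine (hfp.const_mul (((1 / ((n : ℝ) + 1)) ^ (p - 1))⁻¹)).mono'
    (measurable_truncLow hf n).aestronglyMeasurable (ae_of_all _ fun z => ?_)
  by_cases h : 1 / ((n : ℝ) + 1) < |f z|
  · rw [truncLow, Set.indicator_of_mem (by exact h), Real.norm_eq_abs,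
      ← div_eq_inv_mul, le_div_iff₀ (Real.rpow_pos_of_pos hn _)]
    have h1 : |f z| ^ p = |f z| * |f z| ^ (p - 1) := by
      rw [← Real.rpow_one_add' (abs_nonneg _) (by linarith)]
      congr 1
      ring
    rw [h1]
    exact mul_le_mul_of_nonneg_left (Real.rpow_le_rpow hn.le h.le (by linarith)) (abs_nonneg _)
  · rw [truncLow, Set.indicator_of_notMem (by exact h), norm_zero]
    positivity

/-- The discarded part of `f` is at most `1 / (n + 1)` in absolute value, so the `L¹` bound on the
kernel makes the error uniform in `t`. -/
theorem KernelBound.tendstoUniformlyOn {s A B : ℝ} {k : ℝ → EuclideanSpace ℝ (Fin d) → ℝ}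
    (hk : KernelBound s A B k) {p : ℝ} (hp : 1 ≤ p) {f : EuclideanSpace ℝ (Fin d) → ℝ}
    (hf : Measurable f) (hfp : Integrable fun x => |f x| ^ p) :
    TendstoUniformlyOn (fun (n : ℕ) t => ∫ z, k t z * truncLow f n z)
      (fun t => ∫ z, k t z * f z) atTop (Set.Ioi s) := by
  have hbound : ∀ n : ℕ, ∀ t ∈ Set.Ioi s,
      |(∫ z, k t z * f z) - ∫ z, k t z * truncLow f n z| ≤ A * (1 / ((n : ℝ) + 1)) := by
    intro n t ht
    have hi1 := integrable_kernel_mul hp hf hfp (hk.integrable t ht) (hk.abs_le t ht)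
    have hi2 : Integrable fun z => k t z * truncLow f n z :=
      (integrable_truncLow hp hf hfp n).bdd_mul (hk.integrable t ht).aestronglyMeasurable
        (ae_of_all _ fun z => hk.abs_le t ht z)
    rw [← integral_sub hi1 hi2]
    calc _ ≤ ∫ z, |k t z * f z - k t z * truncLow f n z| := abs_integral_le_integral_abs
      _ ≤ ∫ z, |k t z| * (1 / ((n : ℝ) + 1)) := by
        refine integral_mono (hi1.sub hi2).abs ((hk.integrable t ht).abs.mul_const _) fun z => ?_
        simp only
        rw [← mul_sub, abs_mul]
        exact mul_le_mul_of_nonneg_left (abs_sub_truncLow_le f n z) (abs_nonneg _)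
      _ ≤ _ := by
        rw [integral_mul_const]
        exact mul_le_mul_of_nonneg_right (hk.integral_le t ht) (by positivity)
  rw [Metric.tendstoUniformlyOn_iff]
  intro ε hε
  have hlim : Tendsto (fun n : ℕ => A * (1 / ((n : ℝ) + 1))) atTop (𝓝 (A * 0)) :=
    (tendsto_one_div_add_atTop_nhds_zero_nat (𝕜 := ℝ)).const_mul A
  rw [mul_zero] at hlim
  filter_upwards [hlim.eventually (gt_mem_nhds hε)] with n hn t ht
  rw [Real.dist_eq]
  exact (hbound n t ht).trans_lt hn

theorem KernelBound.continuousOn {s A B : ℝ} {k : ℝ → EuclideanSpace ℝ (Fin d) → ℝ}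
    (hk : KernelBound s A B k) (hc : ∀ z, ContinuousOn (fun t => k t z) (Set.Ioi s))
    {p : ℝ} (hp : 1 ≤ p) {f : EuclideanSpace ℝ (Fin d) → ℝ}
    (hf : Measurable f) (hfp : Integrable fun x => |f x| ^ p) :
    ContinuousOn (fun t => ∫ z, k t z * f z) (Set.Ioi s) := by
  refine (hk.tendstoUniformlyOn hp hf hfp).continuousOn
    (Eventually.of_forall fun n => ?_).frequently
  have hi := integrable_truncLow hp hf hfp n
  refine continuousOn_of_dominated (bound := fun z => B * |truncLow f n z|) (fun t ht => ?_)
    (fun t ht => ae_of_all _ fun z => ?_) (hi.abs.const_mul B)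
    (ae_of_all _ fun z => (hc z).mul continuousOn_const)
  · exact (hk.integrable t ht).aestronglyMeasurable.mul hi.aestronglyMeasurable
  · rw [norm_mul]
    exact mul_le_mul_of_nonneg_right (hk.abs_le t ht z) (norm_nonneg _)

/-- For the integrable truncations of `f`, the supremum bound allows differentiation under the
integral. Uniform convergence of the derivatives then carries the result to `f` in `L^p`. -/
theorem KernelBound.hasDerivAt {s A B A' B' : ℝ} {k k' : ℝ → EuclideanSpace ℝ (Fin d) → ℝ}
    (hk : KernelBound s A B k) (hk' : KernelBound s A' B' k')
    (hd : ∀ t, s < t → ∀ z, HasDerivAt (fun t => k t z) (k' t z) t)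
    {p : ℝ} (hp : 1 ≤ p) {f : EuclideanSpace ℝ (Fin d) → ℝ}
    (hf : Measurable f) (hfp : Integrable fun x => |f x| ^ p) {t : ℝ} (ht : s < t) :
    HasDerivAt (fun t => ∫ z, k t z * f z) (∫ z, k' t z * f z) t := by
  refine hasDerivAt_of_tendstoUniformlyOn isOpen_Ioi (hk'.tendstoUniformlyOn hp hf hfp)
    (Eventually.of_forall fun n r hr => ?_)
    (fun r hr => (hk.tendstoUniformlyOn hp hf hfp).tendsto_at hr) ht
  have hi := integrable_truncLow hp hf hfp n
  exact (hasDerivAt_integral_of_dominated_loc_of_deriv_le (μ := volume)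
    (F := fun (t : ℝ) (z : EuclideanSpace ℝ (Fin d)) => k t z * truncLow f n z)
    (F' := fun (t : ℝ) (z : EuclideanSpace ℝ (Fin d)) => k' t z * truncLow f n z)
    (x₀ := r) (s := Set.Ioi s) (bound := fun z => B' * |truncLow f n z|)
    (Ioi_mem_nhds hr)
    (by
      filter_upwards [Ioi_mem_nhds hr] with t ht
      exact (hk.integrable t ht).aestronglyMeasurable.mul hi.aestronglyMeasurable)
    (hi.bdd_mul (hk.integrable r hr).aestronglyMeasurable (ae_of_all _ (hk.abs_le r hr)))
    ((hk'.integrable r hr).aestronglyMeasurable.mul hi.aestronglyMeasurable)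
    (ae_of_all _ fun z t ht => by
      rw [norm_mul]
      exact mul_le_mul_of_nonneg_right (hk'.abs_le t ht z) (norm_nonneg _))
    (hi.abs.const_mul B')
    (ae_of_all _ fun z t ht => (hd t ht z).mul_const _)).2

/-- Hölder's inequality against the constant 1, that is, Jensen's inequality without normalising
`m`. -/
theorem lintegral_rpow_le_measure_univ_mul {Y : Type*} [MeasurableSpace Y] (m : Measure Y)
    {p : ℝ} (hp : 1 < p) {g : Y → ℝ≥0∞} (hg : AEMeasurable g m) :
    (∫⁻ y, g y ∂m) ^ p ≤ m Set.univ ^ (p - 1) * ∫⁻ y, g y ^ p ∂m := by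
  have hp0 : 0 < p := by linarith
  have hpq := Real.HolderConjugate.conjExponent hp
  have h := ENNReal.lintegral_mul_le_Lp_mul_Lq m hpq hg
    (aemeasurable_const (b := (1 : ℝ≥0∞)))
  simp only [Pi.mul_apply, mul_one, ENNReal.one_rpow, lintegral_const, one_mul] at h
  have h2 := ENNReal.rpow_le_rpow h hp0.le
  rw [ENNReal.mul_rpow_of_nonneg _ _ hp0.le, ← ENNReal.rpow_mul, ← ENNReal.rpow_mul,
    one_div_mul_cancel hp0.ne', ENNReal.rpow_one, mul_comm] at h2
  convert h2 using 3
  unfold Real.conjExponent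
  field_simp

/-- Young's inequality for the action of an integrable kernel on `L^p`. -/
theorem lintegral_kernel_rpow_le {p : ℝ} (hp : 1 < p) {k f : EuclideanSpace ℝ (Fin d) → ℝ≥0∞}
    (hk : Measurable k) (hf : Measurable f) :
    ∫⁻ x, (∫⁻ z, k (z - x) * f z) ^ p ≤ (∫⁻ z, k z) ^ p * ∫⁻ z, f z ^ p := by
  have h1 : ∀ x, (∫⁻ z, k (z - x) * f z) ^ p
      ≤ (∫⁻ z, k z) ^ (p - 1) * ∫⁻ z, k (z - x) * f z ^ p := by
    intro x
    have hkx : Measurable fun z => k (z - x) := by fun_prop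
    have h2 := lintegral_rpow_le_measure_univ_mul (volume.withDensity fun z => k (z - x)) hp
      hf.aemeasurable
    rw [withDensity_apply _ MeasurableSet.univ, Measure.restrict_univ,
      lintegral_withDensity_eq_lintegral_mul _ hkx hf,
      lintegral_withDensity_eq_lintegral_mul _ hkx (by fun_prop),
      lintegral_sub_right_eq_self (fun z => k z) x] at h2
    exact h2
  have hm : Measurable fun q : EuclideanSpace ℝ (Fin d) × EuclideanSpace ℝ (Fin d) =>
      k (q.2 - q.1) * f q.2 ^ p := by fun_prop
  calc ∫⁻ x, (∫⁻ z, k (z - x) * f z) ^ p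
      ≤ ∫⁻ x, (∫⁻ z, k z) ^ (p - 1) * ∫⁻ z, k (z - x) * f z ^ p := lintegral_mono h1
    _ = (∫⁻ z, k z) ^ (p - 1) * ((∫⁻ z, k z) * ∫⁻ z, f z ^ p) := by
      rw [lintegral_const_mul _ hm.lintegral_prod_right', lintegral_lintegral_swap hm.aemeasurable]
      congr 1
      rw [← lintegral_const_mul _ (by fun_prop)]
      refine lintegral_congr fun z => ?_
      simp only
      rw [lintegral_mul_const _ (by fun_prop), lintegral_sub_left_eq_self (fun z => k z) z]
    _ = _ := by
      rw [← mul_assoc]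
      congr 1
      nth_rewrite 2 [← ENNReal.rpow_one (∫⁻ z, k z)]
      rw [← ENNReal.rpow_add_of_nonneg _ _ (by linarith) zero_le_one, sub_add_cancel]

theorem lintegral_abs_integral_kernel_rpow_le {p : ℝ} (hp : 1 < p)
    {k f : EuclideanSpace ℝ (Fin d) → ℝ} (hk : Measurable k) (hki : Integrable k)
    (hf : Measurable f) :
    ∫⁻ x, ENNReal.ofReal (|∫ z, k (z - x) * f z| ^ p)
      ≤ ENNReal.ofReal ((∫ z, |k z|) ^ p) * ∫⁻ z, ENNReal.ofReal (|f z| ^ p) := by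
  have hp0 : 0 ≤ p := by linarith
  have h := lintegral_kernel_rpow_le hp (k := fun z => ENNReal.ofReal |k z|)
    (f := fun z => ENNReal.ofReal |f z|) (by fun_prop) (by fun_prop)
  simp_rw [ENNReal.ofReal_rpow_of_nonneg (abs_nonneg _) hp0] at h
  rw [← ofReal_integral_eq_lintegral_ofReal hki.abs (ae_of_all _ fun z => abs_nonneg _),
    ENNReal.ofReal_rpow_of_nonneg (integral_nonneg fun _ => abs_nonneg _) hp0] at h
  refine (lintegral_mono fun x => ?_).trans h
  rw [← ENNReal.ofReal_rpow_of_nonneg (abs_nonneg _) hp0]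
  refine ENNReal.rpow_le_rpow ?_ hp0
  simp_rw [← ENNReal.ofReal_mul (abs_nonneg _), ← abs_mul, ← Real.norm_eq_abs,
    ofReal_norm]
  exact enorm_integral_le_lintegral_enorm _

theorem integral_abs_integral_kernel_rpow_le {p : ℝ} (hp : 1 < p)
    {k f : EuclideanSpace ℝ (Fin d) → ℝ} (hk : Measurable k) (hki : Integrable k)
    (hf : Measurable f) (hfp : Integrable fun x => |f x| ^ p) :
    Integrable (fun x => |∫ z, k (z - x) * f z| ^ p) ∧
      ∫ x, |∫ z, k (z - x) * f z| ^ p ≤ (∫ z, |k z|) ^ p * ∫ z, |f z| ^ p := by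
  have h := lintegral_abs_integral_kernel_rpow_le hp hk hki hf
  have hm : Measurable fun x => ∫ z, k (z - x) * f z := by
    have h1 : StronglyMeasurable fun q : EuclideanSpace ℝ (Fin d) × EuclideanSpace ℝ (Fin d) =>
        k (q.2 - q.1) * f q.2 := (by fun_prop : Measurable _).stronglyMeasurable
    exact h1.integral_prod_right.measurable
  have h0 : 0 ≤ (∫ z, |k z|) ^ p := Real.rpow_nonneg (integral_nonneg fun _ => abs_nonneg _) p
  rw [← ofReal_integral_eq_lintegral_ofReal hfp (ae_of_all _ fun z => by positivity),
    ← ENNReal.ofReal_mul h0] at h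
  have hi : Integrable (fun x => |∫ z, k (z - x) * f z| ^ p) := by
    refine ⟨(by fun_prop : Measurable _).aestronglyMeasurable, ?_⟩
    rw [hasFiniteIntegral_iff_ofReal (ae_of_all _ fun z => by positivity)]
    exact h.trans_lt ENNReal.ofReal_lt_top
  refine ⟨hi, ?_⟩
  rw [← ofReal_integral_eq_lintegral_ofReal hi (ae_of_all _ fun z => by positivity)] at h
  exact (ENNReal.ofReal_le_ofReal_iff (mul_nonneg h0
    (integral_nonneg fun _ => by positivity))).1 h

/-! ### The Taylor remainder and the `p`-form of the generator -/

theorem measurable_taylorRem {Y : Type*} [MeasurableSpace Y] {p : ℝ} {u v : Y → ℝ}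
    (hu : Measurable u) (hv : Measurable v) : Measurable fun q => taylorRem p (u q) (v q) := by
  unfold taylorRem
  fun_prop

theorem abs_self_mul_abs_rpow {p : ℝ} (hp : 1 < p) (a : ℝ) :
    |a * |a| ^ (p - 2)| = |a| ^ (p - 1) := by
  rw [abs_mul, abs_of_nonneg (Real.rpow_nonneg (abs_nonneg a) _),
    ← Real.rpow_one_add' (abs_nonneg _) (by linarith)]
  congr 1
  ring

theorem abs_rpow_sub_one_mul_le {p : ℝ} (hp : 1 < p) {a c : ℝ} (hc : 0 ≤ c) :
    |a| ^ (p - 1) * c ≤ |a| ^ p + c ^ p := by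
  have h1 : ∀ b : ℝ, 0 ≤ b → b ^ (p - 1) * b = b ^ p := fun b hb => by
    rw [mul_comm, ← Real.rpow_one_add' hb (by linarith)]
    congr 1
    ring
  rcases le_total c |a| with h | h
  · calc _ ≤ |a| ^ (p - 1) * |a| := by gcongr
      _ = |a| ^ p := h1 _ (abs_nonneg a)
      _ ≤ _ := le_add_of_nonneg_right (Real.rpow_nonneg hc p)
  · calc _ ≤ c ^ (p - 1) * c := by
          have : 0 ≤ p - 1 := by linarith
          gcongr
      _ = c ^ p := h1 _ hc
      _ ≤ _ := le_add_of_nonneg_left (Real.rpow_nonneg (abs_nonneg a) p)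

theorem abs_self_mul_abs_rpow_mul_le {p : ℝ} (hp : 1 < p) (a c : ℝ) :
    |a * |a| ^ (p - 2) * c| ≤ |a| ^ p + |c| ^ p := by
  rw [abs_mul, abs_self_mul_abs_rpow hp]
  exact abs_rpow_sub_one_mul_le hp (abs_nonneg c)

/-- The weight is later `κ = min(1, |y|²)` with `c` a second difference, whose `p`-th power
integrates to `O(κ^p)`. Both terms then become `O(κ)`, which is `ν`-integrable. -/
theorem abs_self_mul_abs_rpow_mul_le_of_pos {p : ℝ} (hp : 1 < p) (a c : ℝ) {κ : ℝ}
    (hκ : 0 < κ) : |a * |a| ^ (p - 2) * c| ≤ κ * |a| ^ p + κ * (κ ^ p)⁻¹ * |c| ^ p := by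
  have h := abs_self_mul_abs_rpow_mul_le hp a (c / κ)
  have h1 : a * |a| ^ (p - 2) * c = κ * (a * |a| ^ (p - 2) * (c / κ)) := by
    field_simp
  rw [h1, abs_mul, abs_of_pos hκ]
  rw [abs_div, abs_of_pos hκ, Real.div_rpow (abs_nonneg c) hκ.le] at h
  calc _ ≤ κ * (|a| ^ p + |c| ^ p / κ ^ p) := by gcongr
    _ = _ := by ring

theorem integrable_self_mul_abs_rpow_mul {p : ℝ} (hp : 1 < p)
    {u g : EuclideanSpace ℝ (Fin d) → ℝ} (hu : Measurable u) (hg : Measurable g)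
    (hup : Integrable fun x => |u x| ^ p) (hgp : Integrable fun x => |g x| ^ p) :
    Integrable fun x => u x * |u x| ^ (p - 2) * g x :=
  (hup.add hgp).mono' (by fun_prop : Measurable _).aestronglyMeasurable
    (ae_of_all _ fun x => abs_self_mul_abs_rpow_mul_le hp (u x) (g x))

/-- The increment of the energy in direction `y`. -/
def dirEnergy (p : ℝ) (u : EuclideanSpace ℝ (Fin d) → ℝ) (y : EuclideanSpace ℝ (Fin d)) : ℝ :=
  ∫ x, taylorRem p (u x) (u (x + y))

/-- By translation invariance `|u(x+y)|^p` and `|u(x)|^p` have the same integral, so only the linear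
term of the remainder survives. -/
theorem integrable_taylorRem {p : ℝ} (hp : 1 < p)
    {u : EuclideanSpace ℝ (Fin d) → ℝ} (hu : Measurable u)
    (hup : Integrable fun x => |u x| ^ p) (y : EuclideanSpace ℝ (Fin d)) :
    Integrable (fun x => taylorRem p (u x) (u (x + y))) ∧
      dirEnergy p u y = -p * ∫ x, u x * |u x| ^ (p - 2) * (u (x + y) - u x) := by
  have hy : Integrable fun x => |u (x + y)| ^ p := hup.comp_add_right y
  have h1 := integrable_self_mul_abs_rpow_mul hp hu (by fun_prop : Measurable fun x => u (x + y))
    hup hy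
  have h2 := integrable_self_mul_abs_rpow_mul hp hu hu hup hup
  have h3 : Integrable fun x => u x * |u x| ^ (p - 2) * (u (x + y) - u x) := by
    refine (h1.sub h2).congr (ae_of_all _ fun x => ?_)
    simp only [Pi.sub_apply]
    ring
  have h4 : ∀ x, taylorRem p (u x) (u (x + y))
      = (|u (x + y)| ^ p - |u x| ^ p) + -p * (u x * |u x| ^ (p - 2) * (u (x + y) - u x)) :=
    fun x => by
      unfold taylorRem
      ring
  have h5 : Integrable fun x => |u (x + y)| ^ p - |u x| ^ p := hy.sub hup
  refine ⟨(h5.add (h3.const_mul (-p))).congr (ae_of_all _ fun x => (h4 x).symm), ?_⟩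
  unfold dirEnergy
  simp_rw [h4]
  rw [integral_add h5 (h3.const_mul _), integral_sub hy hup,
    integral_add_right_eq_self (fun x => |u x| ^ p), sub_self, zero_add, integral_const_mul]

theorem dirEnergy_nonneg {p : ℝ} (hp : 1 < p) (u : EuclideanSpace ℝ (Fin d) → ℝ)
    (y : EuclideanSpace ℝ (Fin d)) : 0 ≤ dirEnergy p u y :=
  integral_nonneg fun _ => taylorRem_nonneg hp _ _

theorem integral_self_mul_secondDiff {p : ℝ} (hp : 1 < p)
    {u : EuclideanSpace ℝ (Fin d) → ℝ} (hu : Measurable u)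
    (hup : Integrable fun x => |u x| ^ p) (y : EuclideanSpace ℝ (Fin d)) :
    -p * ∫ x, u x * |u x| ^ (p - 2) * secondDiff u y x
      = dirEnergy p u y + dirEnergy p u (-y) := by
  have h1 : ∀ y, Integrable fun x => u x * |u x| ^ (p - 2) * (u (x + y) - u x) := fun y => by
    refine ((integrable_self_mul_abs_rpow_mul hp hu
      (by fun_prop : Measurable fun x => u (x + y)) hup (hup.comp_add_right y)).sub
      (integrable_self_mul_abs_rpow_mul hp hu hu hup hup)).congr (ae_of_all _ fun x => ?_)
    simp only [Pi.sub_apply]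
    ring
  rw [(integrable_taylorRem hp hu hup y).2, (integrable_taylorRem hp hu hup (-y)).2, ← mul_add,
    ← integral_add (h1 y) (h1 (-y))]
  congr 2
  ext x
  rw [secondDiff, sub_eq_add_neg x y]
  ring

/-- The `p`-form of the generator, in symmetrised form, is the energy integral. -/
theorem ofReal_neg_integral_self_mul_eq (hν : IsLevyMeasure ν) (hs : IsSymm ν) {p : ℝ}
    (hp : 1 < p) {u : EuclideanSpace ℝ (Fin d) → ℝ} (hu : Measurable u)
    (hup : Integrable fun x => |u x| ^ p) {C : ℝ}
    (hΔ : ∀ y, Integrable fun x => |secondDiff u y x| ^ p)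
    (hC : ∀ y, ∫ x, |secondDiff u y x| ^ p ≤ C * (min 1 (‖y‖ ^ 2)) ^ p) :
    0 ≤ -p * (∫ x, u x * |u x| ^ (p - 2) * (1 / 2 * ∫ y, secondDiff u y x ∂ν)) ∧
    ENNReal.ofReal (-p * ∫ x, u x * |u x| ^ (p - 2) * (1 / 2 * ∫ y, secondDiff u y x ∂ν))
      = ∫⁻ x, ∫⁻ y, ENNReal.ofReal (taylorRem p (u x) (u (x + y))) ∂ν := by
  have := hν.sigmaFinite
  have := hs.isNegInvariant
  have hΔm : Measurable fun q : EuclideanSpace ℝ (Fin d) × EuclideanSpace ℝ (Fin d) =>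
      secondDiff u q.1 q.2 := by
    unfold secondDiff
    fun_prop
  set G : EuclideanSpace ℝ (Fin d) × EuclideanSpace ℝ (Fin d) → ℝ := fun q =>
    u q.2 * |u q.2| ^ (p - 2) * secondDiff u q.1 q.2 with hG
  have hGm : Measurable G := by fun_prop
  -- Absolute integrability on the product space is what lets the `y`-integral inside the generator
  -- be exchanged with the `x`-integral.
  have hGi : Integrable G (ν.prod volume) := by
    rw [integrable_prod_iff hGm.aestronglyMeasurable]
    have hfix : ∀ y, Integrable fun x => G (y, x) := fun y =>
      integrable_self_mul_abs_rpow_mul hp hu (by fun_prop) hup (hΔ y)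
    refine ⟨ae_of_all _ hfix, (hν.integrable_min.mul_const ((∫ x, |u x| ^ p) + C)).mono'
      hGm.norm.aestronglyMeasurable.integral_prod_right' (ae_of_all _ fun y => ?_)⟩
    rw [Real.norm_eq_abs, abs_of_nonneg (integral_nonneg fun _ => norm_nonneg _)]
    rcases (min_one_sq_nonneg y).eq_or_lt with h0 | h0
    -- The weighted inequality needs a positive weight; it vanishes only at `y = 0`, where the
    -- second difference is zero.
    · have hy : y = 0 := by
        by_contra hy
        have h1 := norm_pos_iff.2 hy
        have : 0 < min 1 (‖y‖ ^ 2) := by positivity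
        exact this.ne h0
      have hz : ∀ x, G (y, x) = 0 := fun x => by
        simp only [hG, hy, secondDiff, add_zero, sub_zero]
        ring
      simp only [hz, norm_zero, integral_zero, ← h0, zero_mul]
      exact le_rfl
    · set κ := min 1 (‖y‖ ^ 2)
      calc ∫ x, ‖G (y, x)‖
          ≤ ∫ x, (κ * |u x| ^ p + κ * (κ ^ p)⁻¹ * |secondDiff u y x| ^ p) :=
            integral_mono (hfix y).norm ((hup.const_mul _).add ((hΔ y).const_mul _))
              fun x => abs_self_mul_abs_rpow_mul_le_of_pos hp _ _ h0
        _ = κ * (∫ x, |u x| ^ p) + κ * (κ ^ p)⁻¹ * ∫ x, |secondDiff u y x| ^ p := by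
            rw [integral_add (hup.const_mul _) ((hΔ y).const_mul _), integral_const_mul,
              integral_const_mul]
        _ ≤ κ * (∫ x, |u x| ^ p) + κ * (κ ^ p)⁻¹ * (C * κ ^ p) := by
            gcongr
            exact hC y
        _ = κ * ((∫ x, |u x| ^ p) + C) := by
            have : κ ^ p ≠ 0 := (Real.rpow_pos_of_pos h0 p).ne'
            field_simp
  have hinner : ∀ y, -p * (1 / 2 * ∫ x, G (y, x))
      = 1 / 2 * (dirEnergy p u y + dirEnergy p u (-y)) := fun y => by
    rw [← integral_self_mul_secondDiff hp hu hup y]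
    ring
  have hmain : -p * (∫ x, u x * |u x| ^ (p - 2) * (1 / 2 * ∫ y, secondDiff u y x ∂ν))
      = ∫ y, 1 / 2 * (dirEnergy p u y + dirEnergy p u (-y)) ∂ν := by
    simp_rw [← hinner]
    rw [integral_const_mul, integral_const_mul, integral_integral_swap hGi,
      ← integral_const_mul (1 / 2)]
    refine congrArg _ (integral_congr_ae (ae_of_all _ fun x => ?_))
    simp only [hG]
    rw [integral_const_mul]
    ring
  have hint : Integrable (fun y => 1 / 2 * (dirEnergy p u y + dirEnergy p u (-y))) ν := by
    simp_rw [← hinner]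
    exact (hGi.integral_prod_left.const_mul _).const_mul _
  have hnn : ∀ y, 0 ≤ 1 / 2 * (dirEnergy p u y + dirEnergy p u (-y)) := fun y => by
    have h1 := dirEnergy_nonneg hp u y
    have h2 := dirEnergy_nonneg hp u (-y)
    positivity
  have hFm : Measurable fun q : EuclideanSpace ℝ (Fin d) × EuclideanSpace ℝ (Fin d) =>
      taylorRem p (u q.2) (u (q.2 + q.1)) :=
    measurable_taylorRem (by fun_prop) (by fun_prop)
  have hEm : Measurable (dirEnergy p u) :=
    hFm.stronglyMeasurable.integral_prod_right.measurable
  have hE : ∫⁻ y, ENNReal.ofReal (dirEnergy p u y) ∂ν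
      = ∫⁻ x, ∫⁻ y, ENNReal.ofReal (taylorRem p (u x) (u (x + y))) ∂ν := by
    rw [← lintegral_lintegral_swap (f := fun y x =>
      ENNReal.ofReal (taylorRem p (u x) (u (x + y)))) hFm.ennreal_ofReal.aemeasurable]
    refine lintegral_congr fun y => ?_
    exact ofReal_integral_eq_lintegral_ofReal (integrable_taylorRem hp hu hup y).1
      (ae_of_all _ fun x => taylorRem_nonneg hp _ _)
  refine ⟨hmain ▸ integral_nonneg hnn, ?_⟩
  rw [hmain, ofReal_integral_eq_lintegral_ofReal hint (ae_of_all _ hnn), ← hE]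
  have h3 : ∀ y, ENNReal.ofReal (1 / 2 * (dirEnergy p u y + dirEnergy p u (-y)))
      = ENNReal.ofReal (1 / 2) * (ENNReal.ofReal (dirEnergy p u y)
        + ENNReal.ofReal (dirEnergy p u (-y))) := fun y => by
    rw [ENNReal.ofReal_mul (by norm_num),
      ENNReal.ofReal_add (dirEnergy_nonneg hp u _) (dirEnergy_nonneg hp u _)]
  simp_rw [h3]
  -- The symmetry of `ν` identifies the contributions of `y` and `-y`, so the factor `1/2` cancels.
  rw [lintegral_const_mul _ (by fun_prop), lintegral_add_left (by fun_prop),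
    lintegral_neg_eq_self (μ := ν) (fun y => ENNReal.ofReal (dirEnergy p u y)), ← two_mul,
    ← mul_assoc, one_div, ENNReal.ofReal_inv_of_pos two_pos, ENNReal.ofReal_ofNat,
    ENNReal.inv_mul_cancel two_ne_zero ENNReal.ofNat_ne_top, one_mul]

/-! ### The semigroup on `L^p` and the identity on compact time intervals -/

/-- The time derivative of `P_t f`. -/
def semigroupDeriv (ν : Measure (EuclideanSpace ℝ (Fin d))) (t : ℝ)
    (f : EuclideanSpace ℝ (Fin d) → ℝ) (x : EuclideanSpace ℝ (Fin d)) : ℝ :=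
  ∫ z, densityDeriv ν t (z - x) * f z

theorem Decay.kernelBound_density (hν : IsLevyMeasure ν) (hs : IsSymm ν) (h : Decay ν) {s : ℝ}
    (hs0 : 0 < s) (x : EuclideanSpace ℝ (Fin d)) :
    KernelBound s 1 (((2 * Real.pi) ^ d)⁻¹ *
      ∫ ξ : EuclideanSpace ℝ (Fin d), Real.exp (-(s * exponent ν ξ)))
      fun t z => density ν t (z - x) where
  integrable t ht := (h.integrable_density hν hs (hs0.trans ht)).comp_sub_right x
  abs_le t ht z := h.abs_density_le hν hs0 ht.le _
  integral_le t ht := by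
    have ht0 := hs0.trans ht
    rw [integral_sub_right_eq_self (fun z => |density ν t z|),
      ← h.integral_density hν hs ht0]
    exact (integral_congr_ae (ae_of_all _ fun z =>
      abs_of_nonneg (h.density_nonneg hν hs ht0 z))).le

theorem Decay.exists_kernelBound_densityDeriv (hν : IsLevyMeasure ν) (hs : IsSymm ν)
    (h : Decay ν) {s : ℝ} (hs0 : 0 < s) : ∃ A B : ℝ, ∀ x : EuclideanSpace ℝ (Fin d),
      KernelBound s A B fun t z => densityDeriv ν t (z - x) := by
  obtain ⟨A, -, hA⟩ := h.exists_integral_abs_densityDeriv_le hν hs hs0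
  exact ⟨A, _, fun x =>
    { integrable := fun t ht =>
        (h.integrable_densityDeriv hν hs (hs0.trans ht)).comp_sub_right x
      abs_le := fun t ht z => h.abs_densityDeriv_le hν hs0 ht.le _
      integral_le := fun t ht => by
        rw [integral_sub_right_eq_self (fun z => |densityDeriv ν t z|)]
        exact hA t ht.le }⟩

section

variable {p : ℝ} {f : EuclideanSpace ℝ (Fin d) → ℝ}

theorem Decay.hasDerivAt_semigroup (hν : IsLevyMeasure ν) (hs : IsSymm ν) (h : Decay ν)
    (hp : 1 < p) (hf : Measurable f) (hfp : Integrable fun x => |f x| ^ p) {t : ℝ} (ht : 0 < t)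
    (x : EuclideanSpace ℝ (Fin d)) :
    HasDerivAt (fun t => semigroup ν t f x) (semigroupDeriv ν t f x) t := by
  obtain ⟨A, B, hAB⟩ := h.exists_kernelBound_densityDeriv hν hs (half_pos ht)
  exact (h.kernelBound_density hν hs (half_pos ht) x).hasDerivAt (hAB x)
    (fun r hr z => h.hasDerivAt_density hν ((half_pos ht).trans hr) _) hp.le hf hfp
    (half_lt_self ht)

theorem Decay.continuousAt_semigroupDeriv (hν : IsLevyMeasure ν) (hs : IsSymm ν) (h : Decay ν)
    (hp : 1 < p) (hf : Measurable f) (hfp : Integrable fun x => |f x| ^ p) {t : ℝ} (ht : 0 < t)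
    (x : EuclideanSpace ℝ (Fin d)) : ContinuousAt (fun t => semigroupDeriv ν t f x) t := by
  obtain ⟨A, B, hAB⟩ := h.exists_kernelBound_densityDeriv hν hs (half_pos ht)
  exact ((hAB x).continuousOn (fun z => (h.continuousOn_densityDeriv hν _).mono
    (Set.Ioi_subset_Ioi (half_pos ht).le)) hp.le hf hfp).continuousAt
    (Ioi_mem_nhds (half_lt_self ht))

theorem measurable_semigroup (hν : IsLevyMeasure ν) (hf : Measurable f) :
    Measurable fun q : ℝ × EuclideanSpace ℝ (Fin d) => semigroup ν q.1 f q.2 := by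
  have h1 : Measurable fun q : (ℝ × EuclideanSpace ℝ (Fin d)) × EuclideanSpace ℝ (Fin d) =>
      density ν q.1.1 (q.2 - q.1.2) * f q.2 :=
    ((measurable_density hν).comp (by fun_prop : Measurable
      fun q : (ℝ × EuclideanSpace ℝ (Fin d)) × EuclideanSpace ℝ (Fin d) =>
        (q.1.1, q.2 - q.1.2))).mul (by fun_prop)
  exact h1.stronglyMeasurable.integral_prod_right.measurable

theorem measurable_semigroupDeriv (hν : IsLevyMeasure ν) (hf : Measurable f) :
    Measurable fun q : ℝ × EuclideanSpace ℝ (Fin d) => semigroupDeriv ν q.1 f q.2 := by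
  have h1 : Measurable fun q : (ℝ × EuclideanSpace ℝ (Fin d)) × EuclideanSpace ℝ (Fin d) =>
      densityDeriv ν q.1.1 (q.2 - q.1.2) * f q.2 :=
    ((measurable_densityDeriv hν).comp (by fun_prop : Measurable
      fun q : (ℝ × EuclideanSpace ℝ (Fin d)) × EuclideanSpace ℝ (Fin d) =>
        (q.1.1, q.2 - q.1.2))).mul (by fun_prop)
  exact h1.stronglyMeasurable.integral_prod_right.measurable

theorem measurable_semigroup_apply (hν : IsLevyMeasure ν) (hf : Measurable f) (t : ℝ) :
    Measurable (semigroup ν t f) :=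
  (show Measurable (Function.uncurry fun t x => semigroup ν t f x) from
    measurable_semigroup hν hf).of_uncurry_left

theorem measurable_semigroupDeriv_apply (hν : IsLevyMeasure ν) (hf : Measurable f) (t : ℝ) :
    Measurable (semigroupDeriv ν t f) :=
  (show Measurable (Function.uncurry fun t x => semigroupDeriv ν t f x) from
    measurable_semigroupDeriv hν hf).of_uncurry_left

theorem Decay.integrable_semigroup_rpow (hν : IsLevyMeasure ν) (hs : IsSymm ν) (h : Decay ν)
    (hp : 1 < p) (hf : Measurable f) (hfp : Integrable fun x => |f x| ^ p) {t : ℝ}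
    (ht : 0 < t) : Integrable (fun x => |semigroup ν t f x| ^ p) ∧
      ∫ x, |semigroup ν t f x| ^ p ≤ ∫ x, |f x| ^ p := by
  have h1 := integral_abs_integral_kernel_rpow_le hp (h.continuous_density hν ht).measurable
    (h.integrable_density hν hs ht) hf hfp
  have h2 : ∫ z, |density ν t z| = 1 := by
    rw [← h.integral_density hν hs ht]
    exact integral_congr_ae (ae_of_all _ fun z => abs_of_nonneg (h.density_nonneg hν hs ht z))
  rw [h2, Real.one_rpow, one_mul] at h1
  exact h1

theorem Decay.exists_integrable_semigroupDeriv_rpow (hν : IsLevyMeasure ν) (hs : IsSymm ν)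
    (h : Decay ν) (hp : 1 < p) (hf : Measurable f) (hfp : Integrable fun x => |f x| ^ p)
    {s : ℝ} (hs0 : 0 < s) : ∃ C : ℝ, ∀ t, s ≤ t →
      Integrable (fun x => |semigroupDeriv ν t f x| ^ p) ∧
      ∫ x, |semigroupDeriv ν t f x| ^ p ≤ C := by
  obtain ⟨A, hA0, hA⟩ := h.exists_integral_abs_densityDeriv_le hν hs hs0
  refine ⟨A ^ p * ∫ x, |f x| ^ p, fun t ht => ?_⟩
  have ht0 := hs0.trans_le ht
  have h1 := integral_abs_integral_kernel_rpow_le hp (h.continuous_densityDeriv hν ht0).measurable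
    (h.integrable_densityDeriv hν hs ht0) hf hfp
  refine ⟨h1.1, h1.2.trans (mul_le_mul_of_nonneg_right ?_ (integral_nonneg fun _ =>
    by positivity))⟩
  exact Real.rpow_le_rpow (integral_nonneg fun _ => abs_nonneg _) (hA t ht) (by linarith)

theorem Decay.secondDiff_semigroup (hν : IsLevyMeasure ν) (hs : IsSymm ν)
    (h : Decay ν) (hp : 1 < p) (hf : Measurable f) (hfp : Integrable fun x => |f x| ^ p)
    {t : ℝ} (ht : 0 < t) (y x : EuclideanSpace ℝ (Fin d)) :
    secondDiff (semigroup ν t f) y x = ∫ z, secondDiff (density ν t) y (z - x) * f z := by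
  have hi : ∀ x, Integrable fun z => density ν t (z - x) * f z := fun x =>
    integrable_kernel_mul hp.le hf hfp ((h.integrable_density hν hs ht).comp_sub_right x)
      fun z => h.abs_density_le hν ht le_rfl _
  have h1 : Integrable fun z => density ν t (z - (x + y)) * f z + density ν t (z - (x - y)) * f z :=
    (hi _).add (hi _)
  unfold secondDiff semigroup
  rw [← integral_add (hi _) (hi _), ← integral_const_mul,
    ← integral_sub h1 ((hi x).const_mul 2)]
  refine integral_congr_ae (ae_of_all _ fun z => ?_)
  simp only
  rw [show z - (x + y) = z - x - y by abel, show z - (x - y) = z - x + y by abel]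
  ring

/-- The generator formula for the density is transferred to `P_t f` by Fubini's theorem, which needs
the `L¹` and supremum bounds on second differences together. -/
theorem Decay.semigroupDeriv_eq (hν : IsLevyMeasure ν) (hs : IsSymm ν)
    (h : Decay ν) (hp : 1 < p) (hf : Measurable f) (hfp : Integrable fun x => |f x| ^ p)
    {t : ℝ} (ht : 0 < t) (x : EuclideanSpace ℝ (Fin d)) :
    semigroupDeriv ν t f x = 1 / 2 * ∫ y, secondDiff (semigroup ν t f) y x ∂ν := by
  have := hν.sigmaFinite
  obtain ⟨C, -, hC⟩ := h.exists_abs_secondDiff_density_le hν ht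
  have hk : Integrable (fun q : EuclideanSpace ℝ (Fin d) × EuclideanSpace ℝ (Fin d) =>
      secondDiff (density ν t) q.1 (q.2 - x)) (ν.prod volume) :=
    ((MeasurePreserving.id ν).prod
      (measurePreserving_sub_right volume x)).integrable_comp_of_integrable
      (h.integrable_secondDiff_density_prod hν hs ht)
  have hprod := integrable_prod_kernel_mul hp.le hf hfp hk (hν.integrable_min.const_mul C)
    fun q => hC t le_rfl q.1 _
  simp_rw [h.secondDiff_semigroup hν hs hp hf hfp ht]
  rw [integral_integral_swap hprod, ← integral_const_mul, semigroupDeriv]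
  refine integral_congr_ae (ae_of_all _ fun z => ?_)
  simp only
  rw [integral_mul_const, h.densityDeriv_eq_integral_secondDiff hν ht]
  ring

/-- The second difference of `P_t f` is `f` integrated against the second difference of `p_t`, so
Young's inequality raises its `L¹` bound to the power `p`. -/
theorem Decay.exists_integral_secondDiff_semigroup_le (hν : IsLevyMeasure ν) (hs : IsSymm ν)
    (h : Decay ν) (hp : 1 < p) (hf : Measurable f) (hfp : Integrable fun x => |f x| ^ p)
    {t : ℝ} (ht : 0 < t) : ∃ C : ℝ, ∀ y,
      Integrable (fun x => |secondDiff (semigroup ν t f) y x| ^ p) ∧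
      ∫ x, |secondDiff (semigroup ν t f) y x| ^ p ≤ C * (min 1 (‖y‖ ^ 2)) ^ p := by
  obtain ⟨A, hA0, hA⟩ := h.exists_integral_abs_secondDiff_density_le hν hs ht
  have hc := h.continuous_density hν ht
  refine ⟨A ^ p * ∫ x, |f x| ^ p, fun y => ?_⟩
  have h1 := integral_abs_integral_kernel_rpow_le hp
    (by unfold secondDiff; fun_prop : Measurable (secondDiff (density ν t) y))
    (integrable_secondDiff (h.integrable_density hν hs ht) y) hf hfp
  simp_rw [h.secondDiff_semigroup hν hs hp hf hfp ht]
  refine ⟨h1.1, h1.2.trans ?_⟩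
  rw [mul_right_comm, ← Real.mul_rpow hA0 (min_one_sq_nonneg y)]
  refine mul_le_mul_of_nonneg_right ?_ (integral_nonneg fun _ => by positivity)
  exact Real.rpow_le_rpow (integral_nonneg fun _ => abs_nonneg _) (hA t le_rfl y) (by linarith)

/-- The energy `∫∫ F(P_t f(x), P_t f(x+y)) ν(dy) dx`. -/
def energy (ν : Measure (EuclideanSpace ℝ (Fin d))) (p : ℝ)
    (f : EuclideanSpace ℝ (Fin d) → ℝ) (t : ℝ) : ℝ≥0∞ :=
  ∫⁻ x, ∫⁻ y, ENNReal.ofReal (taylorRem p (semigroup ν t f x) (semigroup ν t f (x + y))) ∂ν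

theorem Decay.ofReal_integral_semigroupDeriv (hν : IsLevyMeasure ν) (hs : IsSymm ν)
    (h : Decay ν) (hp : 1 < p) (hf : Measurable f) (hfp : Integrable fun x => |f x| ^ p)
    {t : ℝ} (ht : 0 < t) :
    0 ≤ -p * (∫ x, semigroup ν t f x * |semigroup ν t f x| ^ (p - 2) *
      semigroupDeriv ν t f x) ∧
    ENNReal.ofReal (-p * ∫ x, semigroup ν t f x * |semigroup ν t f x| ^ (p - 2) *
      semigroupDeriv ν t f x) = energy ν p f t := by
  obtain ⟨C, hC⟩ := h.exists_integral_secondDiff_semigroup_le hν hs hp hf hfp ht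
  simp_rw [h.semigroupDeriv_eq hν hs hp hf hfp ht]
  exact ofReal_neg_integral_self_mul_eq hν hs hp
    (measurable_semigroup_apply hν hf t)
    (h.integrable_semigroup_rpow hν hs hp hf hfp ht).1 (fun y => (hC y).1) fun y => (hC y).2

theorem Decay.semigroup_rpow_sub_eq (hν : IsLevyMeasure ν) (hs : IsSymm ν)
    (h : Decay ν) (hp : 1 < p) (hf : Measurable f) (hfp : Integrable fun x => |f x| ^ p)
    {s T : ℝ} (hs0 : 0 < s) (hsT : s ≤ T) (x : EuclideanSpace ℝ (Fin d)) :
    |semigroup ν s f x| ^ p - |semigroup ν T f x| ^ p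
      = ∫ t in Set.Ioc s T, -p * (semigroup ν t f x * |semigroup ν t f x| ^ (p - 2) *
        semigroupDeriv ν t f x) := by
  have hpos : ∀ t ∈ Set.uIcc s T, 0 < t := fun t ht => by
    rw [Set.uIcc_of_le hsT] at ht
    exact hs0.trans_le ht.1
  have hd : ∀ t ∈ Set.uIcc s T, HasDerivAt (fun t => |semigroup ν t f x| ^ p)
      (p * |semigroup ν t f x| ^ (p - 2) * semigroup ν t f x * semigroupDeriv ν t f x) t :=
    fun t ht => (hasDerivAt_abs_rpow _ hp).comp t
      (h.hasDerivAt_semigroup hν hs hp hf hfp (hpos t ht) x)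
  -- For `p < 2` the factor `|a|^(p-2)` is singular at 0. Continuity of the product is read off from
  -- its being the derivative of the `C¹` function `|a|^p`.
  have hcont : Continuous fun a : ℝ => p * |a| ^ (p - 2) * a := by
    have h1 : ContDiff ℝ 1 fun a : ℝ => |a| ^ p := by
      simpa using contDiff_norm_rpow (E := ℝ) hp
    have h2 := h1.continuous_deriv le_rfl
    convert h2 using 1
    ext a
    exact (hasDerivAt_abs_rpow a hp).deriv.symm
  have hi : IntervalIntegrable (fun t => p * |semigroup ν t f x| ^ (p - 2) * semigroup ν t f x *
      semigroupDeriv ν t f x) volume s T := by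
    refine ContinuousOn.intervalIntegrable fun t ht => ContinuousAt.continuousWithinAt ?_
    exact ContinuousAt.mul (hcont.continuousAt.comp
      (h.hasDerivAt_semigroup hν hs hp hf hfp (hpos t ht) x).continuousAt)
      (h.continuousAt_semigroupDeriv hν hs hp hf hfp (hpos t ht) x)
  have h1 := intervalIntegral.integral_eq_sub_of_hasDerivAt hd hi
  rw [intervalIntegral.integral_of_le hsT] at h1
  rw [← neg_sub, ← h1, ← integral_neg]
  refine integral_congr_ae (ae_of_all _ fun t => ?_)
  simp only
  ring

/-- For `t ≥ s > 0` the `L^p` norms of `P_t f` and of its time derivative are bounded uniformly in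
`t`. The second bound uses `s > 0`, so the identity is first proved away from time 0. -/
theorem Decay.integrable_prod_semigroupDeriv (hν : IsLevyMeasure ν) (hs : IsSymm ν)
    (h : Decay ν) (hp : 1 < p) (hf : Measurable f) (hfp : Integrable fun x => |f x| ^ p)
    {s T : ℝ} (hs0 : 0 < s) :
    Integrable (fun q : ℝ × EuclideanSpace ℝ (Fin d) => -p * (semigroup ν q.1 f q.2 *
      |semigroup ν q.1 f q.2| ^ (p - 2) * semigroupDeriv ν q.1 f q.2))
      ((volume.restrict (Set.Ioc s T)).prod volume) := by
  have hm1 := measurable_semigroup (f := f) hν hf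
  have hm2 := measurable_semigroupDeriv (f := f) hν hf
  have hm : Measurable fun q : ℝ × EuclideanSpace ℝ (Fin d) => semigroup ν q.1 f q.2 *
      |semigroup ν q.1 f q.2| ^ (p - 2) * semigroupDeriv ν q.1 f q.2 := by fun_prop
  obtain ⟨C, hC⟩ := h.exists_integrable_semigroupDeriv_rpow hν hs hp hf hfp hs0
  have hfix : ∀ t ∈ Set.Ioc s T, Integrable fun x => semigroup ν t f x *
      |semigroup ν t f x| ^ (p - 2) * semigroupDeriv ν t f x := fun t ht =>
    integrable_self_mul_abs_rpow_mul hp (measurable_semigroup_apply hν hf t)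
      (measurable_semigroupDeriv_apply hν hf t)
      (h.integrable_semigroup_rpow hν hs hp hf hfp (hs0.trans ht.1)).1 (hC t ht.1.le).1
  refine Integrable.const_mul ?_ (-p)
  rw [integrable_prod_iff hm.aestronglyMeasurable]
  refine ⟨(ae_restrict_iff' measurableSet_Ioc).2 (ae_of_all _ hfix),
    (integrable_const ((∫ x, |f x| ^ p) + C)).mono'
      hm.norm.aestronglyMeasurable.integral_prod_right'
      ((ae_restrict_iff' measurableSet_Ioc).2 (ae_of_all _ fun t ht => ?_))⟩
  rw [Real.norm_eq_abs, abs_of_nonneg (integral_nonneg fun _ => norm_nonneg _)]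
  have hu := h.integrable_semigroup_rpow hν hs hp hf hfp (hs0.trans ht.1)
  have hw := hC t ht.1.le
  calc _ ≤ ∫ x, (|semigroup ν t f x| ^ p + |semigroupDeriv ν t f x| ^ p) :=
        integral_mono (hfix t ht).norm (hu.1.add hw.1)
          fun x => abs_self_mul_abs_rpow_mul_le hp _ _
    _ = (∫ x, |semigroup ν t f x| ^ p) + ∫ x, |semigroupDeriv ν t f x| ^ p :=
        integral_add hu.1 hw.1
    _ ≤ _ := add_le_add hu.2 hw.2

/-- The Hardy–Stein identity on a compact time interval. -/
theorem Decay.lintegral_energy_Ioc (hν : IsLevyMeasure ν) (hs : IsSymm ν)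
    (h : Decay ν) (hp : 1 < p) (hf : Measurable f) (hfp : Integrable fun x => |f x| ^ p)
    {s T : ℝ} (hs0 : 0 < s) (hsT : s ≤ T) :
    ∫⁻ t in Set.Ioc s T, energy ν p f t = ENNReal.ofReal
      ((∫ x, |semigroup ν s f x| ^ p) - ∫ x, |semigroup ν T f x| ^ p) := by
  have hprod := h.integrable_prod_semigroupDeriv hν hs hp hf hfp (T := T) hs0
  have hus := h.integrable_semigroup_rpow hν hs hp hf hfp hs0
  have huT := h.integrable_semigroup_rpow hν hs hp hf hfp (hs0.trans_le hsT)
  rw [← integral_sub hus.1 huT.1]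
  simp_rw [h.semigroup_rpow_sub_eq hν hs hp hf hfp hs0 hsT]
  rw [← integral_integral_swap hprod]
  have h1 : ∀ t ∈ Set.Ioc s T, _ := fun t ht =>
    h.ofReal_integral_semigroupDeriv hν hs hp hf hfp (hs0.trans ht.1)
  refine Eq.trans ?_ (congrArg ENNReal.ofReal (integral_congr_ae (ae_of_all _ fun t =>
    (integral_const_mul (-p) _).symm)))
  have hi := hprod.integral_prod_left
  simp_rw [integral_const_mul (-p)] at hi
  rw [ofReal_integral_eq_lintegral_ofReal hi
    ((ae_restrict_iff' measurableSet_Ioc).2 (ae_of_all _ fun t ht => (h1 t ht).1))]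
  exact setLIntegral_congr_fun measurableSet_Ioc fun t ht => (h1 t ht).2.symm

end

/-! ### Decay as time tends to infinity -/

theorem exponent_natCast_smul_eq_zero (hν : IsLevyMeasure ν) {ξ : EuclideanSpace ℝ (Fin d)}
    (h : exponent ν ξ = 0) (n : ℕ) : exponent ν ((n : ℝ) • ξ) = 0 := by
  have h1 := (integral_eq_zero_iff_of_nonneg (fun y => one_sub_cos_nonneg (inner ℝ ξ y))
    (hν.integrable_one_sub_cos ξ)).1 h
  refine integral_eq_zero_of_ae ?_
  filter_upwards [h1] with y hy
  simp only [Pi.zero_apply] at hy ⊢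
  obtain ⟨k, hk⟩ := (Real.cos_eq_one_iff _).1 (sub_eq_zero.1 hy).symm
  rw [inner_smul_left, ← hk, sub_eq_zero, eq_comm, Real.cos_eq_one_iff]
  refine ⟨n * k, ?_⟩
  push_cast
  simp only [conj_trivial]
  ring

/-- If `ψ(ξ) = 0`, then `cos(ξ·y) = 1` for `ν`-almost every `y`, so `ψ` vanishes at all multiples
`nξ`, contrary to its growth at infinity. -/
theorem HartmanWintner.exponent_pos (hν : IsLevyMeasure ν) (h : HartmanWintner ν)
    {ξ : EuclideanSpace ℝ (Fin d)} (hξ : ξ ≠ 0) : 0 < exponent ν ξ := by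
  refine lt_of_le_of_ne (exponent_nonneg ξ) fun h0 => ?_
  obtain ⟨R, hR1, hR⟩ := h.exists_le 1
  have hpos := norm_pos_iff.2 hξ
  obtain ⟨n, hn⟩ := exists_nat_ge (R / ‖ξ‖)
  have h1 : R ≤ ‖(n : ℝ) • ξ‖ := by
    rw [norm_smul, Real.norm_natCast]
    exact (div_le_iff₀ hpos).1 hn
  have h2 := hR _ h1
  rw [exponent_natCast_smul_eq_zero hν h0.symm, one_mul] at h2
  exact absurd h2 (not_le.2 (Real.log_pos (hR1.trans_le h1)))

theorem HartmanWintner.tendsto_integral_exp (hd : 1 ≤ d) (hν : IsLevyMeasure ν)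
    (h : HartmanWintner ν) :
    Tendsto (fun n : ℕ => ∫ ξ : EuclideanSpace ℝ (Fin d),
      Real.exp (-(((n : ℝ) + 1) * exponent ν ξ))) atTop (𝓝 0) := by
  have hc := hν.continuous_exponent
  have hdec := h.decay hν
  -- For `d ≥ 1` the point 0, where the integrand stays equal to 1, is a Lebesgue null set.
  have : Nonempty (Fin d) := ⟨⟨0, hd⟩⟩
  have hlim := tendsto_integral_of_dominated_convergence (μ := volume)
    (F := fun (n : ℕ) (ξ : EuclideanSpace ℝ (Fin d)) =>
      Real.exp (-(((n : ℝ) + 1) * exponent ν ξ))) (f := fun _ => (0 : ℝ))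
    (fun ξ => Real.exp (-(1 * exponent ν ξ)))
    (fun n => (by fun_prop : Continuous _).aestronglyMeasurable)
    (hdec.integrable_exp hν one_pos)
    (fun n => ae_of_all _ fun ξ => ?_) ?_
  · simpa using hlim
  · rw [Real.norm_eq_abs, abs_of_pos (Real.exp_pos _)]
    have h1 := exponent_nonneg (ν := ν) ξ
    gcongr
    linarith [(n.cast_nonneg : (0 : ℝ) ≤ n)]
  · have h0 : ∀ᵐ ξ : EuclideanSpace ℝ (Fin d), ξ ≠ 0 := compl_mem_ae_iff.2 (measure_singleton 0)
    filter_upwards [h0] with ξ hξ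
    refine Real.tendsto_exp_neg_atTop_nhds_zero.comp ?_
    exact (tendsto_atTop_add_const_right _ 1 tendsto_natCast_atTop_atTop).atTop_mul_const
      (h.exponent_pos hν hξ)

section

variable {p : ℝ} {f g : EuclideanSpace ℝ (Fin d) → ℝ}

theorem Decay.semigroup_sub (hν : IsLevyMeasure ν) (hs : IsSymm ν) (h : Decay ν)
    (hp : 1 ≤ p) (hf : Measurable f) (hfp : Integrable fun x => |f x| ^ p) (hg : Measurable g)
    (hgp : Integrable fun x => |g x| ^ p) {t : ℝ} (ht : 0 < t) (x : EuclideanSpace ℝ (Fin d)) :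
    semigroup ν t (fun z => f z - g z) x = semigroup ν t f x - semigroup ν t g x := by
  have hi : ∀ {f : EuclideanSpace ℝ (Fin d) → ℝ}, Measurable f →
      (Integrable fun x => |f x| ^ p) → Integrable fun z => density ν t (z - x) * f z :=
    fun hf hfp => integrable_kernel_mul hp hf hfp
      ((h.integrable_density hν hs ht).comp_sub_right x) fun z => h.abs_density_le hν ht le_rfl _
  unfold semigroup
  rw [← integral_sub (hi hf hfp) (hi hg hgp)]
  simp_rw [mul_sub]

theorem lintegral_ofReal_abs_rpow (hp : 1 < p) (u : EuclideanSpace ℝ (Fin d) → ℝ) :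
    ∫⁻ x, ENNReal.ofReal (|u x| ^ p) = eLpNorm u (ENNReal.ofReal p) volume ^ p := by
  have hp0 : 0 < p := by linarith
  rw [eLpNorm_eq_lintegral_rpow_enorm_toReal (by simpa using hp0) ENNReal.ofReal_ne_top,
    ENNReal.toReal_ofReal hp0.le, ← ENNReal.rpow_mul, one_div_mul_cancel hp0.ne',
    ENNReal.rpow_one]
  refine lintegral_congr fun x => ?_
  rw [← ENNReal.ofReal_rpow_of_nonneg (abs_nonneg _) hp0.le, ← Real.norm_eq_abs, ofReal_norm]

theorem integrable_abs_rpow_of_memLp (hp : 1 < p) (hf : MemLp f (ENNReal.ofReal p) volume) :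
    Integrable fun x => |f x| ^ p := by
  have hp0 : 0 < p := by linarith
  have := hf.integrable_norm_rpow (by simpa using hp0) ENNReal.ofReal_ne_top
  simpa [ENNReal.toReal_ofReal hp0.le] using this

theorem Decay.eLpNorm_semigroup_le (hν : IsLevyMeasure ν) (hs : IsSymm ν) (h : Decay ν)
    (hp : 1 < p) (hf : Measurable f) {t : ℝ} (ht : 0 < t) :
    eLpNorm (semigroup ν t f) (ENNReal.ofReal p) volume
      ≤ eLpNorm f (ENNReal.ofReal p) volume := by
  have hp0 : 0 < p := by linarith
  have h1 := lintegral_abs_integral_kernel_rpow_le hp (h.continuous_density hν ht).measurable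
    (h.integrable_density hν hs ht) hf
  have h2 : ∫ z, |density ν t z| = 1 := by
    rw [← h.integral_density hν hs ht]
    exact integral_congr_ae (ae_of_all _ fun z => abs_of_nonneg (h.density_nonneg hν hs ht z))
  rw [h2, Real.one_rpow, ENNReal.ofReal_one, one_mul, lintegral_ofReal_abs_rpow hp,
    lintegral_ofReal_abs_rpow hp] at h1
  exact (ENNReal.rpow_le_rpow_iff hp0).1 h1

theorem Decay.abs_semigroup_le (hν : IsLevyMeasure ν) (h : Decay ν)
    (hg : Integrable g) {t : ℝ} (ht : 0 < t) (x : EuclideanSpace ℝ (Fin d)) :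
    |semigroup ν t g x| ≤ (((2 * Real.pi) ^ d)⁻¹ *
      ∫ ξ : EuclideanSpace ℝ (Fin d), Real.exp (-(t * exponent ν ξ))) * ∫ z, |g z| := by
  have hc := h.continuous_density hν ht
  rw [← integral_const_mul]
  refine abs_integral_le_integral_abs.trans (integral_mono (hg.bdd_mul
    (by fun_prop : Continuous _).aestronglyMeasurable
      (ae_of_all _ fun z => h.abs_density_le hν ht le_rfl _)).abs (hg.abs.const_mul _) fun z => ?_)
  simp only [abs_mul]
  exact mul_le_mul_of_nonneg_right (h.abs_density_le hν ht le_rfl _) (abs_nonneg _)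

theorem Decay.lintegral_semigroup_le (hν : IsLevyMeasure ν) (hs : IsSymm ν) (h : Decay ν)
    (hg : Measurable g) {t : ℝ} (ht : 0 < t) :
    ∫⁻ x, ENNReal.ofReal |semigroup ν t g x| ≤ ∫⁻ z, ENNReal.ofReal |g z| := by
  have hc := h.continuous_density hν ht
  calc ∫⁻ x, ENNReal.ofReal |semigroup ν t g x|
      ≤ ∫⁻ x, ∫⁻ z, ENNReal.ofReal (density ν t (z - x)) * ENNReal.ofReal |g z| := by
        refine lintegral_mono fun x => ?_
        rw [← Real.norm_eq_abs, ofReal_norm]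
        refine (enorm_integral_le_lintegral_enorm _).trans (le_of_eq ?_)
        refine lintegral_congr fun z => ?_
        rw [enorm_mul, ← ofReal_norm, ← ofReal_norm, Real.norm_eq_abs, Real.norm_eq_abs,
          abs_of_nonneg (h.density_nonneg hν hs ht _)]
    _ = ∫⁻ z, ∫⁻ x, ENNReal.ofReal (density ν t (z - x)) * ENNReal.ofReal |g z| :=
        lintegral_lintegral_swap (by fun_prop)
    _ = _ := by
        refine lintegral_congr fun z => ?_
        rw [lintegral_mul_const _ (by fun_prop),
          lintegral_sub_left_eq_self (fun x => ENNReal.ofReal (density ν t x)) z,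
          h.lintegral_density hν hs ht, one_mul]

/-- Interpolation: `‖P_t g‖_p^p ≤ ‖P_t g‖_∞^(p-1) ‖P_t g‖_1`. The supremum is at most a multiple of
`‖g‖_1 ∫ e^{-tψ}`, which tends to 0, and the `L¹` norm does not exceed that of `g`. -/
theorem HartmanWintner.tendsto_eLpNorm_semigroup_of_integrable (hd : 1 ≤ d)
    (hν : IsLevyMeasure ν) (hs : IsSymm ν) (h : HartmanWintner ν) (hp : 1 < p)
    (hg : Measurable g) (hgi : Integrable g) :
    Tendsto (fun n : ℕ => eLpNorm (semigroup ν ((n : ℝ) + 1) g) (ENNReal.ofReal p) volume)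
      atTop (𝓝 0) := by
  have hp0 : 0 < p := by linarith
  have hdec := h.decay hν
  set S : ℕ → ℝ := fun n => (((2 * Real.pi) ^ d)⁻¹ *
    ∫ ξ : EuclideanSpace ℝ (Fin d), Real.exp (-(((n : ℝ) + 1) * exponent ν ξ))) * ∫ z, |g z|
    with hS
  have hS0 : ∀ n, 0 ≤ S n := fun n => mul_nonneg (mul_nonneg invF_const_pos.le
    (integral_nonneg fun _ => (Real.exp_pos _).le)) (integral_nonneg fun _ => abs_nonneg _)
  have hSlim : Tendsto S atTop (𝓝 0) := by
    have := ((h.tendsto_integral_exp hd hν).const_mul ((2 * Real.pi) ^ d)⁻¹).mul_const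
      (∫ z, |g z|)
    simpa using this
  have hbound : ∀ n : ℕ, eLpNorm (semigroup ν ((n : ℝ) + 1) g) (ENNReal.ofReal p) volume ^ p
      ≤ ENNReal.ofReal (S n ^ (p - 1)) * ∫⁻ z, ENNReal.ofReal |g z| := by
    intro n
    have hn : (0 : ℝ) < (n : ℝ) + 1 := by positivity
    rw [← lintegral_ofReal_abs_rpow hp]
    calc ∫⁻ x, ENNReal.ofReal (|semigroup ν ((n : ℝ) + 1) g x| ^ p)
        ≤ ∫⁻ x, ENNReal.ofReal (S n ^ (p - 1))
          * ENNReal.ofReal |semigroup ν ((n : ℝ) + 1) g x| := by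
          refine lintegral_mono fun x => ?_
          rw [← ENNReal.ofReal_mul (Real.rpow_nonneg (hS0 n) _)]
          refine ENNReal.ofReal_le_ofReal ?_
          have h1 : |semigroup ν ((n : ℝ) + 1) g x| ^ p = |semigroup ν ((n : ℝ) + 1) g x| ^ (p - 1)
              * |semigroup ν ((n : ℝ) + 1) g x| := by
            rw [mul_comm, ← Real.rpow_one_add' (abs_nonneg _) (by linarith)]
            congr 1
            ring
          rw [h1]
          exact mul_le_mul_of_nonneg_right (Real.rpow_le_rpow (abs_nonneg _)
            (hdec.abs_semigroup_le hν hgi hn x) (by linarith)) (abs_nonneg _)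
      _ ≤ _ := by
          rw [lintegral_const_mul' _ _ ENNReal.ofReal_ne_top]
          exact mul_le_mul' le_rfl (hdec.lintegral_semigroup_le hν hs hg hn)
  have hfin : ∫⁻ z, ENNReal.ofReal |g z| ≠ ⊤ := by
    have := hgi.abs.2
    rw [hasFiniteIntegral_iff_ofReal (ae_of_all _ fun z => abs_nonneg _)] at this
    exact this.ne
  have hlim : Tendsto (fun n => ENNReal.ofReal (S n ^ (p - 1)) * ∫⁻ z, ENNReal.ofReal |g z|)
      atTop (𝓝 (ENNReal.ofReal (0 ^ (p - 1)) * ∫⁻ z, ENNReal.ofReal |g z|)) :=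
    ENNReal.Tendsto.mul_const ((ENNReal.continuous_ofReal.tendsto _).comp
      (hSlim.rpow_const (Or.inr (by linarith)))) (Or.inr hfin)
  rw [Real.zero_rpow (by linarith), ENNReal.ofReal_zero, zero_mul] at hlim
  have h2 := tendsto_of_tendsto_of_tendsto_of_le_of_le tendsto_const_nhds hlim
    (fun n => zero_le) hbound
  have h3 := h2.ennrpow_const p⁻¹
  simp only [← ENNReal.rpow_mul, mul_inv_cancel₀ hp0.ne', ENNReal.rpow_one] at h3
  rwa [ENNReal.zero_rpow_of_pos (inv_pos.2 hp0)] at h3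

/-! ### Behaviour as time tends to zero -/

theorem Decay.tendsto_semigroup_of_boundedContinuous (hν : IsLevyMeasure ν) (hs : IsSymm ν)
    (h : Decay ν) (g : BoundedContinuousFunction (EuclideanSpace ℝ (Fin d)) ℝ)
    (x : EuclideanSpace ℝ (Fin d)) :
    Tendsto (fun n : ℕ => semigroup ν (1 / ((n : ℝ) + 1)) g x) atTop (𝓝 (g x)) := by
  have hn : ∀ n : ℕ, (0 : ℝ) < 1 / ((n : ℝ) + 1) := fun n => by positivity
  have hc := fun n => h.continuous_density hν (hn n)
  have hi := fun n => h.integrable_density hν hs (hn n)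
  set μ : ℕ → Measure (EuclideanSpace ℝ (Fin d)) := fun n =>
    volume.withDensity fun z => ENNReal.ofReal (density ν (1 / ((n : ℝ) + 1)) z) with hμ
  have hprob : ∀ n, IsProbabilityMeasure (μ n) := fun n => ⟨by
    rw [hμ, withDensity_apply _ MeasurableSet.univ, Measure.restrict_univ]
    exact h.lintegral_density hν hs (hn n)⟩
  have hint : ∀ (n : ℕ) {F : Type} [NormedAddCommGroup F] [NormedSpace ℝ F]
      (G : EuclideanSpace ℝ (Fin d) → F),
      ∫ z, G z ∂(μ n) = ∫ z, density ν (1 / ((n : ℝ) + 1)) z • G z := by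
    intro n F _ _ G
    have hcn := hc n
    rw [hμ, integral_withDensity_eq_integral_toReal_smul (by fun_prop)
      (ae_of_all _ fun z => ENNReal.ofReal_lt_top)]
    simp_rw [ENNReal.toReal_ofReal (h.density_nonneg hν hs (hn n) _)]
  have hchar : ∀ n ξ, charFun (μ n) ξ
      = ((Real.exp (-(1 / ((n : ℝ) + 1) * exponent ν ξ)) : ℝ) : ℂ) := by
    intro n ξ
    rw [charFun_apply, hint, ← h.integral_cos_mul_density hν hs (hn n),
      ← integral_cexp_mul_of_even (hi n) (fun z => by
        rw [h.density_eq hν (hn n), levyDensity_neg])]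
    refine integral_congr_ae (ae_of_all _ fun z => ?_)
    simp only [Complex.real_smul]
    rw [mul_comm, mul_comm Complex.I]
  let M : ℕ → ProbabilityMeasure (EuclideanSpace ℝ (Fin d)) := fun n => ⟨μ n, hprob n⟩
  let M₀ : ProbabilityMeasure (EuclideanSpace ℝ (Fin d)) := ⟨Measure.dirac 0, inferInstance⟩
  have hM : ∀ n, (M n : Measure (EuclideanSpace ℝ (Fin d))) = μ n := fun _ => rfl
  have hM₀ : (M₀ : Measure (EuclideanSpace ℝ (Fin d))) = Measure.dirac 0 := rfl
  -- Lévy's continuity theorem: `e^{-tψ} → 1`, the characteristic function of the point mass at 0.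
  have hlim : Tendsto M atTop (𝓝 M₀) := by
    refine ProbabilityMeasure.tendsto_of_tendsto_charFun fun ξ => ?_
    simp only [hM, hM₀, hchar, charFun_dirac, inner_zero_left]
    have h1 : Tendsto (fun n : ℕ => Real.exp (-(1 / ((n : ℝ) + 1) * exponent ν ξ))) atTop
        (𝓝 (Real.exp (-(0 * exponent ν ξ)))) :=
      (Real.continuous_exp.tendsto _).comp
        ((tendsto_one_div_add_atTop_nhds_zero_nat (𝕜 := ℝ)).mul_const _).neg
    simpa [Function.comp_def] using (Complex.continuous_ofReal.tendsto _).comp h1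
  have h2 := ProbabilityMeasure.tendsto_iff_forall_integral_tendsto.1 hlim
    (g.compContinuous ⟨fun z => z + x, by fun_prop⟩)
  simp only [hM, hM₀, BoundedContinuousFunction.compContinuous_apply,
    ContinuousMap.coe_mk, hint, integral_dirac, zero_add, smul_eq_mul] at h2
  refine h2.congr fun n => ?_
  unfold semigroup
  rw [← integral_sub_right_eq_self
    (fun z => density ν (1 / ((n : ℝ) + 1)) z * g (z + x)) x]
  simp only [sub_add_cancel]

/-- Pointwise convergence and Fatou's lemma give a lower bound, which is all that is required since
`P_t` is a contraction. -/
theorem Decay.eLpNorm_le_liminf_of_hasCompactSupport (hν : IsLevyMeasure ν) (hs : IsSymm ν)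
    (h : Decay ν) (hg : Continuous g) (hgc : HasCompactSupport g) :
    eLpNorm g (ENNReal.ofReal p) volume ≤ liminf (fun n : ℕ =>
      eLpNorm (semigroup ν (1 / ((n : ℝ) + 1)) g) (ENNReal.ofReal p) volume) atTop := by
  obtain ⟨C, hC⟩ := hgc.exists_bound_of_continuous hg
  exact Lp.eLpNorm_lim_le_liminf_eLpNorm
    (fun n => (measurable_semigroup_apply hν hg.measurable _).aestronglyMeasurable) g
    (ae_of_all _ fun x => h.tendsto_semigroup_of_boundedContinuous hν hs
      (BoundedContinuousFunction.ofNormedAddCommGroup g hg C hC) x)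

end

/-! ### Extension to `L^p` by density, and the identity on the half-line -/

section

variable {p : ℝ} {f g : EuclideanSpace ℝ (Fin d) → ℝ}

theorem Decay.eLpNorm_semigroup_sub_le (hν : IsLevyMeasure ν) (hs : IsSymm ν) (h : Decay ν)
    (hp : 1 < p) (hf : Measurable f) (hfp : Integrable fun x => |f x| ^ p) (hg : Measurable g)
    (hgp : Integrable fun x => |g x| ^ p) {t : ℝ} (ht : 0 < t) :
    eLpNorm (semigroup ν t f) (ENNReal.ofReal p) volume
      ≤ eLpNorm (semigroup ν t g) (ENNReal.ofReal p) volume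
        + eLpNorm (f - g) (ENNReal.ofReal p) volume := by
  have h1 : semigroup ν t f = semigroup ν t g + semigroup ν t (f - g) := by
    ext x
    have := h.semigroup_sub hν hs hp.le hf hfp hg hgp ht x
    rw [Pi.add_apply, show f - g = fun z => f z - g z from rfl, this]
    ring
  have hp1 : 1 ≤ ENNReal.ofReal p := by
    rw [← ENNReal.ofReal_one]
    exact ENNReal.ofReal_le_ofReal hp.le
  rw [h1]
  refine (eLpNorm_add_le (measurable_semigroup_apply hν hg t).aestronglyMeasurable
    (measurable_semigroup_apply hν (hf.sub hg) t).aestronglyMeasurable hp1).trans ?_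
  exact add_le_add le_rfl (h.eLpNorm_semigroup_le hν hs hp (hf.sub hg) ht)

theorem HartmanWintner.tendsto_eLpNorm_semigroup_atTop (hd : 1 ≤ d) (hν : IsLevyMeasure ν)
    (hs : IsSymm ν) (h : HartmanWintner ν) (hp : 1 < p) (hf : Measurable f)
    (hfp : MemLp f (ENNReal.ofReal p) volume) :
    Tendsto (fun n : ℕ => eLpNorm (semigroup ν ((n : ℝ) + 1) f) (ENNReal.ofReal p) volume)
      atTop (𝓝 0) := by
  have hdec := h.decay hν
  rw [ENNReal.tendsto_nhds_zero]
  intro ε hε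
  have hε2 : ε / 2 ≠ 0 := (ENNReal.half_pos hε.ne').ne'
  obtain ⟨g, hgc, hfg, hg, hgp⟩ :=
    hfp.exists_hasCompactSupport_eLpNorm_sub_le ENNReal.ofReal_ne_top hε2
  have hgi : Integrable g := hg.integrable_of_hasCompactSupport hgc
  have h1 := ENNReal.tendsto_nhds_zero.1 (h.tendsto_eLpNorm_semigroup_of_integrable hd hν hs hp
    hg.measurable hgi) (ε / 2) (ENNReal.half_pos hε.ne')
  filter_upwards [h1] with n hn
  calc _ ≤ _ := hdec.eLpNorm_semigroup_sub_le hν hs hp hf (integrable_abs_rpow_of_memLp hp hfp)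
        hg.measurable (integrable_abs_rpow_of_memLp hp hgp) (by positivity)
    _ ≤ ε / 2 + ε / 2 := add_le_add hn hfg
    _ = ε := ENNReal.add_halves ε

/-- Contractivity gives the upper bound. The lower bound passes from compactly supported continuous
functions to `f`, approximation costing half of the gap `r` twice: once at time 0 and once at time
`t`. Convergence of norms suffices here; strong continuity is not needed. -/
theorem Decay.tendsto_eLpNorm_semigroup_zero (hν : IsLevyMeasure ν)
    (hs : IsSymm ν) (h : Decay ν) (hp : 1 < p) (hf : Measurable f)
    (hfp : MemLp f (ENNReal.ofReal p) volume) :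
    Tendsto (fun n : ℕ => eLpNorm (semigroup ν (1 / ((n : ℝ) + 1)) f) (ENNReal.ofReal p) volume)
      atTop (𝓝 (eLpNorm f (ENNReal.ofReal p) volume)) := by
  have hp1 : 1 ≤ ENNReal.ofReal p := by
    rw [← ENNReal.ofReal_one]
    exact ENNReal.ofReal_le_ofReal hp.le
  have hn : ∀ n : ℕ, (0 : ℝ) < 1 / ((n : ℝ) + 1) := fun n => by positivity
  refine tendsto_order.2 ⟨fun a ha => ?_, fun a ha => Eventually.of_forall fun n =>
    (h.eLpNorm_semigroup_le hν hs hp hf (hn n)).trans_lt ha⟩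
  obtain ⟨r, hr0, hr⟩ := ENNReal.lt_iff_exists_add_pos_lt.1 ha
  have hr2 : (r : ℝ≥0∞) / 2 ≠ 0 := (ENNReal.half_pos (by exact_mod_cast hr0.ne')).ne'
  have hrtop : (r : ℝ≥0∞) / 2 ≠ ⊤ := (ENNReal.div_lt_top ENNReal.coe_ne_top two_ne_zero).ne
  obtain ⟨g, hgc, hfg, hg, hgp⟩ :=
    hfp.exists_hasCompactSupport_eLpNorm_sub_le ENNReal.ofReal_ne_top hr2
  have hgf : eLpNorm (g - f) (ENNReal.ofReal p) volume ≤ r / 2 := by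
    rwa [eLpNorm_sub_comm]
  have h1 : eLpNorm f (ENNReal.ofReal p) volume
      ≤ eLpNorm g (ENNReal.ofReal p) volume + r / 2 := by
    have h2 : f = g + (f - g) := by abel
    calc eLpNorm f (ENNReal.ofReal p) volume
        = eLpNorm (g + (f - g)) (ENNReal.ofReal p) volume := by rw [← h2]
      _ ≤ _ := eLpNorm_add_le hgp.1 (hfp.1.sub hgp.1) hp1
      _ ≤ _ := add_le_add le_rfl hfg
  have h3 : a + r / 2 < eLpNorm g (ENNReal.ofReal p) volume := by
    rw [← ENNReal.add_lt_add_iff_right hrtop, add_assoc, ENNReal.add_halves]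
    exact hr.trans_le h1
  have h4 := eventually_lt_of_lt_liminf
    (h3.trans_le (h.eLpNorm_le_liminf_of_hasCompactSupport (p := p) hν hs hg hgc))
  filter_upwards [h4] with n h5
  have h6 := h.eLpNorm_semigroup_sub_le hν hs hp hg.measurable
    (integrable_abs_rpow_of_memLp hp hgp) hf (integrable_abs_rpow_of_memLp hp hfp) (hn n)
  exact (ENNReal.add_lt_add_iff_right hrtop).1 (h5.trans_le (h6.trans (add_le_add le_rfl hgf)))

theorem Decay.ofReal_integral_semigroup_rpow (hν : IsLevyMeasure ν)
    (hs : IsSymm ν) (h : Decay ν) (hp : 1 < p) (hf : Measurable f)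
    (hfp : MemLp f (ENNReal.ofReal p) volume) {t : ℝ} (ht : 0 < t) :
    ENNReal.ofReal (∫ x, |semigroup ν t f x| ^ p)
      = eLpNorm (semigroup ν t f) (ENNReal.ofReal p) volume ^ p := by
  rw [← lintegral_ofReal_abs_rpow hp]
  exact ofReal_integral_eq_lintegral_ofReal
    (h.integrable_semigroup_rpow hν hs hp hf (integrable_abs_rpow_of_memLp hp hfp) ht).1
    (ae_of_all _ fun x => by positivity)

/-- The intervals `(1/(n+1), n+1]` increase to `(0, ∞)`, so monotone convergence handles the energy
side while the boundary terms converge to `‖f‖_p^p` and 0. -/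
theorem HartmanWintner.lintegral_energy (hd : 1 ≤ d) (hν : IsLevyMeasure ν)
    (hs : IsSymm ν) (h : HartmanWintner ν) (hp : 1 < p) (hf : Measurable f)
    (hfp : MemLp f (ENNReal.ofReal p) volume) :
    ∫⁻ x, ENNReal.ofReal (|f x| ^ p) = ∫⁻ t in Set.Ioi (0 : ℝ), energy ν p f t := by
  have hp0 : 0 < p := by linarith
  have hdec := h.decay hν
  set A : ℕ → Set ℝ := fun n => Set.Ioc (1 / ((n : ℝ) + 1)) ((n : ℝ) + 1) with hA
  have hmono : Monotone A := fun m n hmn => by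
    have h1 : (m : ℝ) + 1 ≤ (n : ℝ) + 1 := by
      have : (m : ℝ) ≤ n := by exact_mod_cast hmn
      linarith
    exact Set.Ioc_subset_Ioc (one_div_le_one_div_of_le (by positivity) h1) h1
  have hU : ⋃ n, A n = Set.Ioi 0 := by
    ext t
    simp only [hA, Set.mem_iUnion, Set.mem_Ioc, Set.mem_Ioi]
    refine ⟨fun ⟨n, hn, _⟩ => lt_trans (by positivity) hn, fun ht => ?_⟩
    obtain ⟨m, hm⟩ := exists_nat_one_div_lt ht
    obtain ⟨k, hk⟩ := exists_nat_ge t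
    refine ⟨max m k, lt_of_le_of_lt (one_div_le_one_div_of_le (by positivity) ?_) hm, ?_⟩
    · have : (m : ℝ) ≤ (max m k : ℕ) := by exact_mod_cast le_max_left m k
      linarith
    · have : (k : ℝ) ≤ (max m k : ℕ) := by exact_mod_cast le_max_right m k
      linarith
  have hsup : ∫⁻ t in Set.Ioi (0 : ℝ), energy ν p f t
      = ⨆ n, ∫⁻ t in A n, energy ν p f t := by
    rw [← hU]
    exact setLIntegral_iUnion_of_directed _ hmono.directed_le
  have hlim1 : Tendsto (fun n => ∫⁻ t in A n, energy ν p f t) atTop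
      (𝓝 (∫⁻ t in Set.Ioi (0 : ℝ), energy ν p f t)) := by
    rw [hsup]
    exact tendsto_atTop_iSup fun m n hmn => lintegral_mono_set (hmono hmn)
  have hA' : ∀ n : ℕ, ∫⁻ t in A n, energy ν p f t
      = eLpNorm (semigroup ν (1 / ((n : ℝ) + 1)) f) (ENNReal.ofReal p) volume ^ p
        - eLpNorm (semigroup ν ((n : ℝ) + 1) f) (ENNReal.ofReal p) volume ^ p := by
    intro n
    have hn : (0 : ℝ) ≤ n := n.cast_nonneg
    have hle : 1 / ((n : ℝ) + 1) ≤ (n : ℝ) + 1 :=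
      (div_le_one (by positivity) |>.2 (by linarith)).trans (by linarith)
    rw [hdec.lintegral_energy_Ioc hν hs hp hf (integrable_abs_rpow_of_memLp hp hfp)
      (by positivity) hle, ENNReal.ofReal_sub _ (integral_nonneg fun _ => by positivity),
      hdec.ofReal_integral_semigroup_rpow hν hs hp hf hfp (by positivity),
      hdec.ofReal_integral_semigroup_rpow hν hs hp hf hfp (by positivity)]
  -- Subtraction in `ℝ≥0∞` is continuous here because the limit `‖f‖_p^p` is finite.
  have hlim2 := ENNReal.Tendsto.sub
    ((hdec.tendsto_eLpNorm_semigroup_zero hν hs hp hf hfp).ennrpow_const p)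
    ((h.tendsto_eLpNorm_semigroup_atTop hd hν hs hp hf hfp).ennrpow_const p)
    (Or.inl (ENNReal.rpow_ne_top_of_nonneg hp0.le hfp.2.ne))
  rw [ENNReal.zero_rpow_of_pos hp0, tsub_zero, ← lintegral_ofReal_abs_rpow hp] at hlim2
  simp_rw [← hA'] at hlim2
  exact tendsto_nhds_unique hlim2 hlim1

end

theorem semigroup_congr_ae {f g : EuclideanSpace ℝ (Fin d) → ℝ} (h : f =ᵐ[volume] g) (t : ℝ) :
    semigroup ν t f = semigroup ν t g := by
  ext x
  refine integral_congr_ae ?_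
  filter_upwards [h] with z hz
  rw [hz]

end HardyStein

end

theorem theorem3p2 (d : ℕ) (hd : 1 ≤ d) (ν : Measure (EuclideanSpace ℝ (Fin d)))
    (hν : HardyStein.IsLevyMeasure ν) (hsymm : HardyStein.IsSymm ν)
    (hHW : HardyStein.HartmanWintner ν) (p : ℝ) (hp : 1 < p)
    (f : EuclideanSpace ℝ (Fin d) → ℝ) (hf : MemLp f (ENNReal.ofReal p) volume) :
    ∫⁻ x, ENNReal.ofReal (|f x| ^ p) =
      ∫⁻ t in Set.Ioi (0 : ℝ), ∫⁻ x : EuclideanSpace ℝ (Fin d),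
        ∫⁻ y : EuclideanSpace ℝ (Fin d),
          ENNReal.ofReal (HardyStein.taylorRem p
            (HardyStein.semigroup ν t f x) (HardyStein.semigroup ν t f (x + y))) ∂ν := by
  -- A measurable representative may be used: `P_t f` is given by an integral, hence unchanged at
  -- every point when `f` is altered on a null set.
  have hae := hf.1.ae_eq_mk
  have h := hHW.lintegral_energy hd hν hsymm hp hf.1.stronglyMeasurable_mk.measurable
    (hf.ae_eq hae)
  have h1 : ∫⁻ x, ENNReal.ofReal (|f x| ^ p) = ∫⁻ x, ENNReal.ofReal (|hf.1.mk f x| ^ p) := by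
    refine lintegral_congr_ae ?_
    filter_upwards [hae] with x hx
    rw [hx]
  simp only [HardyStein.semigroup_congr_ae hae]
  exact h1.trans h
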